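/- Let $n,k,N$ be positive integers with $k>n+1$, and let $\chi$ be a Dirichlet character modulo $N$ with $\chi(-1)=(-1)^k$, where $N>2$ or $k$ is even. Notation. Write elements of $Sp_n(\mathbb Z)$ in $n\times n$ blocks $\begin{pmatrix}A&B\\C&D\end{pmatrix}$. Let $\Gamma_\infty^+$ be the subgroup given by $C=0$, $\det A=1$; let $\Gamma_0(N)$ be the subgroup given by $C\equiv0\ (N)$; let $\Gamma(N)$ be the subgroup of matrices congruent to $I$ modulo $N$. For $\delta=\begin{pmatrix}A&B\\C&D\end{pmatrix}\in\Gamma_0(N)$ put $\chi(\delta)=\chi(\det D)$. For a function $f$ on the Siegel upper half space $\mathfrak h_n$ and $\gamma\in Sp_n(\mathbb Z)$ let $(f|\gamma)(\tau)=\det(C\tau+D)^{-k}f((A\tau+B)(C\tau+D)^{-1})$. Put $\gamma_\pm=\begin{pmatrix}G_\pm&\\&G_\pm\end{pmatrix}$ with $G_\pm=\mathrm{diag}(-1,1,\dots,1)$. Let $$\mathbb E^*=\sum_{\delta^*}1|\delta^*,$$ where $\delta^*\in\Gamma(N)$ varies so that $\Gamma_\infty^+\Gamma(N)=\bigsqcup_{\delta^*}\Gamma_\infty^+\delta^*$.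 For $\gamma\in Sp_n(\mathbb Z)$ let $\Gamma_\gamma^+=\{\delta\in\Gamma_0(N):\Gamma_\infty^+\Gamma(N)\gamma\delta=\Gamma_\infty^+\Gamma(N)\gamma\}$ and $$\mathbb E_\gamma=\frac1{2[\Gamma_\gamma^+:\Gamma(N)]}\Big(\sum_\beta\overline\chi(\beta)\,\mathbb E^*|\gamma\beta+\sum_\beta\overline\chi(\gamma_\pm\beta)\,\mathbb E^*|\gamma_\pm\gamma\beta\Big),$$ where $\beta$ varies so that $\Gamma_0(N)=\bigsqcup_\beta\Gamma(N)\beta$. For an integral symmetric $n\times n$ matrix $M$ put $\gamma_M=\begin{pmatrix}I&0\\M&I\end{pmatrix}\in Sp_n(\mathbb Z)$. For integers $v,w$ with $(vw,N)=1$ put $$(v,w)\cdot M=v\begin{pmatrix}w&\\&I_{n-1}\end{pmatrix}M\begin{pmatrix}w&\\&I_{n-1}\end{pmatrix},\qquad (v,w)\cdot\gamma_M=\gamma_{(v,w)\cdot M}.$$ Proposition 5.1. Let $v,w$ be integers with $(vw,N)=1$, and let $M,M'$ be integral symmetric $n\times n$ matrices. (a) If $v'\equiv v\ (N)$ and $w'\equiv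 w\ (N)$, then $(v',w')\cdot\gamma_M\in\big((v,w)\cdot\gamma_M\big)\Gamma(N)$ and $\mathbb E_{(v,w)\cdot\gamma_M}=\mathbb E_{(v',w')\cdot\gamma_M}$. (b) If $\mathbb E_{\gamma_M}=\mathbb E_{\gamma_{M'}}$, then $\mathbb E_{(v,w)\cdot\gamma_M}=\mathbb E_{(v,w)\cdot\gamma_{M'}}$. (c) Consequently the rule $(v,w)\cdot\mathbb E_{\gamma_M}=\mathbb E_{(v,w)\cdot\gamma_M}$ is a well-defined action of the group $(\mathbb Z/N\mathbb Z)^\times\times(\mathbb Z/N\mathbb Z)^\times$ on the set $\{\mathbb E_{\gamma_M}: M \text{ integral symmetric}\}$. (d) Suppose $N$ is square-free. Let $\sigma=(N_0,\dots,N_n)$ be positive integers with $N_0\cdots N_n=N$, and let $M_\sigma$ be an integral symmetric matrix with $M_\sigma\equiv\begin{pmatrix}I_d&\\&0\end{pmatrix}\ (N_d)$ for $0\le d\le n$. Write $\mathbb E_\sigma=\mathbb E_{\gamma_{M_\sigma}}$ and $\mathbb E_{(v,w)\cdot\sigma}=\mathbb E_{(v,w)\cdot\gamma_{M_\sigma}}$,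 and let $\chi=\prod_{d=0}^n\chi_{N_d}$ be the factorization of $\chi$ into characters $\chi_{N_d}$ modulo $N_d$. Then $$\mathbb E_{(v,w)\cdot\sigma}=\Big(\overline\chi_{N_n}(w^2)\prod_{0<d\le n}\overline\chi_{N_d}(v^d)\Big)\,\mathbb E_\sigma .$$ -/

import Mathlib

open scoped Pointwise

namespace SiegelEis

/-- `Sp_n(ℤ)`, the group of integral symplectic `2n × 2n` matrices, in `n × n` blocks. -/
abbrev Sp (n : ℕ) : Type := Matrix.symplecticGroup (Fin n) ℤ

/-- The blocks of `γ = (A B; C D)`. -/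
def blkA {n : ℕ} (γ : Sp n) : Matrix (Fin n) (Fin n) ℤ := γ.1.toBlocks₁₁
/-- The upper right block. -/
def blkB {n : ℕ} (γ : Sp n) : Matrix (Fin n) (Fin n) ℤ := γ.1.toBlocks₁₂
/-- The lower left block. -/
def blkC {n : ℕ} (γ : Sp n) : Matrix (Fin n) (Fin n) ℤ := γ.1.toBlocks₂₁
/-- The lower right block. -/
def blkD {n : ℕ} (γ : Sp n) : Matrix (Fin n) (Fin n) ℤ := γ.1.toBlocks₂₂

theorem blkA_mul {n : ℕ} (γ δ : Sp n) :
    blkA (γ * δ) = blkA γ * blkA δ + blkB γ * blkC δ := by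
  ext i j
  simp [blkA, blkB, blkC, Matrix.toBlocks₁₁, Matrix.toBlocks₁₂, Matrix.toBlocks₂₁,
    Matrix.mul_apply, Fintype.sum_sum_type]

theorem blkC_mul {n : ℕ} (γ δ : Sp n) :
    blkC (γ * δ) = blkC γ * blkA δ + blkD γ * blkC δ := by
  ext i j
  simp [blkA, blkC, blkD, Matrix.toBlocks₁₁, Matrix.toBlocks₂₁, Matrix.toBlocks₂₂,
    Matrix.mul_apply, Fintype.sum_sum_type]

theorem blkA_inv {n : ℕ} (γ : Sp n) : blkA γ⁻¹ = (blkD γ).transpose := by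
  rw [blkA, blkD, SymplecticGroup.coe_inv, Matrix.J]
  conv_lhs => rw [← Matrix.fromBlocks_toBlocks γ.1]
  simp [Matrix.fromBlocks_neg, Matrix.fromBlocks_transpose, Matrix.fromBlocks_multiply]

theorem blkC_inv {n : ℕ} (γ : Sp n) : blkC γ⁻¹ = -(blkC γ).transpose := by
  rw [blkC, blkC, SymplecticGroup.coe_inv, Matrix.J]
  conv_lhs => rw [← Matrix.fromBlocks_toBlocks γ.1]
  simp [Matrix.fromBlocks_neg, Matrix.fromBlocks_transpose, Matrix.fromBlocks_multiply]

theorem det_blkD_of_blkC {n : ℕ} (γ : Sp n) (hC : blkC γ = 0) (hA : (blkA γ).det = 1) :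
    (blkD γ).det = 1 := by
  have h := SymplecticGroup.det_eq_one γ.2
  rw [← Matrix.fromBlocks_toBlocks γ.1] at h
  change (Matrix.fromBlocks (blkA γ) (blkB γ) (blkC γ) (blkD γ)).det = 1 at h
  rw [hC, Matrix.det_fromBlocks_zero₂₁, hA, one_mul] at h
  exact h

/-- `Γ_∞⁺ = {(A B; 0 D) ∈ Sp_n(ℤ) : det A = 1}`. -/
def GammaInfPlus (n : ℕ) : Subgroup (Sp n) where
  carrier := {γ | blkC γ = 0 ∧ (blkA γ).det = 1}
  one_mem' := by
    constructor
    · ext i j; simp [blkC, Matrix.toBlocks₂₁]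
    · have : blkA (1 : Sp n) = 1 := by
        ext i j; simp [blkA, Matrix.toBlocks₁₁, Matrix.one_apply]
      simp [this]
  mul_mem' := by
    rintro a b ⟨ha, ha'⟩ ⟨hb, hb'⟩
    refine ⟨?_, ?_⟩
    · rw [blkC_mul, ha, hb]; simp
    · rw [blkA_mul, hb]; simp [ha', hb']
  inv_mem' := by
    rintro a ⟨ha, ha'⟩
    refine ⟨?_, ?_⟩
    · rw [blkC_inv, ha]; simp
    · rw [blkA_inv, Matrix.det_transpose, det_blkD_of_blkC a ha ha']

/-- The principal congruence subgroup `Γ(N) = {γ ∈ Sp_n(ℤ) : γ ≡ I (mod N)}`. -/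
def Gamma (n N : ℕ) : Subgroup (Sp n) where
  carrier := {γ | γ.1.map (Int.castRingHom (ZMod N)) = 1}
  one_mem' := by simp
  mul_mem' := by
    intro a b ha hb
    simp only [Set.mem_ofPred_eq] at ha hb ⊢
    rw [Submonoid.coe_mul, Matrix.map_mul, ha, hb, one_mul]
  inv_mem' := by
    intro a ha
    simp only [Set.mem_ofPred_eq] at ha ⊢
    have h : (a * a⁻¹ : Sp n).1.map (Int.castRingHom (ZMod N)) = 1 := by simp
    rwa [Submonoid.coe_mul, Matrix.map_mul, ha, one_mul] at h

/-- `Γ₀(N) = {(A B; C D) ∈ Sp_n(ℤ) : C ≡ 0 (mod N)}`. -/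
def Gamma0 (n N : ℕ) : Subgroup (Sp n) where
  carrier := {γ | (blkC γ).map (Int.castRingHom (ZMod N)) = 0}
  one_mem' := by ext i j; simp [blkC, Matrix.toBlocks₂₁]
  mul_mem' := by
    intro a b ha hb
    simp only [Set.mem_ofPred_eq] at ha hb ⊢
    rw [blkC_mul, Matrix.map_add _ (map_add _), Matrix.map_mul, Matrix.map_mul, ha, hb]
    simp
  inv_mem' := by
    intro a ha
    simp only [Set.mem_ofPred_eq] at ha ⊢
    ext i j
    have := congrFun (congrFun ha j) i
    simpa [blkC_inv] using this

/-- The Siegel upper half space: symmetric complex `n × n` matrices with positive definite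
imaginary part. -/
def HSpace (n : ℕ) : Type :=
  {τ : Matrix (Fin n) (Fin n) ℂ // τ.IsSymm ∧ (τ.map Complex.im).PosDef}

/-- The factor `Cτ + D`. -/
noncomputable def denom {n : ℕ} (γ : Sp n) (τ : Matrix (Fin n) (Fin n) ℂ) :
    Matrix (Fin n) (Fin n) ℂ :=
  (blkC γ).map (Int.cast : ℤ → ℂ) * τ + (blkD γ).map (Int.cast : ℤ → ℂ)

/-- The fractional linear action `τ ↦ (Aτ + B)(Cτ + D)⁻¹`; it maps the Siegel upper half space
to itself. -/
noncomputable def moebius {n : ℕ} (γ : Sp n) (τ : Matrix (Fin n) (Fin n) ℂ) :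
    Matrix (Fin n) (Fin n) ℂ :=
  ((blkA γ).map (Int.cast : ℤ → ℂ) * τ + (blkB γ).map (Int.cast : ℤ → ℂ)) * (denom γ τ)⁻¹

/-- The weight `k` slash operator `(f|γ)(τ) = det(Cτ + D)^{-k} f(γτ)` (here `det γ = 1`). All
functions are evaluated only at points of the Siegel upper half space. -/
noncomputable def slash {n : ℕ} (k : ℕ) (f : Matrix (Fin n) (Fin n) ℂ → ℂ) (γ : Sp n) :
    Matrix (Fin n) (Fin n) ℂ → ℂ :=
  fun τ => (denom γ τ).det ^ (-(k : ℤ)) * f (moebius γ τ)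

/-- `𝔼*(τ) = ∑ 1(τ)|δ*`, where `δ* ∈ Γ(N)` varies so that `Γ_∞⁺ Γ(N)` is the disjoint union of
the cosets `Γ_∞⁺ δ*`, that is, over representatives of `(Γ_∞⁺ ∩ Γ(N)) \ Γ(N)`. -/
noncomputable def eisStar (n k N : ℕ) : Matrix (Fin n) (Fin n) ℂ → ℂ :=
  fun τ => ∑' c : Quotient (QuotientGroup.rightRel ((GammaInfPlus n).subgroupOf (Gamma n N))),
    slash k (fun _ => 1) (c.out : Gamma n N).1 τ

/-- `χ(γ) = χ(det D)` for `γ = (A B; C D) ∈ Γ₀(N)`. -/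
noncomputable def chiSp {n N : ℕ} (χ : DirichletCharacter ℂ N) (γ : Sp n) : ℂ :=
  χ (((blkD γ).det : ℤ) : ZMod N)

/-- The diagonal matrix `diag(w, 1, …, 1)`. -/
def diagFirst (n : ℕ) (w : ℤ) : Matrix (Fin n) (Fin n) ℤ :=
  Matrix.diagonal (fun i => if (i : ℕ) = 0 then w else 1)

/-- `γ_± = diag(G_±, G_±)` with `G_± = diag(-1, 1, …, 1)`. -/
def gammaPM (n : ℕ) : Sp n :=
  ⟨Matrix.fromBlocks (diagFirst n (-1)) 0 0 (diagFirst n (-1)), by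
    have h : diagFirst n (-1) * diagFirst n (-1) = 1 := by
      rw [diagFirst, Matrix.diagonal_mul_diagonal, ← Matrix.diagonal_one]
      congr 1
      funext i
      split_ifs <;> simp
    rw [SymplecticGroup.mem_iff, Matrix.J, Matrix.fromBlocks_transpose,
      Matrix.fromBlocks_multiply, Matrix.fromBlocks_multiply]
    have ht : (diagFirst n (-1)).transpose = diagFirst n (-1) := by
      rw [diagFirst, Matrix.diagonal_transpose]
    simp [ht, h]⟩

/-- `Γ_γ⁺ = {δ ∈ Γ₀(N) : Γ_∞⁺ Γ(N) γ δ = Γ_∞⁺ Γ(N) γ}`. -/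
def stabPlus (n N : ℕ) (γ : Sp n) : Subgroup (Sp n) where
  carrier := {δ | δ ∈ Gamma0 n N ∧
    ((GammaInfPlus n : Set (Sp n)) * (Gamma n N : Set (Sp n))) * {γ * δ} =
      ((GammaInfPlus n : Set (Sp n)) * (Gamma n N : Set (Sp n))) * {γ}}
  one_mem' := ⟨one_mem _, by rw [mul_one]⟩
  mul_mem' := by
    rintro a b ⟨ha, ha'⟩ ⟨hb, hb'⟩
    refine ⟨mul_mem ha hb, ?_⟩
    rw [← mul_assoc, ← Set.singleton_mul_singleton, ← mul_assoc, ha', mul_assoc,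
      Set.singleton_mul_singleton, hb']
  inv_mem' := by
    rintro a ⟨ha, ha'⟩
    refine ⟨inv_mem ha, ?_⟩
    rw [← Set.singleton_mul_singleton, ← mul_assoc, ← ha', mul_assoc,
      Set.singleton_mul_singleton, mul_inv_cancel_right, ha']

/-- `𝔼'_γ = ∑_β χ̄(β) 𝔼*|γβ + ∑_β χ̄(γ_± β) 𝔼*|γ_± γ β`, with `β` over representatives of
`Γ(N) \ Γ₀(N)` (a finite set). -/
noncomputable def eisPrime {n N : ℕ} (k : ℕ) (χ : DirichletCharacter ℂ N) (γ : Sp n) :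
    Matrix (Fin n) (Fin n) ℂ → ℂ :=
  fun τ =>
    (∑ᶠ c : Quotient (QuotientGroup.rightRel ((Gamma n N).subgroupOf (Gamma0 n N))),
      starRingEnd ℂ (chiSp χ (c.out : Gamma0 n N).1) *
        slash k (eisStar n k N) (γ * (c.out : Gamma0 n N).1) τ) +
    ∑ᶠ c : Quotient (QuotientGroup.rightRel ((Gamma n N).subgroupOf (Gamma0 n N))),
      starRingEnd ℂ (chiSp χ (gammaPM n * (c.out : Gamma0 n N).1)) *
        slash k (eisStar n k N) (gammaPM n * γ * (c.out : Gamma0 n N).1) τ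

/-- The Eisenstein series `𝔼_γ = (2 [Γ_γ⁺ : Γ(N)])⁻¹ 𝔼'_γ` on the Siegel upper half space. -/
noncomputable def eis {n N : ℕ} (k : ℕ) (χ : DirichletCharacter ℂ N) (γ : Sp n) :
    HSpace n → ℂ :=
  fun τ => (2 * ((Gamma n N).relIndex (stabPlus n N γ) : ℂ))⁻¹ * eisPrime k χ γ τ.1

/-- Integral symmetric `n × n` matrices; these are the `M` with `(I 0; M I) ∈ Sp_n(ℤ)`. -/
def SymMat (n : ℕ) : Type := {M : Matrix (Fin n) (Fin n) ℤ // M.IsSymm}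

/-- `γ = (I 0; M I)`. -/
def lower {n : ℕ} (M : SymMat n) : Sp n :=
  ⟨Matrix.fromBlocks 1 0 M.1 1, by
    rw [SymplecticGroup.mem_iff, Matrix.J, Matrix.fromBlocks_transpose,
      Matrix.fromBlocks_multiply, Matrix.fromBlocks_multiply]
    have h : M.1.transpose = M.1 := M.2
    simp [h]⟩

/-- `(v, w) · M = v diag(w, I) M diag(w, I)`. -/
def twist {n : ℕ} (v w : ℤ) (M : SymMat n) : SymMat n :=
  ⟨v • (diagFirst n w * M.1 * diagFirst n w), by
    have h : M.1.transpose = M.1 := M.2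
    have ht : (diagFirst n w).transpose = diagFirst n w := by
      rw [diagFirst, Matrix.diagonal_transpose]
    rw [Matrix.IsSymm, Matrix.transpose_smul, Matrix.transpose_mul, Matrix.transpose_mul, h, ht,
      Matrix.mul_assoc]⟩

/-- The set `{𝔼_γ : γ = (I 0; M I) ∈ Sp_n(ℤ)}`. -/
def eisSet (n k : ℕ) {N : ℕ} (χ : DirichletCharacter ℂ N) : Set (HSpace n → ℂ) :=
  {f | ∃ M : SymMat n, f = eis k χ (lower M)}

/-- The member `𝔼_γ` of that set, for `γ = (I 0; M I)`. -/
noncomputable def eisMem {n N : ℕ} (k : ℕ) (χ : DirichletCharacter ℂ N) (M : SymMat n) :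
    eisSet n k χ :=
  ⟨eis k χ (lower M), M, rfl⟩

/-- For `N = m m'` with `m, m'` coprime, the component `χ_m` (a character modulo `m`) in the
unique factorization `χ = χ_m χ_{m'}`: `χ_m(a) = χ(b)` for `b ≡ a (mod m)`, `b ≡ 1 (mod m')`. -/
noncomputable def charFactor {N : ℕ} (χ : DirichletCharacter ℂ N) (m : ℕ) (hm : m ∣ N)
    (hc : m.Coprime (N / m)) : DirichletCharacter ℂ m :=
  MulChar.ofUnitHom
    ((DirichletCharacter.changeLevel (dvd_of_eq (Nat.mul_div_cancel' hm).symm) χ :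
        DirichletCharacter ℂ (m * (N / m))).toUnitHom.comp
      ((Units.map ((ZMod.chineseRemainder hc).symm : ZMod m × ZMod (N / m) →* ZMod (m * (N / m)))).comp
        ((MulEquiv.prodUnits (M := ZMod m) (N := ZMod (N / m))).symm.toMonoidHom.comp
          (MonoidHom.inl (ZMod m)ˣ (ZMod (N / m))ˣ))))

/-- A multiplicative partition `σ = (N_0, …, N_n)` of `N`: `N_0 ⋯ N_n = N`. -/
structure MulPartition (n N : ℕ) where
  /-- The parts `N_d`, `0 ≤ d ≤ n`. -/
  part : Fin (n + 1) → ℕ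
  prod_part : ∏ d, part d = N

theorem MulPartition.part_dvd {n N : ℕ} (σ : MulPartition n N) (d : Fin (n + 1)) :
    σ.part d ∣ N := by
  conv_rhs => rw [← σ.prod_part]
  exact Finset.dvd_prod_of_mem _ (Finset.mem_univ d)

theorem coprime_div_of_squarefree {N m : ℕ} (hN : Squarefree N) (hm : m ∣ N) :
    m.Coprime (N / m) := by
  have h : Squarefree (m * (N / m)) := by rwa [Nat.mul_div_cancel' hm]
  exact Nat.coprime_of_squarefree_mul h

/-- `χ_{N_d}` for a multiplicative partition of a square-free `N`. -/
noncomputable def partChar {n N : ℕ} (χ : DirichletCharacter ℂ N) (hN : Squarefree N)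
    (σ : MulPartition n N) (d : Fin (n + 1)) : DirichletCharacter ℂ (σ.part d) :=
  charFactor χ (σ.part d) (σ.part_dvd d) (coprime_div_of_squarefree hN (σ.part_dvd d))

/-- `M` is an admissible choice of `M_σ`: for each `d` with `0 ≤ d ≤ n`,
`M ≡ diag(I_d, 0) (mod N_d)`. -/
def IsRepOf {n N : ℕ} (M : SymMat n) (σ : MulPartition n N) : Prop :=
  ∀ d : Fin (n + 1), ∀ i j : Fin n,
    M.1 i j ≡ (if i = j ∧ (i : ℕ) < (d : ℕ) then 1 else 0) [ZMOD (σ.part d : ℤ)]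

end SiegelEis

open SiegelEis

namespace SiegelEis

/-! ### Block relations and the action on the upper half space -/

open Matrix Complex

variable {n : ℕ}

/-! Let P be the Siegel parabolic {C = 0}. Up to a scalar, 𝔼_γ depends only on the double coset
PΓ(N)γΓ₀(N): replacing γ by pgγβ multiplies it by det(D_p)^k χ(β) (`eis_transform`). The parity
condition on χ makes the two sums in the definition of 𝔼_γ agree, so one of them suffices
(`eisPrime_eq`). Part (a) is the case p = g = 1, β ∈ Γ(N).

Part (b) needs a converse, read off from values at cusps. Put τ = iy in 𝔼_γ|γ'⁻¹ and let y → ∞. A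
summand det(Cτ+D)^{-k} tends to 0 unless C = 0, when it is a constant sign; so the limit vanishes
unless γ' lies in the double coset of γ. If every relation γ = pgγβ satisfies det(D_p)^k χ(β) = 1,
then all nonzero terms of the limit at γ' = γ equal 1 and the limit is nonzero. Hence a vanishing
𝔼_γ comes from an incompatible self-relation (`exists_bad_relation`), and equal nonzero series have
a common double coset (`exists_relation_of_eis_eq`).

Limit and sum are exchanged by dominated convergence, with majorant Σ |det(Ci+D)|^{-k} over
Γ_∞⁺\Sp_n(ℤ), finite for k > n+1 (`summable_inv_cov_pow`). Partial inversions reduce this to cosets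
where det C dominates; these are parametrized, with bounded multiplicity, by the symmetric matrix
C⁻¹D modulo 1, and the resulting Siegel series Σ ν(R)^{-k} is bounded by induction on the size of R
(`siegel_series_ne_top`).

The twist by (v,w) is conjugation modulo N by the similitude diag(W⁻¹, vW), W = diag(w,1,…,1). It
preserves the reductions of P and Γ₀(N) as well as det D modulo N, so a relation between γ_M and
γ_{M'} gives one between the twists with the same scalar (`exists_twist_relation`). Vanishing and
equality of series are therefore inherited by twists, and the action in (c) follows formally. The
arithmetic input is that W⁻¹AW modulo N lifts to determinant one when A does
(`exists_conj_diagFirst`).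

For (d), M_σ is diagonal with idempotent entries modulo N, so an explicit relation between M_σ and
its twist can be solved coordinate by coordinate (`exists_relation_twist`); its scalar is then
factored over the parts N_d. -/

theorem coe_eq_fromBlocks (γ : Sp n) :
    γ.1 = fromBlocks (blkA γ) (blkB γ) (blkC γ) (blkD γ) :=
  (fromBlocks_toBlocks γ.1).symm

theorem blkB_mul (γ δ : Sp n) : blkB (γ * δ) = blkA γ * blkB δ + blkB γ * blkD δ := by
  ext i j
  simp [blkA, blkB, blkD, toBlocks₁₁, toBlocks₁₂, toBlocks₂₂, mul_apply, Fintype.sum_sum_type]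

theorem blkD_mul (γ δ : Sp n) : blkD (γ * δ) = blkC γ * blkB δ + blkD γ * blkD δ := by
  ext i j
  simp [blkB, blkC, blkD, toBlocks₁₂, toBlocks₂₁, toBlocks₂₂, mul_apply, Fintype.sum_sum_type]

theorem ext_blk {γ δ : Sp n} (hA : blkA γ = blkA δ) (hB : blkB γ = blkB δ)
    (hC : blkC γ = blkC δ) (hD : blkD γ = blkD δ) : γ = δ := by
  apply Subtype.ext
  rw [coe_eq_fromBlocks γ, coe_eq_fromBlocks δ, hA, hB, hC, hD]

theorem blkB_inv (γ : Sp n) : blkB γ⁻¹ = -(blkB γ)ᵀ := by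
  rw [blkB, blkB, SymplecticGroup.coe_inv, Matrix.J]
  conv_lhs => rw [← Matrix.fromBlocks_toBlocks γ.1]
  simp [Matrix.fromBlocks_neg, Matrix.fromBlocks_transpose, Matrix.fromBlocks_multiply]

theorem blkD_inv (γ : Sp n) : blkD γ⁻¹ = (blkA γ)ᵀ := by
  rw [blkA, blkD, SymplecticGroup.coe_inv, Matrix.J]
  conv_lhs => rw [← Matrix.fromBlocks_toBlocks γ.1]
  simp [Matrix.fromBlocks_neg, Matrix.fromBlocks_transpose, Matrix.fromBlocks_multiply]

@[simp] theorem blkA_one : blkA (1 : Sp n) = 1 := by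
  ext i j; simp [blkA, toBlocks₁₁, one_apply]
@[simp] theorem blkB_one : blkB (1 : Sp n) = 0 := by
  ext i j; simp [blkB, toBlocks₁₂]
@[simp] theorem blkC_one : blkC (1 : Sp n) = 0 := by
  ext i j; simp [blkC, toBlocks₂₁]
@[simp] theorem blkD_one : blkD (1 : Sp n) = 1 := by
  ext i j; simp [blkD, toBlocks₂₂, one_apply]

theorem blkC_mul_transpose_blkD (γ : Sp n) : blkC γ * (blkD γ)ᵀ = blkD γ * (blkC γ)ᵀ := by
  have h := blkC_mul γ γ⁻¹
  rw [mul_inv_cancel, blkC_one, blkA_inv, blkC_inv, Matrix.mul_neg, ← sub_eq_add_neg] at h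
  exact sub_eq_zero.1 h.symm

theorem blkA_mul_transpose_blkB (γ : Sp n) : blkA γ * (blkB γ)ᵀ = blkB γ * (blkA γ)ᵀ := by
  have h := blkB_mul γ γ⁻¹
  rw [mul_inv_cancel, blkB_one, blkB_inv, blkD_inv, Matrix.mul_neg, neg_add_eq_sub] at h
  exact (sub_eq_zero.1 h.symm).symm

theorem blkA_mul_transpose_blkD (γ : Sp n) :
    blkA γ * (blkD γ)ᵀ - blkB γ * (blkC γ)ᵀ = 1 := by
  have h := blkA_mul γ γ⁻¹
  rw [mul_inv_cancel, blkA_one, blkA_inv, blkC_inv, Matrix.mul_neg, ← sub_eq_add_neg] at h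
  exact h.symm

theorem transpose_blkD_mul_blkA (γ : Sp n) :
    (blkD γ)ᵀ * blkA γ - (blkB γ)ᵀ * blkC γ = 1 := by
  have h := blkA_mul γ⁻¹ γ
  rw [inv_mul_cancel, blkA_one, blkA_inv, blkB_inv, Matrix.neg_mul, ← sub_eq_add_neg] at h
  exact h.symm

theorem transpose_blkA_mul_blkC (γ : Sp n) : (blkA γ)ᵀ * blkC γ = (blkC γ)ᵀ * blkA γ := by
  have h := blkC_mul γ⁻¹ γ
  rw [inv_mul_cancel, blkC_one, blkC_inv, blkD_inv, Matrix.neg_mul, neg_add_eq_sub] at h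
  exact (sub_eq_zero.1 h.symm)

theorem transpose_blkB_mul_blkD (γ : Sp n) : (blkB γ)ᵀ * blkD γ = (blkD γ)ᵀ * blkB γ := by
  have h := blkB_mul γ⁻¹ γ
  rw [inv_mul_cancel, blkB_one, blkA_inv, blkB_inv, Matrix.neg_mul, ← sub_eq_add_neg] at h
  exact (sub_eq_zero.1 h.symm).symm

/-- The inclusion of integral matrices into complex ones. -/
noncomputable abbrev toC (M : Matrix (Fin n) (Fin n) ℤ) : Matrix (Fin n) (Fin n) ℂ :=
  M.map (Int.cast : ℤ → ℂ)

theorem toC_mul (M M' : Matrix (Fin n) (Fin n) ℤ) : toC (M * M') = toC M * toC M' :=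
  Matrix.map_mul (f := Int.castRingHom ℂ)
theorem toC_add (M M' : Matrix (Fin n) (Fin n) ℤ) : toC (M + M') = toC M + toC M' :=
  Matrix.map_add _ Int.cast_add _ _
theorem toC_sub (M M' : Matrix (Fin n) (Fin n) ℤ) : toC (M - M') = toC M - toC M' :=
  Matrix.map_sub _ Int.cast_sub _ _
theorem toC_one : toC (1 : Matrix (Fin n) (Fin n) ℤ) = 1 :=
  Matrix.map_one _ Int.cast_zero Int.cast_one
theorem toC_zero : toC (0 : Matrix (Fin n) (Fin n) ℤ) = 0 :=
  Matrix.map_zero _ Int.cast_zero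
theorem toC_transpose (M : Matrix (Fin n) (Fin n) ℤ) : toC Mᵀ = (toC M)ᵀ := rfl
theorem det_toC (M : Matrix (Fin n) (Fin n) ℤ) : (toC M).det = (M.det : ℂ) :=
  (RingHom.map_det (Int.castRingHom ℂ) M).symm

theorem toC_conjTranspose (M : Matrix (Fin n) (Fin n) ℤ) : (toC M)ᴴ = (toC M)ᵀ := by
  ext i j; simp

/-- The numerator `Aτ + B`. -/
noncomputable def numer (γ : Sp n) (τ : Matrix (Fin n) (Fin n) ℂ) :
    Matrix (Fin n) (Fin n) ℂ :=
  toC (blkA γ) * τ + toC (blkB γ)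

theorem moebius_eq (γ : Sp n) (τ : Matrix (Fin n) (Fin n) ℂ) :
    moebius γ τ = numer γ τ * (denom γ τ)⁻¹ := rfl

theorem denom_eq (γ : Sp n) (τ : Matrix (Fin n) (Fin n) ℂ) :
    denom γ τ = toC (blkC γ) * τ + toC (blkD γ) := rfl

/-- This is invariance of the symplectic form on the columns of (τ; 1), in Hermitian form. It yields
both invertibility of Cτ + D and the formula for the imaginary part of γτ. -/
theorem conjTranspose_numer_mul_denom (γ : Sp n) {τ : Matrix (Fin n) (Fin n) ℂ} :
    (numer γ τ)ᴴ * denom γ τ - (denom γ τ)ᴴ * numer γ τ = τᴴ - τ := by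
  have h1 := congrArg toC (transpose_blkD_mul_blkA γ)
  have h2 := congrArg toC (transpose_blkA_mul_blkC γ)
  have h3 := congrArg toC (transpose_blkB_mul_blkD γ)
  have h4 := congrArg (fun M => (toC M)ᵀ) (transpose_blkD_mul_blkA γ)
  simp only [toC_sub, toC_mul, toC_one, transpose_sub, transpose_mul, toC_transpose,
    transpose_transpose, transpose_one] at h1 h2 h3 h4
  simp only [numer, denom_eq, conjTranspose_add, conjTranspose_mul, toC_conjTranspose]
  have e1 : (toC (blkA γ))ᵀ * toC (blkD γ) = 1 + (toC (blkC γ))ᵀ * toC (blkB γ) := by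
    rw [← h4]; abel
  have e2 : (toC (blkD γ))ᵀ * toC (blkA γ) = 1 + (toC (blkB γ))ᵀ * toC (blkC γ) := by
    rw [← h1]; abel
  calc _ = τᴴ * ((toC (blkA γ))ᵀ * toC (blkC γ)) * τ + τᴴ * ((toC (blkA γ))ᵀ * toC (blkD γ))
        + (toC (blkB γ))ᵀ * toC (blkC γ) * τ + (toC (blkB γ))ᵀ * toC (blkD γ)
        - (τᴴ * ((toC (blkC γ))ᵀ * toC (blkA γ)) * τ + τᴴ * ((toC (blkC γ))ᵀ * toC (blkB γ))
        + (toC (blkD γ))ᵀ * toC (blkA γ) * τ + (toC (blkD γ))ᵀ * toC (blkB γ)) := by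
          noncomm_ring
    _ = _ := by rw [e1, e2, h2, h3]; noncomm_ring

theorem transpose_numer_mul_denom (γ : Sp n) {τ : Matrix (Fin n) (Fin n) ℂ} (hτ : τ.IsSymm) :
    (numer γ τ)ᵀ * denom γ τ = (denom γ τ)ᵀ * numer γ τ := by
  have h1 := congrArg toC (transpose_blkD_mul_blkA γ)
  have h2 := congrArg toC (transpose_blkA_mul_blkC γ)
  have h3 := congrArg toC (transpose_blkB_mul_blkD γ)
  have h4 := congrArg (fun M => (toC M)ᵀ) (transpose_blkD_mul_blkA γ)
  simp only [toC_sub, toC_mul, toC_one, transpose_sub, transpose_mul, toC_transpose,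
    transpose_transpose, transpose_one] at h1 h2 h3 h4
  simp only [numer, denom_eq, transpose_add, transpose_mul, hτ.eq]
  have e1 : (toC (blkA γ))ᵀ * toC (blkD γ) = 1 + (toC (blkC γ))ᵀ * toC (blkB γ) := by
    rw [← h4]; abel
  have e2 : (toC (blkD γ))ᵀ * toC (blkA γ) = 1 + (toC (blkB γ))ᵀ * toC (blkC γ) := by
    rw [← h1]; abel
  rw [← sub_eq_zero]
  calc _ = τ * ((toC (blkA γ))ᵀ * toC (blkC γ)) * τ + τ * ((toC (blkA γ))ᵀ * toC (blkD γ))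
        + (toC (blkB γ))ᵀ * toC (blkC γ) * τ + (toC (blkB γ))ᵀ * toC (blkD γ)
        - (τ * ((toC (blkC γ))ᵀ * toC (blkA γ)) * τ + τ * ((toC (blkC γ))ᵀ * toC (blkB γ))
        + (toC (blkD γ))ᵀ * toC (blkA γ) * τ + (toC (blkD γ))ᵀ * toC (blkB γ)) := by
          noncomm_ring
    _ = _ := by rw [e1, e2, h2, h3]; noncomm_ring

theorem star_dotProduct_map_ofReal_mulVec {Y : Matrix (Fin n) (Fin n) ℝ} (hY : Y.IsSymm)
    (v : Fin n → ℂ) :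
    star v ⬝ᵥ (Y.map ofReal *ᵥ v) =
      (((fun i => (v i).re) ⬝ᵥ (Y *ᵥ fun i => (v i).re) +
        (fun i => (v i).im) ⬝ᵥ (Y *ᵥ fun i => (v i).im) : ℝ) : ℂ) := by
  have key : ∀ i j, star (v i) * (Y i j * v j) + star (v j) * (Y j i * v i)
      = (((v i).re * (Y i j * (v j).re) + (v i).im * (Y i j * (v j).im)
        + ((v j).re * (Y j i * (v i).re) + (v j).im * (Y j i * (v i).im)) : ℝ) : ℂ) := by
    intro i j
    rw [hY.apply i j]
    apply Complex.ext
    · simp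
    · simp
      ring
  have h2 : (2 : ℂ) * (star v ⬝ᵥ (Y.map ofReal *ᵥ v)) =
      2 * (((fun i => (v i).re) ⬝ᵥ (Y *ᵥ fun i => (v i).re) +
        (fun i => (v i).im) ⬝ᵥ (Y *ᵥ fun i => (v i).im) : ℝ) : ℂ) := by
    -- Doubling the form pairs the (i,j) and (j,i) terms, so the imaginary cross terms cancel pair
    -- by pair.
    have e1 : (2 : ℂ) * (star v ⬝ᵥ (Y.map ofReal *ᵥ v)) =
        ∑ i, ∑ j, (star (v i) * (Y i j * v j) + star (v j) * (Y j i * v i)) := by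
      simp only [Finset.sum_add_distrib]
      rw [Finset.sum_comm (f := fun i j => star (v j) * (Y j i * v i)), ← two_mul]
      simp only [dotProduct, mulVec, Finset.mul_sum, Pi.star_apply, map_apply]
    have e2 : 2 * ((fun i => (v i).re) ⬝ᵥ (Y *ᵥ fun i => (v i).re) +
        (fun i => (v i).im) ⬝ᵥ (Y *ᵥ fun i => (v i).im)) =
        ∑ i, ∑ j, ((v i).re * (Y i j * (v j).re) + (v i).im * (Y i j * (v j).im)
        + ((v j).re * (Y j i * (v i).re) + (v j).im * (Y j i * (v i).im))) := by
      simp only [Finset.sum_add_distrib]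
      rw [Finset.sum_comm (f := fun i j => (v j).re * (Y j i * (v i).re)),
        Finset.sum_comm (f := fun i j => (v j).im * (Y j i * (v i).im)), ← two_mul]
      simp only [dotProduct, mulVec, Finset.mul_sum]
    rw [e1, Finset.sum_congr rfl fun i _ => Finset.sum_congr rfl fun j _ => key i j]
    have e3 := congrArg ((↑) : ℝ → ℂ) e2
    rw [ofReal_mul] at e3
    rw [show (2 : ℂ) = ((2 : ℝ) : ℂ) by simp, e3]
    push_cast
    rfl
  exact mul_left_cancel₀ two_ne_zero h2

theorem sub_conjTranspose_eq {τ : Matrix (Fin n) (Fin n) ℂ} (hτ : τ.IsSymm) :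
    τ - τᴴ = (2 * I) • (τ.map Complex.im).map ofReal := by
  ext i j
  rw [Matrix.sub_apply, conjTranspose_apply, hτ.apply i j, Matrix.smul_apply, map_apply, map_apply]
  apply Complex.ext <;> simp
  ring

/-- A kernel vector v of Cτ + D would give v*(τ* − τ)v = 0, that is v* Im(τ) v = 0, contradicting
positivity. -/
theorem det_denom_ne_zero (γ : Sp n) (τ : HSpace n) : (denom γ τ.1).det ≠ 0 := by
  obtain ⟨τ, hs, hp⟩ := τ
  intro h0
  obtain ⟨v, hv, hv0⟩ := exists_mulVec_eq_zero_iff.2 h0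
  have h := congrArg (fun X => star v ⬝ᵥ (X *ᵥ v)) (conjTranspose_numer_mul_denom γ (τ := τ))
  have hstar : star v ᵥ* (denom γ τ)ᴴ = 0 := by
    rw [← star_mulVec, hv0, star_zero]
  have h' : τᴴ - τ = -((2 * I) • (τ.map Complex.im).map ofReal) := by
    rw [← sub_conjTranspose_eq hs]; abel
  simp only [sub_mulVec, ← mulVec_mulVec, hv0, mulVec_zero] at h
  rw [zero_sub, dotProduct_neg, dotProduct_mulVec, hstar, zero_dotProduct, neg_zero,
    ← sub_mulVec, h', neg_mulVec, dotProduct_neg, smul_mulVec, dotProduct_smul,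
    star_dotProduct_map_ofReal_mulVec (by ext i j; simp [hs.apply i j])] at h
  have h3 : ((fun i => (v i).re) ⬝ᵥ (τ.map Complex.im *ᵥ fun i => (v i).re) +
        (fun i => (v i).im) ⬝ᵥ (τ.map Complex.im *ᵥ fun i => (v i).im)) = 0 := by
    have := neg_eq_zero.1 h.symm
    rw [smul_eq_mul, mul_eq_zero] at this
    exact_mod_cast this.resolve_left (by simp)
  have hnn : ∀ x : Fin n → ℝ, 0 ≤ x ⬝ᵥ (τ.map Complex.im *ᵥ x) := fun x => by
    simpa using hp.posSemidef.dotProduct_mulVec_nonneg x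
  have hpos : ∀ x : Fin n → ℝ, x ⬝ᵥ (τ.map Complex.im *ᵥ x) = 0 → x = 0 := fun x hx => by
    by_contra hne
    have := hp.dotProduct_mulVec_pos hne
    simp only [star_trivial] at this
    linarith
  have hr := hpos (fun i => (v i).re) (by linarith [hnn fun i => (v i).re, hnn fun i => (v i).im])
  have hi := hpos (fun i => (v i).im) (by linarith [hnn fun i => (v i).re, hnn fun i => (v i).im])
  exact hv (funext fun i => Complex.ext (by simpa using congrFun hr i) (by simpa using congrFun hi i))

theorem isUnit_det_denom (γ : Sp n) (τ : HSpace n) : IsUnit (denom γ τ.1).det :=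
  (det_denom_ne_zero γ τ).isUnit

theorem numer_moebius_mul_denom (γ δ : Sp n) (τ : HSpace n) :
    numer γ (moebius δ τ.1) * denom δ τ.1 = numer (γ * δ) τ.1 := by
  rw [numer, add_mul, moebius_eq, Matrix.mul_assoc, Matrix.mul_assoc,
    nonsing_inv_mul _ (isUnit_det_denom δ τ), Matrix.mul_one, numer, denom_eq, numer, blkA_mul,
    blkB_mul, toC_add, toC_add, toC_mul, toC_mul, toC_mul, toC_mul]
  noncomm_ring

theorem denom_moebius_mul_denom (γ δ : Sp n) (τ : HSpace n) :
    denom γ (moebius δ τ.1) * denom δ τ.1 = denom (γ * δ) τ.1 := by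
  rw [denom_eq γ, add_mul, moebius_eq, Matrix.mul_assoc, Matrix.mul_assoc,
    nonsing_inv_mul _ (isUnit_det_denom δ τ), Matrix.mul_one, numer, denom_eq, denom_eq, blkC_mul,
    blkD_mul, toC_add, toC_add, toC_mul, toC_mul, toC_mul, toC_mul]
  noncomm_ring

theorem det_denom_mul (γ δ : Sp n) (τ : HSpace n) :
    (denom (γ * δ) τ.1).det = (denom γ (moebius δ τ.1)).det * (denom δ τ.1).det := by
  rw [← denom_moebius_mul_denom, det_mul]

theorem moebius_mul (γ δ : Sp n) (τ : HSpace n) :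
    moebius (γ * δ) τ.1 = moebius γ (moebius δ τ.1) := by
  rw [moebius_eq (γ * δ), ← denom_moebius_mul_denom, ← numer_moebius_mul_denom, Matrix.mul_inv_rev,
    moebius_eq γ, ← Matrix.mul_assoc, Matrix.mul_assoc (numer γ _),
    mul_nonsing_inv _ (isUnit_det_denom δ τ), Matrix.mul_one]

theorem slash_mul (k : ℕ) (f : Matrix (Fin n) (Fin n) ℂ → ℂ) (γ δ : Sp n) (τ : HSpace n) :
    slash k f (γ * δ) τ.1 = slash k (slash k f γ) δ τ.1 := by
  simp only [slash]
  rw [det_denom_mul, moebius_mul, mul_zpow]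
  ring

theorem isSymm_moebius (γ : Sp n) (τ : HSpace n) : (moebius γ τ.1).IsSymm := by
  have hu := isUnit_det_denom γ τ
  have hu' : IsUnit (denom γ τ.1)ᵀ.det := by rwa [det_transpose]
  rw [IsSymm, moebius_eq, transpose_mul, transpose_nonsing_inv]
  calc (denom γ τ.1)ᵀ⁻¹ * (numer γ τ.1)ᵀ
      = (denom γ τ.1)ᵀ⁻¹ * ((numer γ τ.1)ᵀ * denom γ τ.1) * (denom γ τ.1)⁻¹ := by
        rw [← Matrix.mul_assoc, Matrix.mul_assoc, mul_nonsing_inv _ hu, Matrix.mul_one]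
    _ = _ := by
        rw [transpose_numer_mul_denom γ τ.2.1, ← Matrix.mul_assoc, nonsing_inv_mul _ hu',
          Matrix.one_mul]

/-- With d = Cτ + D one has Im(γτ) = (d⁻¹)* Im(τ) d⁻¹; evaluating at a real vector x reduces to
Im(τ) at d⁻¹x. -/
theorem posDef_im_moebius (γ : Sp n) (τ : HSpace n) :
    ((moebius γ τ.1).map Complex.im).PosDef := by
  have hu := isUnit_det_denom γ τ
  set d := denom γ τ.1 with hd
  have hu' : IsUnit dᴴ.det := by rw [det_conjTranspose]; exact hu.star
  have hsymm := isSymm_moebius γ τ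
  have key : ((moebius γ τ.1).map Complex.im).map ofReal =
      (d⁻¹)ᴴ * (τ.1.map Complex.im).map ofReal * d⁻¹ := by
    have h1 : (2 * I) • ((moebius γ τ.1).map Complex.im).map ofReal =
        (2 * I) • ((d⁻¹)ᴴ * (τ.1.map Complex.im).map ofReal * d⁻¹) := by
      rw [← sub_conjTranspose_eq hsymm, ← smul_mul, ← Matrix.mul_smul,
        ← sub_conjTranspose_eq τ.2.1, ← neg_sub τ.1ᴴ, ← conjTranspose_numer_mul_denom γ,
        moebius_eq, ← hd, conjTranspose_mul, conjTranspose_nonsing_inv, neg_sub, mul_sub, sub_mul]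
      congr 1
      · rw [← Matrix.mul_assoc, nonsing_inv_mul _ hu', Matrix.one_mul]
      · rw [← Matrix.mul_assoc, Matrix.mul_assoc, mul_nonsing_inv _ hu, Matrix.mul_one]
    exact smul_right_injective _ (by simp : (2 * I : ℂ) ≠ 0) h1
  have hYs : (τ.1.map Complex.im).IsSymm := by ext i j; simp [τ.2.1.apply i j]
  have hZs : ((moebius γ τ.1).map Complex.im).IsSymm := by ext i j; simp [hsymm.apply i j]
  refine PosDef.of_dotProduct_mulVec_pos ?_ ?_
  · rw [IsHermitian, conjTranspose_eq_transpose_of_trivial, hZs.eq]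
  · intro x hx
    set v : Fin n → ℂ := d⁻¹ *ᵥ (fun i => (x i : ℂ)) with hvdef
    have hxv : (fun i => (x i : ℂ)) = d *ᵥ v := by
      rw [hvdef, mulVec_mulVec, mul_nonsing_inv _ hu, one_mulVec]
    have e := star_dotProduct_map_ofReal_mulVec hZs (fun i => (x i : ℂ))
    rw [key, Matrix.mul_assoc, ← mulVec_mulVec, dotProduct_mulVec, ← star_mulVec, ← hvdef,
      ← mulVec_mulVec, ← hvdef, star_dotProduct_map_ofReal_mulVec hYs] at e
    have e' := ofReal_injective e
    simp only [ofReal_re, ofReal_im] at e'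
    rw [star_trivial]
    have hz : (fun _ => 0 : Fin n → ℝ) ⬝ᵥ
        ((moebius γ τ.1).map Complex.im *ᵥ fun _ => (0 : ℝ)) = 0 := by
      simp [dotProduct]
    rw [hz, add_zero] at e'
    rw [← e']
    have hnn : ∀ x : Fin n → ℝ, 0 ≤ x ⬝ᵥ (τ.1.map Complex.im *ᵥ x) := fun x => by
      simpa using τ.2.2.posSemidef.dotProduct_mulVec_nonneg x
    have hpos : ∀ x : Fin n → ℝ, x ≠ 0 → 0 < x ⬝ᵥ (τ.1.map Complex.im *ᵥ x) := fun x hx => by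
      simpa using τ.2.2.dotProduct_mulVec_pos hx
    by_cases hr : (fun i => (v i).re) = 0
    · have hi : (fun i => (v i).im) ≠ 0 := by
        intro hi
        have hv0 : v = 0 := funext fun i =>
          Complex.ext (by simpa using congrFun hr i) (by simpa using congrFun hi i)
        apply hx
        rw [hv0, mulVec_zero] at hxv
        funext i
        simpa using congrFun hxv i
      exact add_pos_of_nonneg_of_pos (hnn _) (hpos _ hi)
    · exact add_pos_of_pos_of_nonneg (hpos _ hr) (hnn _)

/-- The action of `Sp_n(ℤ)` on the upper half space. -/
noncomputable def moebiusH (γ : Sp n) (τ : HSpace n) : HSpace n :=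
  ⟨moebius γ τ.1, isSymm_moebius γ τ, posDef_im_moebius γ τ⟩

/-! ### Congruence subgroups and the Siegel parabolic -/

/-- Reduction modulo `N`. -/
def red (n N : ℕ) : Sp n →* Matrix (Fin n ⊕ Fin n) (Fin n ⊕ Fin n) (ZMod N) :=
  (RingHom.mapMatrix (Int.castRingHom (ZMod N))).toMonoidHom.comp (Submonoid.subtype _)

theorem mem_Gamma_iff {N : ℕ} {γ : Sp n} : γ ∈ Gamma n N ↔ red n N γ = 1 := Iff.rfl

theorem Gamma_eq_ker (n N : ℕ) : Gamma n N = (red n N).toHomUnits.ker := by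
  ext γ
  rw [MonoidHom.mem_ker, mem_Gamma_iff, Units.ext_iff]
  rfl

instance (n N : ℕ) : (Gamma n N).Normal := by
  rw [Gamma_eq_ker]; infer_instance

theorem finiteIndex_Gamma (n : ℕ) {N : ℕ} (hN : 0 < N) : (Gamma n N).FiniteIndex := by
  have : NeZero N := ⟨hN.ne'⟩
  rw [Gamma_eq_ker]
  exact Subgroup.finiteIndex_ker _

theorem red_eq_fromBlocks {N : ℕ} (γ : Sp n) :
    red n N γ = fromBlocks ((blkA γ).map (Int.castRingHom (ZMod N)))
      ((blkB γ).map (Int.castRingHom (ZMod N))) ((blkC γ).map (Int.castRingHom (ZMod N)))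
      ((blkD γ).map (Int.castRingHom (ZMod N))) := by
  have : red n N γ = γ.1.map (Int.castRingHom (ZMod N)) := rfl
  rw [this, coe_eq_fromBlocks, fromBlocks_map]

theorem Gamma_le_Gamma0 (n N : ℕ) : Gamma n N ≤ Gamma0 n N := by
  intro γ hγ
  rw [mem_Gamma_iff, red_eq_fromBlocks, ← fromBlocks_one] at hγ
  exact (fromBlocks_inj.1 hγ).2.2.1

/-- `Γ_∞⁺ Γ(N)` as a subgroup. -/
def infGamma (n N : ℕ) : Subgroup (Sp n) := GammaInfPlus n ⊔ Gamma n N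

theorem mem_infGamma {N : ℕ} {x : Sp n} :
    x ∈ infGamma n N ↔ ∃ p ∈ GammaInfPlus n, ∃ g ∈ Gamma n N, p * g = x :=
  Subgroup.mem_sup_of_normal_right

theorem det_blkA_mul_det_blkD {p : Sp n} (hp : blkC p = 0) :
    (blkA p).det * (blkD p).det = 1 := by
  have h := congrArg Matrix.det (blkA_mul_transpose_blkD p)
  simpa [hp, det_mul] using h

theorem det_blkD_sq {p : Sp n} (hp : blkC p = 0) : (blkD p).det * (blkD p).det = 1 := by
  have h := det_blkA_mul_det_blkD hp
  rcases Int.isUnit_iff.1 (IsUnit.of_mul_eq_one_right _ h) with h | h <;> rw [h] <;> rfl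

theorem det_blkA_eq_det_blkD {p : Sp n} (hp : blkC p = 0) : (blkA p).det = (blkD p).det := by
  have h := det_blkA_mul_det_blkD hp
  have h' := det_blkD_sq hp
  calc _ = (blkA p).det * ((blkD p).det * (blkD p).det) := by rw [h', mul_one]
    _ = _ := by rw [← mul_assoc, h, one_mul]

theorem mem_GammaInfPlus_iff {p : Sp n} :
    p ∈ GammaInfPlus n ↔ blkC p = 0 ∧ (blkD p).det = 1 := by
  constructor
  · rintro ⟨h, h'⟩
    exact ⟨h, det_blkD_of_blkC p h h'⟩
  · rintro ⟨h, h'⟩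
    exact ⟨h, by rw [det_blkA_eq_det_blkD h, h']⟩

/-- The Siegel parabolic `{C = 0}`. -/
def parabolic (n : ℕ) : Subgroup (Sp n) where
  carrier := {γ | blkC γ = 0}
  one_mem' := blkC_one
  mul_mem' := by
    intro a b (ha : blkC a = 0) (hb : blkC b = 0)
    change blkC (a * b) = 0
    rw [blkC_mul, ha, hb]; simp
  inv_mem' := by
    intro a (ha : blkC a = 0)
    change blkC a⁻¹ = 0
    rw [blkC_inv, ha]; simp

theorem mem_parabolic {p : Sp n} : p ∈ parabolic n ↔ blkC p = 0 := Iff.rfl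

theorem det_blkD_mul_left {p : Sp n} (hp : p ∈ parabolic n) (x : Sp n) :
    (blkD (p * x)).det = (blkD p).det * (blkD x).det := by
  rw [blkD_mul, mem_parabolic.1 hp, Matrix.zero_mul, zero_add, det_mul]

/-- The sign `det(D)^k` of an element of the Siegel parabolic. -/
noncomputable def psi (k : ℕ) (p : Sp n) : ℂ := ((blkD p).det : ℂ) ^ k

theorem psi_mul (k : ℕ) {p : Sp n} (hp : p ∈ parabolic n) (x : Sp n) :
    psi k (p * x) = psi k p * psi k x := by
  rw [psi, psi, psi, det_blkD_mul_left hp, Int.cast_mul, mul_pow]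

theorem psi_sq (k : ℕ) {p : Sp n} (hp : p ∈ parabolic n) : psi k p * psi k p = 1 := by
  rw [psi, ← mul_pow]
  have := congrArg (fun z : ℤ => (z : ℂ)) (det_blkD_sq hp)
  simp only [Int.cast_mul, Int.cast_one] at this
  rw [this, one_pow]

theorem psi_eq_one (k : ℕ) {p : Sp n} (hp : p ∈ GammaInfPlus n) : psi k p = 1 := by
  rw [psi, (mem_GammaInfPlus_iff.1 hp).2]; simp

theorem psi_zpow (k : ℕ) {p : Sp n} (hp : p ∈ parabolic n) :
    ((blkD p).det : ℂ) ^ (-(k : ℤ)) = psi k p := by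
  rw [_root_.zpow_neg, zpow_natCast]
  exact inv_eq_of_mul_eq_one_left (psi_sq k hp)

theorem GammaInfPlus_le_parabolic (n : ℕ) : GammaInfPlus n ≤ parabolic n := fun _ h => h.1

theorem conj_mem_GammaInfPlus {p : Sp n} (hp : p ∈ parabolic n) {x : Sp n}
    (hx : x ∈ GammaInfPlus n) : p * x * p⁻¹ ∈ GammaInfPlus n := by
  have hx' := GammaInfPlus_le_parabolic n hx
  rw [mem_GammaInfPlus_iff]
  refine ⟨mul_mem (mul_mem hp hx') (inv_mem hp), ?_⟩
  have h1 := det_blkD_mul_left hp p⁻¹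
  rw [mul_inv_cancel, blkD_one, det_one] at h1
  rw [det_blkD_mul_left (mul_mem hp hx'), det_blkD_mul_left hp, (mem_GammaInfPlus_iff.1 hx).2,
    mul_one, ← h1]

/-- The parabolic normalizes Γ_∞⁺, being an extension of it by a determinant sign, and Γ(N) is
normal; so it normalizes their product. -/
theorem conj_mem_infGamma {N : ℕ} {p : Sp n} (hp : p ∈ parabolic n) {x : Sp n}
    (hx : x ∈ infGamma n N) : p * x * p⁻¹ ∈ infGamma n N := by
  obtain ⟨q, hq, g, hg, rfl⟩ := mem_infGamma.1 hx
  refine mem_infGamma.2 ⟨p * q * p⁻¹, conj_mem_GammaInfPlus hp hq, p * g * p⁻¹,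
    Subgroup.Normal.conj_mem inferInstance g hg p, by group⟩

theorem denom_parabolic_mul {p : Sp n} (hp : p ∈ parabolic n) (x : Sp n)
    (τ : Matrix (Fin n) (Fin n) ℂ) : (denom (p * x) τ).det = (blkD p).det * (denom x τ).det := by
  rw [denom_eq, denom_eq, blkC_mul, blkD_mul, mem_parabolic.1 hp, Matrix.zero_mul, zero_add,
    Matrix.zero_mul, zero_add, toC_mul, toC_mul, Matrix.mul_assoc, ← Matrix.mul_add, det_mul,
    det_toC]

/-- The automorphy factor `det(Cτ + D)^{-k}`. -/
noncomputable def autFac (k : ℕ) (γ : Sp n) (τ : Matrix (Fin n) (Fin n) ℂ) : ℂ :=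
  (denom γ τ).det ^ (-(k : ℤ))

theorem autFac_parabolic_mul (k : ℕ) {p : Sp n} (hp : p ∈ parabolic n) (x : Sp n)
    (τ : Matrix (Fin n) (Fin n) ℂ) : autFac k (p * x) τ = psi k p * autFac k x τ := by
  rw [autFac, denom_parabolic_mul hp, mul_zpow, psi_zpow k hp, autFac]

theorem autFac_mul (k : ℕ) (γ δ : Sp n) (τ : HSpace n) :
    autFac k (γ * δ) τ.1 = autFac k γ (moebius δ τ.1) * autFac k δ τ.1 := by
  rw [autFac, det_denom_mul, mul_zpow, autFac, autFac]

/-! ### Right cosets and the series 𝔼*|γ -/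

/-- The space of cosets `Γ_∞⁺ \ Sp_n(ℤ)`. -/
abbrev CosetP (n : ℕ) : Type := Quotient (QuotientGroup.rightRel (GammaInfPlus n))

section RightCosets

variable {G : Type*} [Group G] (H : Subgroup G)

theorem exists_out_eq_mul (x : G) :
    ∃ h ∈ H, (Quotient.mk (QuotientGroup.rightRel H) x).out = h * x := by
  have h : QuotientGroup.rightRel H (Quotient.mk (QuotientGroup.rightRel H) x).out x :=
    Quotient.exact (Quotient.out_eq (Quotient.mk (QuotientGroup.rightRel H) x))
  rw [QuotientGroup.rightRel_apply] at h
  exact ⟨_, H.inv_mem h, by group⟩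

theorem mk_eq_mk_iff {x y : G} :
    Quotient.mk (QuotientGroup.rightRel H) x = Quotient.mk (QuotientGroup.rightRel H) y ↔
      y * x⁻¹ ∈ H := by
  rw [Quotient.eq, QuotientGroup.rightRel_apply]

/-- Left translation by an element of the normalizer on the space of right cosets. -/
noncomputable def leftTranslate (p : G) (hp : ∀ h, h ∈ H ↔ p * h * p⁻¹ ∈ H) :
    Quotient (QuotientGroup.rightRel H) ≃ Quotient (QuotientGroup.rightRel H) where
  toFun q := Quotient.mk _ (p * q.out)
  invFun q := Quotient.mk _ (p⁻¹ * q.out)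
  left_inv q := by
    obtain ⟨h, hh, e⟩ := exists_out_eq_mul H (p * q.out)
    simp only [e]
    conv_rhs => rw [← q.out_eq]
    rw [mk_eq_mk_iff, hp]
    simpa [mul_assoc] using H.inv_mem hh
  right_inv q := by
    obtain ⟨h, hh, e⟩ := exists_out_eq_mul H (p⁻¹ * q.out)
    simp only [e]
    conv_rhs => rw [← q.out_eq]
    rw [mk_eq_mk_iff]
    have := (hp h⁻¹).1 (H.inv_mem hh)
    simpa [mul_assoc] using this

theorem finsum_mul_out {M : Type*} [AddCommMonoid M] {f : G → M}
    (hf : ∀ h ∈ H, ∀ x, f (h * x) = f x) (p : G) (hp : ∀ h, h ∈ H ↔ p * h * p⁻¹ ∈ H) :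
    ∑ᶠ q : Quotient (QuotientGroup.rightRel H), f (p * q.out) =
      ∑ᶠ q : Quotient (QuotientGroup.rightRel H), f q.out := by
  rw [← finsum_comp_equiv (leftTranslate H p hp) (f := fun q => f q.out)]
  refine finsum_congr fun q => ?_
  obtain ⟨h, hh, e⟩ := exists_out_eq_mul H (p * q.out)
  have : (leftTranslate H p hp q).out = h * (p * q.out) := e
  rw [this, hf h hh]

/-- Right translation on the space of right cosets. -/
noncomputable def translate (b : G) :
    Quotient (QuotientGroup.rightRel H) ≃ Quotient (QuotientGroup.rightRel H) where
  toFun q := Quotient.mk _ (q.out * b)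
  invFun q := Quotient.mk _ (q.out * b⁻¹)
  left_inv q := by
    obtain ⟨h, hh, e⟩ := exists_out_eq_mul H (q.out * b)
    simp only [e]
    conv_rhs => rw [← q.out_eq]
    rw [mk_eq_mk_iff]
    simpa [mul_assoc] using H.inv_mem hh
  right_inv q := by
    obtain ⟨h, hh, e⟩ := exists_out_eq_mul H (q.out * b⁻¹)
    simp only [e]
    conv_rhs => rw [← q.out_eq]
    rw [mk_eq_mk_iff]
    simpa [mul_assoc] using H.inv_mem hh

end RightCosets

open Classical in
/-- The summand of `𝔼*|γ` at a coset of `Γ_∞⁺`. -/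
noncomputable def eisTerm (k N : ℕ) (γ : Sp n) (τ : Matrix (Fin n) (Fin n) ℂ)
    (q : CosetP n) : ℂ :=
  if q.out * γ⁻¹ ∈ infGamma n N then autFac k q.out τ else 0

theorem autFac_out (k : ℕ) (x : Sp n) (τ : Matrix (Fin n) (Fin n) ℂ) :
    autFac k (Quotient.mk _ x : CosetP n).out τ = autFac k x τ := by
  obtain ⟨h, hh, e⟩ := exists_out_eq_mul (GammaInfPlus n) x
  rw [e, autFac_parabolic_mul k (GammaInfPlus_le_parabolic n hh), psi_eq_one k hh, one_mul]

theorem out_mul_mem_infGamma_iff {N : ℕ} (x y : Sp n) :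
    (Quotient.mk _ x : CosetP n).out * y ∈ infGamma n N ↔ x * y ∈ infGamma n N := by
  obtain ⟨h, hh, e⟩ := exists_out_eq_mul (GammaInfPlus n) x
  rw [e, mul_assoc]
  exact Subgroup.mul_mem_cancel_left _ (Subgroup.mem_sup_left hh)

/-- Right multiplication by γ identifies (Γ_∞⁺ ∩ Γ(N))\Γ(N) with the cosets in Γ_∞⁺\Γ_∞⁺Γ(N)γ.
Summing over one index set for all γ lets series be compared termwise and dominated uniformly. -/
theorem slash_eisStar (k N : ℕ) (γ : Sp n) (τ : HSpace n) :
    slash k (eisStar n k N) γ τ.1 = ∑' q : CosetP n, eisTerm k N γ τ.1 q := by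
  let Q := Quotient (QuotientGroup.rightRel ((GammaInfPlus n).subgroupOf (Gamma n N)))
  let g : Q → CosetP n := fun c => Quotient.mk _ (c.out.1 * γ)
  have hg : Function.Injective g := by
    intro c c' h
    rw [← c.out_eq, ← c'.out_eq, mk_eq_mk_iff, Subgroup.mem_subgroupOf]
    have := (mk_eq_mk_iff (GammaInfPlus n)).1 h
    simpa [mul_assoc] using this
  have hs : Function.support (eisTerm k N γ τ.1) ⊆ Set.range g := by
    intro q hq
    have hmem : q.out * γ⁻¹ ∈ infGamma n N := by
      by_contra hn
      exact hq (if_neg hn)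
    obtain ⟨p, hp, x, hx, e⟩ := mem_infGamma.1 hmem
    refine ⟨Quotient.mk _ ⟨x, hx⟩, ?_⟩
    obtain ⟨h, hh, e'⟩ := exists_out_eq_mul ((GammaInfPlus n).subgroupOf (Gamma n N)) ⟨x, hx⟩
    have e2 : ((Quotient.mk _ ⟨x, hx⟩ : Q).out : Sp n) = h * x := congrArg Subtype.val e'
    change Quotient.mk _ (((Quotient.mk _ ⟨x, hx⟩ : Q).out : Sp n) * γ) = q
    conv_rhs => rw [← q.out_eq]
    rw [e2, mk_eq_mk_iff]
    have e3 : q.out = p * x * γ := by rw [e]; group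
    rw [e3]
    have : p * x * γ * (h * x * γ)⁻¹ = p * (h : Sp n)⁻¹ := by group
    rw [this]
    exact mul_mem hp (inv_mem hh)
  rw [← hg.tsum_eq hs]
  have hterm : ∀ c : Q, eisTerm k N γ τ.1 (g c) =
      (denom γ τ.1).det ^ (-(k : ℤ)) * slash k (fun _ => 1) c.out.1 (moebius γ τ.1) := by
    intro c
    have h1 : (g c).out * γ⁻¹ ∈ infGamma n N := by
      rw [out_mul_mem_infGamma_iff, mul_inv_cancel_right]
      exact Subgroup.mem_sup_right c.out.2
    rw [eisTerm, if_pos h1, autFac_out, autFac_mul, slash, mul_one, mul_comm]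
    rfl
  rw [tsum_congr hterm, tsum_mul_left]
  rfl

theorem mem_GammaInfPlus_iff_conj {p : Sp n} (hp : p ∈ parabolic n) (h : Sp n) :
    h ∈ GammaInfPlus n ↔ p * h * p⁻¹ ∈ GammaInfPlus n :=
  ⟨conj_mem_GammaInfPlus hp, fun hh => by
    simpa [mul_assoc] using conj_mem_GammaInfPlus (inv_mem hp) hh⟩

theorem eisTerm_parabolic_mul (k N : ℕ) {p : Sp n} (hp : p ∈ parabolic n) {g : Sp n}
    (hg : g ∈ Gamma n N) (γ : Sp n) (τ : Matrix (Fin n) (Fin n) ℂ) (q : CosetP n) :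
    eisTerm k N (p * g * γ) τ (leftTranslate (GammaInfPlus n) p
      (mem_GammaInfPlus_iff_conj hp) q) =
      psi k p * eisTerm k N γ τ q := by
  have h1 : ∀ x y : Sp n, (leftTranslate (GammaInfPlus n) p
      (mem_GammaInfPlus_iff_conj hp) q) =
        Quotient.mk _ (p * q.out) := fun _ _ => rfl
  rw [h1 1 1, eisTerm, eisTerm, out_mul_mem_infGamma_iff, autFac_out, autFac_parabolic_mul k hp]
  have h2 : p * q.out * (p * g * γ)⁻¹ ∈ infGamma n N ↔ q.out * γ⁻¹ ∈ infGamma n N := by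
    have e : p * q.out * (p * g * γ)⁻¹ = p * (q.out * γ⁻¹ * g⁻¹) * p⁻¹ := by group
    have hg' : g⁻¹ ∈ infGamma n N := Subgroup.mem_sup_right (inv_mem hg)
    rw [e]
    constructor
    · intro h
      have := conj_mem_infGamma (inv_mem hp) h
      rw [← Subgroup.mul_mem_cancel_right _ hg']
      simpa [mul_assoc] using this
    · intro h
      exact conj_mem_infGamma hp (mul_mem h hg')
  by_cases h : q.out * γ⁻¹ ∈ infGamma n N
  · rw [if_pos (h2.2 h), if_pos h]
  · rw [if_neg (fun h' => h (h2.1 h')), if_neg h, mul_zero]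

/-- Left translation by p permutes the cosets of Γ_∞⁺, carries the support for γ to that for pgγ,
and multiplies each automorphy factor by the sign of p. -/
theorem slash_eisStar_parabolic_mul (k N : ℕ) {p : Sp n} (hp : p ∈ parabolic n) {g : Sp n}
    (hg : g ∈ Gamma n N) (γ : Sp n) (τ : HSpace n) :
    slash k (eisStar n k N) (p * g * γ) τ.1 = psi k p * slash k (eisStar n k N) γ τ.1 := by
  rw [slash_eisStar, slash_eisStar, ← tsum_mul_left,
    ← (leftTranslate (GammaInfPlus n) p (mem_GammaInfPlus_iff_conj hp)).tsum_eq]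
  exact tsum_congr fun q => eisTerm_parabolic_mul k N hp hg γ τ.1 q

/-! ### Character sums and the transformation law -/

theorem blkD_gammaPM : blkD (gammaPM n) = diagFirst n (-1) := by
  simp [blkD, gammaPM]

theorem blkC_gammaPM : blkC (gammaPM n) = 0 := by
  simp [blkC, gammaPM]

theorem gammaPM_mem_parabolic : gammaPM n ∈ parabolic n := blkC_gammaPM

theorem det_diagFirst (hn : 0 < n) (w : ℤ) : (diagFirst n w).det = w := by
  rw [diagFirst, det_diagonal, Finset.prod_eq_single ⟨0, hn⟩]
  · simp
  · intro i _ hi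
    rw [if_neg]
    intro h
    exact hi (Fin.ext h)
  · simp

theorem det_blkD_gammaPM (hn : 0 < n) : (blkD (gammaPM n)).det = -1 := by
  rw [blkD_gammaPM, det_diagFirst hn]

theorem map_det_mul_of_mem_Gamma0 {N : ℕ} {a : Sp n} (ha : a ∈ Gamma0 n N) (b : Sp n) :
    (((blkD (a * b)).det : ℤ) : ZMod N) =
      (((blkD a).det : ℤ) : ZMod N) * (((blkD b).det : ℤ) : ZMod N) := by
  have ha' : (blkC a).map (Int.castRingHom (ZMod N)) = 0 := ha
  change Int.castRingHom (ZMod N) _ = Int.castRingHom (ZMod N) _ * Int.castRingHom (ZMod N) _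
  rw [RingHom.map_det, RingHom.map_det, RingHom.map_det, blkD_mul, map_add, map_mul, map_mul]
  simp only [RingHom.mapMatrix_apply]
  rw [ha', Matrix.zero_mul, zero_add, det_mul]

theorem chiSp_mul {N : ℕ} (χ : DirichletCharacter ℂ N) {a : Sp n} (ha : a ∈ Gamma0 n N)
    (b : Sp n) : chiSp χ (a * b) = chiSp χ a * chiSp χ b := by
  rw [chiSp, map_det_mul_of_mem_Gamma0 ha, map_mul, chiSp, chiSp]

theorem chiSp_one {N : ℕ} (χ : DirichletCharacter ℂ N) : chiSp χ (1 : Sp n) = 1 := by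
  simp [chiSp]

theorem chiSp_of_mem_Gamma {N : ℕ} (χ : DirichletCharacter ℂ N) {g : Sp n}
    (hg : g ∈ Gamma n N) : chiSp χ g = 1 := by
  rw [mem_Gamma_iff, red_eq_fromBlocks, ← fromBlocks_one] at hg
  have h := (fromBlocks_inj.1 hg).2.2.2
  have : (((blkD g).det : ℤ) : ZMod N) = 1 := by
    change Int.castRingHom (ZMod N) _ = 1
    rw [RingHom.map_det, RingHom.mapMatrix_apply, h, det_one]
  rw [chiSp, this, map_one]

theorem chiSp_mul_chiSp_inv {N : ℕ} (χ : DirichletCharacter ℂ N) {a : Sp n}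
    (ha : a ∈ Gamma0 n N) : chiSp χ a * chiSp χ a⁻¹ = 1 := by
  rw [← chiSp_mul χ ha, mul_inv_cancel, chiSp_one]

theorem norm_chiSp {N : ℕ} (χ : DirichletCharacter ℂ N) {a : Sp n}
    (ha : a ∈ Gamma0 n N) : ‖chiSp χ a‖ = 1 := by
  have h := congrArg norm (chiSp_mul_chiSp_inv χ ha)
  rw [norm_mul, norm_one] at h
  have h1 : ‖chiSp χ a‖ ≤ 1 := χ.norm_le_one _
  have h2 : ‖chiSp χ a⁻¹‖ ≤ 1 := χ.norm_le_one _
  nlinarith [norm_nonneg (chiSp χ a), norm_nonneg (chiSp χ a⁻¹)]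

theorem conj_chiSp_mul_chiSp {N : ℕ} (χ : DirichletCharacter ℂ N) {a : Sp n}
    (ha : a ∈ Gamma0 n N) : starRingEnd ℂ (chiSp χ a) * chiSp χ a = 1 := by
  rw [mul_comm, Complex.mul_conj, Complex.normSq_eq_norm_sq, norm_chiSp χ ha]; simp

theorem gammaPM_mem_Gamma0 (N : ℕ) : gammaPM n ∈ Gamma0 n N := by
  change (blkC (gammaPM n)).map _ = 0
  rw [blkC_gammaPM]; ext; simp

/-- The space of cosets `Γ(N) \ Γ₀(N)`. -/
abbrev CosetLevel (n N : ℕ) : Type :=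
  Quotient (QuotientGroup.rightRel ((Gamma n N).subgroupOf (Gamma0 n N)))

theorem finite_cosetLevel (n : ℕ) {N : ℕ} (hN : 0 < N) : Finite (CosetLevel n N) := by
  have := finiteIndex_Gamma n hN
  have : Finite (Gamma0 n N ⧸ (Gamma n N).subgroupOf (Gamma0 n N)) :=
    Subgroup.finite_quotient_of_finiteIndex
  exact Finite.of_equiv _ (QuotientGroup.quotientRightRelEquivQuotientLeftRel _).symm

/-- The character sum `∑_β χ̄(β) 𝔼*|γβ`. -/
noncomputable def eisSum {N : ℕ} (k : ℕ) (χ : DirichletCharacter ℂ N) (γ : Sp n)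
    (τ : Matrix (Fin n) (Fin n) ℂ) : ℂ :=
  ∑ᶠ c : CosetLevel n N, starRingEnd ℂ (chiSp χ (c.out : Gamma0 n N).1) *
        slash k (eisStar n k N) (γ * (c.out : Gamma0 n N).1) τ

/-- Passing from γ to γ_±γ costs the sign (-1)^k, which the factor χ̄(γ_±) = χ̄(-1) cancels; the two
sums are equal. -/
theorem eisPrime_eq {N k : ℕ} (hn : 0 < n) (χ : DirichletCharacter ℂ N)
    (hχ : χ (-1) = (-1 : ℂ) ^ k) (γ : Sp n) (τ : HSpace n) :
    eisPrime k χ γ τ.1 = 2 * eisSum k χ γ τ.1 := by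
  rw [eisPrime, two_mul]
  congr 1
  refine finsum_congr fun c => ?_
  have h1 : slash k (eisStar n k N) (gammaPM n * γ * (c.out : Gamma0 n N).1) τ.1 =
      psi k (gammaPM n) * slash k (eisStar n k N) (γ * (c.out : Gamma0 n N).1) τ.1 := by
    rw [← slash_eisStar_parabolic_mul k N gammaPM_mem_parabolic (one_mem _), mul_one, mul_assoc]
  have h2 : chiSp χ (gammaPM n) = psi k (gammaPM n) := by
    rw [chiSp, psi, det_blkD_gammaPM hn]
    simpa using hχ
  rw [h1, chiSp_mul χ (gammaPM_mem_Gamma0 N), h2, map_mul]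
  have h3 : starRingEnd ℂ (psi k (gammaPM n)) * psi k (gammaPM n) = 1 := by
    rw [← h2]; exact conj_chiSp_mul_chiSp χ (gammaPM_mem_Gamma0 N)
  calc _ = (starRingEnd ℂ (psi k (gammaPM n)) * psi k (gammaPM n)) *
        (starRingEnd ℂ (chiSp χ (c.out : Gamma0 n N).1) *
          slash k (eisStar n k N) (γ * (c.out : Gamma0 n N).1) τ.1) := by ring
    _ = _ := by rw [h3, one_mul]

/-- Left multiplication by β permutes Γ(N)\Γ₀(N) because Γ(N) is normal; reindexing extracts χ(β),
while p contributes its sign and g nothing. -/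
theorem eisSum_transform {N : ℕ} (k : ℕ) (χ : DirichletCharacter ℂ N) {p g β : Sp n}
    (hp : p ∈ parabolic n) (hg : g ∈ Gamma n N) (hβ : β ∈ Gamma0 n N) (γ : Sp n) (τ : HSpace n) :
    eisSum k χ (p * g * γ * β) τ.1 = psi k p * chiSp χ β * eisSum k χ γ τ.1 := by
  let f : Gamma0 n N → ℂ := fun b => starRingEnd ℂ (chiSp χ b.1) *
    slash k (eisStar n k N) (γ * b.1) τ.1
  have hf : ∀ h ∈ (Gamma n N).subgroupOf (Gamma0 n N), ∀ x, f (h * x) = f x := by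
    intro h hh x
    have hh' : (h : Sp n) ∈ Gamma n N := hh
    change starRingEnd ℂ (chiSp χ (h.1 * x.1)) * slash k (eisStar n k N) (γ * (h.1 * x.1)) τ.1 = _
    have e : γ * (h.1 * x.1) = 1 * (γ * h.1 * γ⁻¹) * (γ * x.1) := by group
    rw [chiSp_mul χ h.2, chiSp_of_mem_Gamma χ hh', one_mul, e,
      slash_eisStar_parabolic_mul k N (one_mem _) (Subgroup.Normal.conj_mem inferInstance _ hh' γ),
      psi_eq_one k (one_mem _), one_mul]
  have hn : ∀ h, h ∈ (Gamma n N).subgroupOf (Gamma0 n N) ↔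
      (⟨β, hβ⟩ : Gamma0 n N) * h * (⟨β, hβ⟩ : Gamma0 n N)⁻¹ ∈
        (Gamma n N).subgroupOf (Gamma0 n N) := fun h =>
    ⟨fun hh => Subgroup.Normal.conj_mem inferInstance _ hh _, fun hh => by
      simpa [mul_assoc] using
        Subgroup.Normal.conj_mem inferInstance _ hh (⟨β, hβ⟩ : Gamma0 n N)⁻¹⟩
  have h2 : eisSum k χ γ τ.1 = ∑ᶠ c : CosetLevel n N, f c.out := rfl
  rw [h2, ← finsum_mul_out _ hf ⟨β, hβ⟩ hn, eisSum, ← smul_eq_mul (psi k p * chiSp χ β),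
    smul_finsum]
  refine finsum_congr fun c => ?_
  change _ = _ * (starRingEnd ℂ (chiSp χ (β * c.out.1)) *
    slash k (eisStar n k N) (γ * (β * c.out.1)) τ.1)
  have e : p * g * γ * β * c.out.1 = p * g * (γ * (β * c.out.1)) := by group
  rw [e, slash_eisStar_parabolic_mul k N hp hg, chiSp_mul χ hβ, map_mul]
  calc _ = (starRingEnd ℂ (chiSp χ β) * chiSp χ β) * (starRingEnd ℂ (chiSp χ c.out.1) *
        (psi k p * slash k (eisStar n k N) (γ * (β * c.out.1)) τ.1)) := by
        rw [conj_chiSp_mul_chiSp χ hβ, one_mul]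
    _ = _ := by ring

theorem mem_stabPlus_iff {N : ℕ} {γ δ : Sp n} :
    δ ∈ stabPlus n N γ ↔ δ ∈ Gamma0 n N ∧ γ * δ * γ⁻¹ ∈ infGamma n N := by
  have hset : ((GammaInfPlus n : Set (Sp n)) * (Gamma n N : Set (Sp n))) = infGamma n N :=
    (Subgroup.mul_normal _ _).symm
  change _ ∧ _ = _ ↔ _
  rw [hset, Set.mul_singleton, Set.mul_singleton]
  refine and_congr_right fun _ => ⟨fun h => ?_, fun h => ?_⟩
  · have h1 : γ * δ ∈ (fun x => x * γ) '' (infGamma n N : Set (Sp n)) := by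
      rw [← h]; exact ⟨1, one_mem _, one_mul _⟩
    obtain ⟨x, hx, e⟩ := h1
    have e' : γ * δ * γ⁻¹ = x := by rw [← e]; group
    rw [e']; exact hx
  · ext y
    constructor
    · rintro ⟨x, hx, rfl⟩
      refine ⟨x * (γ * δ * γ⁻¹), mul_mem hx h, ?_⟩
      simp only; group
    · rintro ⟨x, hx, rfl⟩
      refine ⟨x * (γ * δ * γ⁻¹)⁻¹, mul_mem hx (inv_mem h), ?_⟩
      simp only; group

/-- The two stabilizers are conjugate by β, and conjugation fixes Γ(N). -/
theorem relIndex_stabPlus {N : ℕ} {p g β : Sp n} (hp : p ∈ parabolic n) (hg : g ∈ Gamma n N)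
    (hβ : β ∈ Gamma0 n N) (γ : Sp n) :
    (Gamma n N).relIndex (stabPlus n N (p * g * γ * β)) =
      (Gamma n N).relIndex (stabPlus n N γ) := by
  rw [← Subgroup.relIndex_pointwise_smul (MulAut.conj β) (Gamma n N) (stabPlus n N _)]
  congr 1
  · exact Subgroup.Normal.conj_smul_eq_self β (Gamma n N)
  · ext δ
    rw [Subgroup.mem_pointwise_smul_iff_inv_smul_mem, mem_stabPlus_iff, mem_stabPlus_iff]
    have e1 : (MulAut.conj β)⁻¹ • δ = β⁻¹ * δ * β := by
      rw [← map_inv]; simp [MulAut.smul_def]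
    rw [e1]
    refine and_congr ?_ ?_
    · rw [Subgroup.mul_mem_cancel_right _ hβ, Subgroup.mul_mem_cancel_left _ (inv_mem hβ)]
    · have hg' : g ∈ infGamma n N := Subgroup.mem_sup_right hg
      have e2 : p * g * γ * β * (β⁻¹ * δ * β) * (p * g * γ * β)⁻¹ =
        p * (g * (γ * δ * γ⁻¹) * g⁻¹) * p⁻¹ := by group
      rw [e2]
      constructor
      · intro h
        have := conj_mem_infGamma (inv_mem hp) h
        have h3 := mul_mem (mul_mem (inv_mem hg') this) hg'
        simpa [mul_assoc] using h3
      · intro h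
        exact conj_mem_infGamma hp (mul_mem (mul_mem hg' h) (inv_mem hg'))

theorem relIndex_stabPlus_ne_zero {N : ℕ} (hN : 0 < N) (γ : Sp n) :
    (Gamma n N).relIndex (stabPlus n N γ) ≠ 0 := by
  have := finiteIndex_Gamma n hN
  exact Subgroup.FiniteIndex.index_ne_zero

theorem eis_eq {N k : ℕ} (hn : 0 < n) (χ : DirichletCharacter ℂ N)
    (hχ : χ (-1) = (-1 : ℂ) ^ k) (γ : Sp n) (τ : HSpace n) :
    eis k χ γ τ = ((Gamma n N).relIndex (stabPlus n N γ) : ℂ)⁻¹ * eisSum k χ γ τ.1 := by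
  rw [eis, eisPrime_eq hn χ hχ, mul_inv]
  ring

/-- The transformation law of `𝔼_γ` in the double coset variable `γ`. -/
theorem eis_transform {N k : ℕ} (hn : 0 < n) (χ : DirichletCharacter ℂ N)
    (hχ : χ (-1) = (-1 : ℂ) ^ k) {p g β : Sp n}
    (hp : p ∈ parabolic n) (hg : g ∈ Gamma n N) (hβ : β ∈ Gamma0 n N) (γ : Sp n) :
    eis k χ (p * g * γ * β) = (psi k p * chiSp χ β) • eis k χ γ := by
  funext τ
  rw [Pi.smul_apply, eis_eq hn χ hχ, eis_eq hn χ hχ, eisSum_transform k χ hp hg hβ,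
    relIndex_stabPlus hp hg hβ, smul_eq_mul]
  ring

/-! ### Convergence of the Siegel series -/

open ENNReal

/-- The torsion group `ℚ/ℤ`. -/
abbrev QZ : Type := AddCircle (1 : ℚ)

theorem isOfFinAddOrder_QZ (x : QZ) : IsOfFinAddOrder x := by
  obtain ⟨q, rfl⟩ := QuotientAddGroup.mk_surjective x
  rw [isOfFinAddOrder_iff_nsmul_eq_zero]
  refine ⟨q.den, q.den_pos, ?_⟩
  have : q.den • q = ((q.num : ℤ) : ℚ) := by
    rw [nsmul_eq_mul]; exact_mod_cast q.den_mul_eq_num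
  change q.den • ((q : ℚ) : QZ) = 0
  rw [← AddCircle.coe_nsmul, this, AddCircle.coe_eq_zero_iff]
  exact ⟨q.num, by simp⟩

theorem exists_nsmul_eq_zero {ι : Type*} [Finite ι] (x : ι → QZ) : ∃ d : ℕ, 0 < d ∧ d • x = 0 := by
  have := Fintype.ofFinite ι
  refine ⟨∏ i, addOrderOf (x i), Finset.prod_pos fun i _ => (isOfFinAddOrder_QZ _).addOrderOf_pos,
    funext fun i => ?_⟩
  rw [Pi.smul_apply, Pi.zero_apply, ← addOrderOf_dvd_iff_nsmul_eq_zero]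
  exact Finset.dvd_prod_of_mem _ (Finset.mem_univ i)

theorem tsum_comp_le {α β : Type*} (f : α → β) (G : β → ℝ≥0∞) (K : β → ℕ)
    (hK : ∀ y, (f ⁻¹' {y}).encard ≤ K y) : ∑' x, G (f x) ≤ ∑' y, K y * G y := by
  rw [← ENNReal.tsum_fiberwise _ f]
  refine ENNReal.tsum_le_tsum fun y => ?_
  have h1 : ∑' x : f ⁻¹' {y}, G (f x) = ∑' _ : f ⁻¹' {y}, G y :=
    tsum_congr fun x => by rw [show f x = y from x.2]
  rw [h1, ENNReal.tsum_set_const]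
  gcongr
  calc ((f ⁻¹' {y}).encard : ℝ≥0∞) ≤ ((K y : ℕ∞) : ℝ≥0∞) := ENat.toENNReal_le.2 (hK y)
    _ = K y := by simp

/-- A nonempty solution set is a translate of the d-torsion, counted coordinatewise. -/
theorem encard_fiber_le {A : Type*} [AddCommGroup A] {ι : Type*} [Fintype ι] (d : ℕ)
    (hA : {x : A | d • x = 0}.encard ≤ d) (c : ι → A) :
    {x : ι → A | d • x = c}.encard ≤ (d ^ Fintype.card ι : ℕ) := by
  classical
  rcases Set.eq_empty_or_nonempty {x : ι → A | d • x = c} with h | ⟨x₀, h₀⟩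
  · rw [h]; simp
  have hfin : {x : A | d • x = 0}.Finite :=
    Set.finite_of_encard_le_coe hA
  have hsub : {x : ι → A | d • x = c} ⊆
      (fun y => y + x₀) '' (Fintype.piFinset fun _ : ι => hfin.toFinset : Set (ι → A)) := by
    intro x hx
    refine ⟨x - x₀, ?_, by simp⟩
    rw [Finset.mem_coe, Fintype.mem_piFinset]
    intro i
    rw [Set.Finite.mem_toFinset]
    have : d • (x - x₀) = 0 := by
      rw [smul_sub, show d • x = c from hx, show d • x₀ = c from h₀, sub_self]
    exact congrFun this i
  refine (Set.encard_le_encard hsub).trans ((Set.encard_image_le _ _).trans ?_)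
  rw [Set.encard_coe_eq_coe_finsetCard, Fintype.card_piFinset, Finset.prod_const, Finset.card_univ]
  rw [hfin.encard_eq_coe_toFinset_card] at hA
  exact_mod_cast Nat.pow_le_pow_left (by exact_mod_cast hA) _

theorem encard_torsion_QZ (d : ℕ) (hd : d ≠ 0) : {x : QZ | d • x = 0}.encard ≤ d :=
  AddCircle.card_torsion_le_of_isSMulRegular _ d hd
    (.of_right_eq_zero_of_smul fun _ ↦ by simp [hd])

/-- The weight `d^{-s}` as an extended nonnegative real, with value `0` at `d = 0`. -/
noncomputable def wt (s d : ℕ) : ℝ≥0∞ := ENNReal.ofReal (((d : ℝ) ^ s)⁻¹)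

theorem wt_mul (s a b : ℕ) : wt s (a * b) = wt s a * wt s b := by
  rw [wt, wt, wt, ← ENNReal.ofReal_mul (by positivity)]
  push_cast
  rw [mul_pow, mul_inv]

theorem natCast_mul_wt_le (s d : ℕ) : (d : ℝ≥0∞) * wt (s + 1) d ≤ wt s d := by
  rcases Nat.eq_zero_or_pos d with rfl | hd
  · simp
  · rw [wt, wt, ← ENNReal.ofReal_natCast, ← ENNReal.ofReal_mul (by positivity)]
    apply le_of_eq
    congr 1
    have : (d : ℝ) ≠ 0 := by positivity
    field_simp
    ring

theorem natCast_pow_mul_wt_le (s m d : ℕ) : ((d ^ m : ℕ) : ℝ≥0∞) * wt (s + m) d ≤ wt s d := by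
  induction m with
  | zero => simp
  | succ m ih =>
    calc ((d ^ (m + 1) : ℕ) : ℝ≥0∞) * wt (s + (m + 1)) d
        = ((d ^ m : ℕ) : ℝ≥0∞) * (d * wt (s + m + 1) d) := by
          rw [pow_succ, Nat.cast_mul, mul_assoc]; rfl
      _ ≤ ((d ^ m : ℕ) : ℝ≥0∞) * wt (s + m) d := by gcongr; exact natCast_mul_wt_le _ _
      _ ≤ _ := ih

theorem wt_anti {s a b : ℕ} (ha : 0 < a) (h : a ≤ b) : wt s b ≤ wt s a := by
  apply ENNReal.ofReal_le_ofReal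
  have : (0 : ℝ) < a := by exact_mod_cast ha
  gcongr

theorem tsum_wt_ne_top {s : ℕ} (hs : 2 ≤ s) : ∑' d : ℕ, wt s d ≠ ∞ := by
  have h := (Real.summable_nat_pow_inv (p := s)).2 (by omega)
  exact h.tsum_ofReal_ne_top

section Columns

variable {m : ℕ}

/-- The homomorphism `a ↦ R a` attached to a matrix over `ℚ/ℤ`. -/
def colHom (R : Matrix (Fin m) (Fin m) QZ) : (Fin m → ℤ) →+ (Fin m → QZ) where
  toFun a i := ∑ j, a j • R i j
  map_zero' := by ext i; simp
  map_add' a b := by ext i; simp [add_smul, Finset.sum_add_distrib]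

theorem colHom_apply (R : Matrix (Fin m) (Fin m) QZ) (a : Fin m → ℤ) (i : Fin m) :
    colHom R a i = ∑ j, a j • R i j := rfl

/-- The order of the subgroup of `(ℚ/ℤ)^m` generated by the columns of `R`; for the class of a
rational symmetric matrix this is the absolute value of its denominator determinant. -/
noncomputable def nu (R : Matrix (Fin m) (Fin m) QZ) : ℕ := Nat.card (colHom R).range

instance (R : Matrix (Fin m) (Fin m) QZ) : Finite (colHom R).range := by
  have : AddGroup.FG (colHom R).range :=
    AddGroup.fg_of_surjective (f := (colHom R).rangeRestrict) (colHom R).rangeRestrict_surjective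
  refine AddCommGroup.finite_of_fg_isAddTorsion _ fun x => ?_
  obtain ⟨d, hd, h⟩ := exists_nsmul_eq_zero x.1
  exact isOfFinAddOrder_iff_nsmul_eq_zero.2 ⟨d, hd, Subtype.ext h⟩

theorem nu_pos (R : Matrix (Fin m) (Fin m) QZ) : 0 < nu R := Nat.card_pos

/-- The order of `r` modulo the column group of `R`. -/
noncomputable def relOrder (R : Matrix (Fin m) (Fin m) QZ) (r : Fin m → QZ) : ℕ :=
  addOrderOf (QuotientAddGroup.mk r : (Fin m → QZ) ⧸ (colHom R).range)

theorem relOrder_dvd_iff (R : Matrix (Fin m) (Fin m) QZ) (r : Fin m → QZ) (d : ℤ) :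
    (relOrder R r : ℤ) ∣ d ↔ d • r ∈ (colHom R).range := by
  rw [relOrder, addOrderOf_dvd_iff_zsmul_eq_zero, ← QuotientAddGroup.mk_zsmul,
    QuotientAddGroup.eq_zero_iff]

theorem relOrder_pos (R : Matrix (Fin m) (Fin m) QZ) (r : Fin m → QZ) : 0 < relOrder R r := by
  obtain ⟨d, hd, h⟩ := exists_nsmul_eq_zero r
  rw [relOrder]
  refine IsOfFinAddOrder.addOrderOf_pos (isOfFinAddOrder_iff_nsmul_eq_zero.2 ⟨d, hd, ?_⟩)
  rw [← QuotientAddGroup.mk_nsmul, h, QuotientAddGroup.mk_zero]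

theorem relOrder_nsmul_mem (R : Matrix (Fin m) (Fin m) QZ) (r : Fin m → QZ) :
    relOrder R r • r ∈ (colHom R).range := by
  have := (relOrder_dvd_iff R r (relOrder R r)).1 dvd_rfl
  rwa [natCast_zsmul] at this

/-- Coefficients expressing `relOrder R r • r` through the columns of `R`. -/
noncomputable def relCoeff (R : Matrix (Fin m) (Fin m) QZ) (r : Fin m → QZ) : Fin m → ℤ :=
  (relOrder_nsmul_mem R r).choose

theorem colHom_relCoeff (R : Matrix (Fin m) (Fin m) QZ) (r : Fin m → QZ) :
    colHom R (relCoeff R r) = relOrder R r • r := (relOrder_nsmul_mem R r).choose_spec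

/-- The residual corner entry after eliminating the first column by the others. -/
noncomputable def corner (R : Matrix (Fin m) (Fin m) QZ) (r : Fin m → QZ) (x : QZ) : QZ :=
  relOrder R r • x - ∑ j, relCoeff R r j • r j

/-- Such an r has d • r among the ν(R) elements of the column group, and each value has at most d^m
preimages under multiplication by d. -/
theorem encard_relOrder_eq_le (R : Matrix (Fin m) (Fin m) QZ) (d : ℕ) :
    (relOrder R ⁻¹' {d}).encard ≤ (d ^ m * nu R : ℕ) := by
  rcases Nat.eq_zero_or_pos d with rfl | hd
  · have : relOrder R ⁻¹' {0} = ∅ := by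
      ext r; simpa using (relOrder_pos R r).ne'
    rw [this]; simp
  have hsub : relOrder R ⁻¹' {d} ⊆ ⋃ h : (colHom R).range, {r | d • r = h.1} := by
    intro r hr
    have hr' : relOrder R r = d := hr
    exact Set.mem_iUnion.2 ⟨⟨_, relOrder_nsmul_mem R r⟩, by simp [hr']⟩
  have := Fintype.ofFinite (colHom R).range
  have hfib := fun h : (colHom R).range =>
    encard_fiber_le (ι := Fin m) d (encard_torsion_QZ d hd.ne') h.1
  calc _ ≤ (⋃ h : (colHom R).range, {r : Fin m → QZ | d • r = h.1}).encard :=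
        Set.encard_le_encard hsub
    _ ≤ ∑ h : (colHom R).range, {r : Fin m → QZ | d • r = h.1}.encard :=
        Set.encard_iUnion_le_of_fintype _
    _ ≤ ∑ h : (colHom R).range, ((d ^ m : ℕ) : ℕ∞) :=
        Finset.sum_le_sum fun h _ => by simpa using hfib h
    _ = _ := by
        rw [Finset.sum_const, Finset.card_univ, nu, Nat.card_eq_fintype_card]
        simp [mul_comm]

end Columns

/-- Counting the column group by its projection to the last m coordinates: the projection contains
the column group of the minor R₁ and, modulo it, d multiples of r. The kernel contains the column
combination with zero tail and head `corner`, hence at least its order many elements. Symmetry of R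
lets the first row be read from r. -/
theorem nu_lower_bound {m : ℕ} (R : Matrix (Fin (m + 1)) (Fin (m + 1)) QZ) (hR : R.IsSymm) :
    nu (R.submatrix Fin.succ Fin.succ) *
      relOrder (R.submatrix Fin.succ Fin.succ) (fun i => R i.succ 0) *
      addOrderOf (corner (R.submatrix Fin.succ Fin.succ) (fun i => R i.succ 0) (R 0 0)) ≤ nu R := by
  set R₁ := R.submatrix Fin.succ Fin.succ with hR₁
  set r : Fin m → QZ := fun i => R i.succ 0 with hr
  set d := relOrder R₁ r with hd
  set y := corner R₁ r (R 0 0) with hy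
  set g := addOrderOf y with hg
  have tail : ∀ (b : ℤ) (a : Fin m → ℤ) (i : Fin m),
      colHom R (Fin.cons b a) i.succ = b • r i + colHom R₁ a i := by
    intro b a i
    rw [colHom_apply, Fin.sum_univ_succ, colHom_apply]
    simp [hr, hR₁]
  have head : ∀ (b : ℤ) (a : Fin m → ℤ),
      colHom R (Fin.cons b a) 0 = b • R 0 0 + ∑ j, a j • r j := by
    intro b a
    rw [colHom_apply, Fin.sum_univ_succ]
    simp [hr, hR.apply]
  have hYtail : ∀ i : Fin m, colHom R (Fin.cons (d : ℤ) (-relCoeff R₁ r)) i.succ = 0 := by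
    intro i
    rw [tail, map_neg, colHom_relCoeff]
    simp [hd]
  have hYhead : colHom R (Fin.cons (d : ℤ) (-relCoeff R₁ r)) 0 = y := by
    rw [head, hy, corner]
    simp [hd, sub_eq_add_neg]
  let sec : (colHom R₁).range → Fin m → ℤ := fun h => h.2.choose
  have hsec : ∀ h, colHom R₁ (sec h) = h.1 := fun h => h.2.choose_spec
  -- An element of the minor's column group, a multiple of the first column below d, and a multiple
  -- of the kernel element below g: the tail recovers the first two, the head the third.
  let F : (colHom R₁).range × Fin d × Fin g → (colHom R).range := fun z =>
    (colHom R).rangeRestrict (Fin.cons (z.2.1 : ℤ) (sec z.1)) +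
      (z.2.2 : ℕ) • (colHom R).rangeRestrict (Fin.cons (d : ℤ) (-relCoeff R₁ r))
  have hF : Function.Injective F := by
    rintro ⟨h, i, t⟩ ⟨h', i', t'⟩ e
    have e' : colHom R (Fin.cons (i : ℤ) (sec h)) +
        (t : ℕ) • colHom R (Fin.cons (d : ℤ) (-relCoeff R₁ r)) =
        colHom R (Fin.cons (i' : ℤ) (sec h')) +
        (t' : ℕ) • colHom R (Fin.cons (d : ℤ) (-relCoeff R₁ r)) := congrArg Subtype.val e
    have etail : (i : ℤ) • r + h.1 = (i' : ℤ) • r + h'.1 := by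
      funext l
      have := congrFun e' l.succ
      simp only [Pi.add_apply, Pi.smul_apply, hYtail, tail, smul_zero, add_zero, hsec] at this
      simpa using this
    have hdvd : (d : ℤ) ∣ (i : ℤ) - i' := by
      refine (relOrder_dvd_iff R₁ r _).2 ?_
      rw [sub_smul]
      have : (i : ℤ) • r - (i' : ℤ) • r = h'.1 - h.1 := by
        rw [sub_eq_sub_iff_add_eq_add, etail, add_comm]
      rw [this]
      exact sub_mem h'.2 h.2
    have hi : i = i' := by
      have h1 := i.2
      have h2 := i'.2
      have := Int.eq_zero_of_abs_lt_dvd hdvd (by rw [abs_lt]; omega)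
      exact Fin.ext (by omega)
    subst hi
    have hh : h = h' := Subtype.ext (add_left_cancel etail)
    subst hh
    have ehead := congrFun e' 0
    simp only [Pi.add_apply, Pi.smul_apply, hYhead] at ehead
    have et := add_left_cancel ehead
    have ht : t = t' := by
      have hp : (t : ℕ) % g = (t' : ℕ) % g := (nsmul_eq_nsmul_iff_modEq).1 et
      rw [Nat.mod_eq_of_lt t.2, Nat.mod_eq_of_lt t'.2] at hp
      exact Fin.ext hp
    rw [ht]
  have := Nat.card_le_card_of_injective F hF
  rw [Nat.card_prod, Nat.card_prod, Nat.card_fin, Nat.card_fin] at this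
  rw [mul_assoc]
  exact this

/-- The corner is affine in x with slope `relOrder R r`, so each value is taken at most that often;
and at most d elements of ℚ/ℤ have order d, which costs one power of d. -/
theorem tsum_wt_corner_le {m : ℕ} (s : ℕ) (R : Matrix (Fin m) (Fin m) QZ) (r : Fin m → QZ) :
    ∑' x : QZ, wt (s + 1) (addOrderOf (corner R r x)) ≤ relOrder R r * ∑' d : ℕ, wt s d := by
  have h1 : ∀ y : QZ, ((fun x => corner R r x) ⁻¹' {y}).encard ≤ relOrder R r := by
    intro y
    have hpos := relOrder_pos R r
    have h := encard_fiber_le (ι := Unit) (relOrder R r) (encard_torsion_QZ _ hpos.ne')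
      (fun _ => y + ∑ j, relCoeff R r j • r j)
    simp only [Fintype.card_unit, pow_one] at h
    refine le_trans ?_ h
    refine Set.encard_le_encard_of_injOn (f := fun x _ => x) ?_ ?_
    · intro x hx
      have hx' : corner R r x = y := hx
      funext _
      simp only [Pi.smul_apply]
      rw [← hx', corner]; abel
    · intro x _ x' _ h
      exact congrFun h ()
  refine (tsum_comp_le (fun x => corner R r x) (fun y => wt (s + 1) (addOrderOf y))
    (fun _ => relOrder R r) h1).trans ?_
  rw [ENNReal.tsum_mul_left]
  gcongr
  refine (tsum_comp_le (fun y : QZ => addOrderOf y) (fun d => wt (s + 1) d) id ?_).trans ?_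
  · intro d
    rcases Nat.eq_zero_or_pos d with rfl | hd
    · have : (fun y : QZ => addOrderOf y) ⁻¹' {0} = ∅ := by
        ext r; simpa using isOfFinAddOrder_QZ r
      rw [this]; simp
    · refine le_trans (Set.encard_le_encard ?_) (encard_torsion_QZ d hd.ne')
      intro y hy
      have hy' : addOrderOf y = d := hy
      rw [← hy']
      exact addOrderOf_nsmul_eq_zero y
  · exact ENNReal.tsum_le_tsum fun d => natCast_mul_wt_le s d

theorem tsum_wt_relOrder_le {m : ℕ} (s : ℕ) (R : Matrix (Fin m) (Fin m) QZ) :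
    ∑' r : Fin m → QZ, wt (s + m) (relOrder R r) ≤ nu R * ∑' d : ℕ, wt s d := by
  refine (tsum_comp_le (relOrder R) (fun d => wt (s + m) d) (fun d => d ^ m * nu R)
    (encard_relOrder_eq_le R)).trans ?_
  rw [← ENNReal.tsum_mul_left]
  refine ENNReal.tsum_le_tsum fun d => ?_
  rw [Nat.cast_mul, mul_comm ((d ^ m : ℕ) : ℝ≥0∞), mul_assoc]
  gcongr
  exact natCast_pow_mul_wt_le s m d

/-- Convergence of the Siegel series `∑_R ν(R)^{-s}` over symmetric matrices modulo `1`. -/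
theorem siegel_series_ne_top (m s : ℕ) (hs : m + 2 ≤ s) :
    ∑' R : {R : Matrix (Fin m) (Fin m) QZ // R.IsSymm}, wt s (nu R.1) ≠ ∞ := by
  induction m generalizing s with
  | zero =>
    have : Subsingleton {R : Matrix (Fin 0) (Fin 0) QZ // R.IsSymm} :=
      ⟨fun a b => Subtype.ext (Subsingleton.elim _ _)⟩
    have : Fintype {R : Matrix (Fin 0) (Fin 0) QZ // R.IsSymm} := Fintype.ofFinite _
    rw [tsum_fintype]
    exact (ENNReal.sum_lt_top.2 fun _ _ => ENNReal.ofReal_lt_top).ne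
  | succ m ih =>
    obtain ⟨t, rfl⟩ : ∃ t, s = t + 1 := ⟨s - 1, by omega⟩
    let S := {R : Matrix (Fin m) (Fin m) QZ // R.IsSymm}
    let f : {R : Matrix (Fin (m + 1)) (Fin (m + 1)) QZ // R.IsSymm} →
        -- A symmetric matrix is determined by its lower right minor, the rest of its first column,
        -- and its corner entry.
        S × (Fin m → QZ) × QZ := fun R =>
      (⟨R.1.submatrix Fin.succ Fin.succ, R.2.submatrix _⟩, fun i => R.1 i.succ 0, R.1 0 0)
    have hf : Function.Injective f := by
      intro R R' h
      simp only [f, Prod.mk.injEq] at h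
      obtain ⟨h1, h2, h3⟩ := h
      apply Subtype.ext
      ext i j
      refine Fin.cases ?_ (fun i => ?_) i
      · refine Fin.cases h3 (fun j => ?_) j
        rw [R.2.apply, R'.2.apply]
        exact congrFun h2 j
      · refine Fin.cases (congrFun h2 i) (fun j => ?_) j
        exact congrFun (congrFun (congrArg Subtype.val h1) i) j
    -- `Z` bounds the corner sum and `Z'` the column sum: starting from weight t + 1, the corner
    -- costs one power of the relative order and the count of columns costs m more. The hypothesis
    -- gives t − m ≥ 2, exactly what `Z'` requires.
    let Z := ∑' d : ℕ, wt t d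
    let Z' := ∑' d : ℕ, wt (t - m) d
    have hZ : Z ≠ ∞ := tsum_wt_ne_top (by omega)
    have hZ' : Z' ≠ ∞ := tsum_wt_ne_top (by omega)
    let G : S × (Fin m → QZ) × QZ → ℝ≥0∞ := fun z =>
      wt (t + 1) (nu z.1.1) * (wt (t + 1) (relOrder z.1.1 z.2.1) *
        wt (t + 1) (addOrderOf (corner z.1.1 z.2.1 z.2.2)))
    have hbound : ∑' R : {R : Matrix (Fin (m + 1)) (Fin (m + 1)) QZ // R.IsSymm},
        wt (t + 1) (nu R.1) ≤ ∑' R : S, wt t (nu R.1) * (Z' * Z) := by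
      calc _ ≤ ∑' R, G (f R) := by
            refine ENNReal.tsum_le_tsum fun R => ?_
            have h := nu_lower_bound R.1 R.2
            refine (wt_anti ?_ h).trans (le_of_eq ?_)
            · have h1 := nu_pos (R.1.submatrix Fin.succ Fin.succ)
              have h2 := relOrder_pos (R.1.submatrix Fin.succ Fin.succ) (fun i => R.1 i.succ 0)
              have h3 := (isOfFinAddOrder_QZ (corner (R.1.submatrix Fin.succ Fin.succ)
                (fun i => R.1 i.succ 0) (R.1 0 0))).addOrderOf_pos
              positivity
            · rw [wt_mul, wt_mul, mul_assoc]
        _ ≤ ∑' z, G z := ENNReal.tsum_comp_le_tsum_of_injective hf G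
        _ = ∑' R : S, wt (t + 1) (nu R.1) * ∑' r : Fin m → QZ, wt (t + 1) (relOrder R.1 r) *
            ∑' x : QZ, wt (t + 1) (addOrderOf (corner R.1 r x)) := by
            rw [ENNReal.tsum_prod']
            refine tsum_congr fun R => ?_
            rw [ENNReal.tsum_prod', ← ENNReal.tsum_mul_left]
            refine tsum_congr fun r => ?_
            rw [← ENNReal.tsum_mul_left, ← ENNReal.tsum_mul_left]
        _ ≤ ∑' R : S, wt t (nu R.1) * (Z' * Z) := by
            refine ENNReal.tsum_le_tsum fun R => ?_
            calc _ ≤ wt (t + 1) (nu R.1) * ∑' r : Fin m → QZ, wt (t + 1) (relOrder R.1 r) *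
                    (relOrder R.1 r * Z) := by
                  gcongr with r
                  exact tsum_wt_corner_le t R.1 r
              _ ≤ wt (t + 1) (nu R.1) * ∑' r : Fin m → QZ, wt t (relOrder R.1 r) * Z := by
                  refine mul_le_mul' le_rfl (ENNReal.tsum_le_tsum fun r => ?_)
                  rw [← mul_assoc, mul_comm (wt (t + 1) _)]
                  refine mul_le_mul' ?_ le_rfl
                  exact natCast_mul_wt_le _ _
              _ ≤ wt (t + 1) (nu R.1) * (nu R.1 * Z' * Z) := by
                  rw [ENNReal.tsum_mul_right]
                  gcongr
                  have := tsum_wt_relOrder_le (t - m) R.1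
                  rwa [show t - m + m = t by omega] at this
              -- The factor ν(R) from counting columns lowers the exponent by one, matching the
              -- induction hypothesis for the smaller size.
              _ = (nu R.1 * wt (t + 1) (nu R.1)) * (Z' * Z) := by ring
              _ ≤ _ := by
                  gcongr
                  exact natCast_mul_wt_le _ _
    refine ne_top_of_le_ne_top ?_ hbound
    rw [ENNReal.tsum_mul_right]
    exact ENNReal.mul_ne_top (ih t (by omega)) (ENNReal.mul_ne_top hZ' hZ)

/-! ### Determinant estimates and partial inversions -/

theorem one_add_trace_le_det {A : Matrix (Fin n) (Fin n) ℝ} (hA : A.PosSemidef) :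
    1 + A.trace ≤ (1 + A).det := by
  have hH := hA.isHermitian
  have hs := hH.spectral_theorem
  have h1 : (1 + A).det = ∏ i, (1 + hH.eigenvalues i) := by
    have e : 1 + A = (hH.eigenvectorUnitary : Matrix (Fin n) (Fin n) ℝ) *
        (1 + diagonal hH.eigenvalues) *
        star (hH.eigenvectorUnitary : Matrix (Fin n) (Fin n) ℝ) := by
      have hu : (hH.eigenvectorUnitary : Matrix (Fin n) (Fin n) ℝ) *
          star (hH.eigenvectorUnitary : Matrix (Fin n) (Fin n) ℝ) = 1 :=
        Unitary.mul_star_self_of_mem hH.eigenvectorUnitary.2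
      rw [mul_add, add_mul, mul_one, hu]
      congr 1
    have hd : (hH.eigenvectorUnitary : Matrix (Fin n) (Fin n) ℝ).det *
        (star (hH.eigenvectorUnitary : Matrix (Fin n) (Fin n) ℝ)).det = 1 := by
      rw [← det_mul, Unitary.mul_star_self_of_mem hH.eigenvectorUnitary.2, det_one]
    rw [e, det_mul, det_mul, mul_right_comm, hd, one_mul, ← diagonal_one, diagonal_add,
      det_diagonal]
  have h2 : A.trace = ∑ i, hH.eigenvalues i := by simpa using hH.trace_eq_sum_eigenvalues
  rw [h1, h2]
  have : ∀ s : Finset (Fin n), 1 + ∑ i ∈ s, hH.eigenvalues i ≤ ∏ i ∈ s, (1 + hH.eigenvalues i) := by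
    intro s
    induction s using Finset.induction_on with
    | empty => simp
    | insert a s ha ih =>
      rw [Finset.sum_insert ha, Finset.prod_insert ha]
      have h0 := hA.eigenvalues_nonneg a
      have h3 : 0 ≤ ∑ i ∈ s, hH.eigenvalues i := Finset.sum_nonneg fun i _ => hA.eigenvalues_nonneg i
      nlinarith
  exact this Finset.univ

/-- Since R is real and symmetric, the product of iI + R with its conjugate −iI + R is 1 + R² = 1 +
RRᵀ. -/
theorem normSq_det_I_add {R : Matrix (Fin n) (Fin n) ℝ} (hR : R.IsSymm) :
    Complex.normSq (Complex.I • (1 : Matrix (Fin n) (Fin n) ℂ) + R.map Complex.ofReal).det =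
      (1 + R * Rᵀ).det := by
  have hc : starRingEnd ℂ (Complex.I • (1 : Matrix (Fin n) (Fin n) ℂ) + R.map Complex.ofReal).det =
      (-(Complex.I • (1 : Matrix (Fin n) (Fin n) ℂ)) + R.map Complex.ofReal).det := by
    rw [RingHom.map_det]
    congr 1
    ext i j
    by_cases h : i = j <;> simp [h]
  apply Complex.ofReal_injective
  rw [← Complex.mul_conj, hc, ← det_mul, hR.eq]
  change _ = Complex.ofRealHom _
  rw [RingHom.map_det]
  congr 1
  have e1 : Complex.ofRealHom.mapMatrix (1 + R * R) =
      1 + R.map Complex.ofReal * R.map Complex.ofReal := by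
    rw [map_add, map_mul, map_one]
    rfl
  rw [e1, add_mul, mul_add, mul_add, smul_mul, smul_mul, Matrix.one_mul, Matrix.one_mul,
    Matrix.mul_neg, Matrix.mul_smul, Matrix.mul_one, smul_neg, smul_smul, Complex.I_mul_I]
  simp

theorem one_le_normSq_det_I_add {R : Matrix (Fin n) (Fin n) ℝ} (hR : R.IsSymm) (i j : Fin n) :
    1 + R i j ^ 2 ≤
      Complex.normSq (Complex.I • (1 : Matrix (Fin n) (Fin n) ℂ) + R.map Complex.ofReal).det := by
  rw [normSq_det_I_add hR]
  have hps : (R * Rᵀ).PosSemidef := by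
    simpa using posSemidef_self_mul_conjTranspose R
  refine le_trans ?_ (one_add_trace_le_det hps)
  have : (R * Rᵀ).trace = ∑ i, ∑ j, R i j ^ 2 := by
    simp [trace, mul_apply, sq]
  rw [this]
  gcongr
  calc R i j ^ 2 ≤ ∑ j, R i j ^ 2 :=
        Finset.single_le_sum (f := fun j => R i j ^ 2) (fun _ _ => sq_nonneg _) (Finset.mem_univ j)
    _ ≤ _ := Finset.single_le_sum (f := fun i => ∑ j, R i j ^ 2)
        (fun _ _ => Finset.sum_nonneg fun _ _ => sq_nonneg _) (Finset.mem_univ i)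

theorem one_le_norm_det_I_add {R : Matrix (Fin n) (Fin n) ℝ} (hR : R.IsSymm) :
    1 ≤ ‖(Complex.I • (1 : Matrix (Fin n) (Fin n) ℂ) + R.map Complex.ofReal).det‖ := by
  have h : 1 ≤ Complex.normSq
      (Complex.I • (1 : Matrix (Fin n) (Fin n) ℂ) + R.map Complex.ofReal).det := by
    rw [normSq_det_I_add hR]
    have hps : (R * Rᵀ).PosSemidef := by
      simpa using posSemidef_self_mul_conjTranspose R
    linarith [one_add_trace_le_det hps, hps.trace_nonneg]
  rw [Complex.normSq_eq_norm_sq] at h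
  exact (one_le_sq_iff₀ (norm_nonneg _)).1 h

/-- The point `i` of the upper half space, as a matrix. -/
noncomputable def basePt (n : ℕ) : Matrix (Fin n) (Fin n) ℂ := Complex.I • 1

/-- The absolute value of `det(Ci + D)`. -/
noncomputable def cov (γ : Sp n) : ℝ := ‖(denom γ (basePt n)).det‖

theorem denom_basePt (γ : Sp n) :
    denom γ (basePt n) = Complex.I • toC (blkC γ) + toC (blkD γ) := by
  rw [denom_eq, basePt, Matrix.mul_smul, Matrix.mul_one]

theorem abs_det_blkD {p : Sp n} (hp : p ∈ parabolic n) : |(blkD p).det| = 1 := by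
  have h := det_blkD_sq hp
  rcases Int.isUnit_iff.1 (IsUnit.of_mul_eq_one _ h) with h | h <;> rw [h] <;> rfl

theorem cov_parabolic_mul {p : Sp n} (hp : p ∈ parabolic n) (x : Sp n) : cov (p * x) = cov x := by
  rw [cov, denom_parabolic_mul hp, norm_mul, Complex.norm_intCast, cov]
  have := abs_det_blkD hp
  rw [← Int.cast_abs, this]; simp

/-- The diagonal matrix which is the indicator of `S`. -/
def indDiag (S : Finset (Fin n)) : Matrix (Fin n) (Fin n) ℤ :=
  diagonal fun i => if i ∈ S then 1 else 0

/-- The partial inversion at the coordinates outside `S`. -/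
def partialInv (S : Finset (Fin n)) : Sp n :=
  ⟨fromBlocks (indDiag S) (indDiag Sᶜ) (-indDiag Sᶜ) (indDiag S), by
    have h1 : ∀ T : Finset (Fin n), (indDiag T)ᵀ = indDiag T := fun T => diagonal_transpose _
    have h2 : indDiag S * indDiag Sᶜ = 0 := by
      rw [indDiag, indDiag, diagonal_mul_diagonal, ← diagonal_zero]
      congr 1; funext i; by_cases h : i ∈ S <;> simp [h]
    have h3 : indDiag Sᶜ * indDiag S = 0 := by
      rw [indDiag, indDiag, diagonal_mul_diagonal, ← diagonal_zero]
      congr 1; funext i; by_cases h : i ∈ S <;> simp [h]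
    have h4 : indDiag S * indDiag S + indDiag Sᶜ * indDiag Sᶜ = 1 := by
      rw [indDiag, indDiag, diagonal_mul_diagonal, diagonal_mul_diagonal, diagonal_add,
        ← diagonal_one]
      congr 1; funext i; by_cases h : i ∈ S <;> simp [h]
    rw [SymplecticGroup.mem_iff, Matrix.J, fromBlocks_transpose, fromBlocks_multiply,
      fromBlocks_multiply]
    simp only [transpose_neg, h1, Matrix.mul_zero, Matrix.mul_one, Matrix.mul_neg, zero_add,
      add_zero, Matrix.neg_mul, neg_neg, h2, h3, neg_zero]
    congr 1
    rw [← h4]; abel⟩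

theorem blkC_mul_partialInv (γ : Sp n) (S : Finset (Fin n)) :
    blkC (γ * partialInv S) = blkC γ * indDiag S - blkD γ * indDiag Sᶜ := by
  rw [blkC_mul]
  simp [blkA, blkC, partialInv, sub_eq_add_neg]

theorem blkD_mul_partialInv (γ : Sp n) (S : Finset (Fin n)) :
    blkD (γ * partialInv S) = blkC γ * indDiag Sᶜ + blkD γ * indDiag S := by
  rw [blkD_mul]
  simp [blkB, blkD, partialInv]

/-- A partial inversion fixes the point i, and its automorphy factor there is a diagonal matrix with
entries 1 and −i. -/
theorem cov_mul_partialInv (γ : Sp n) (S : Finset (Fin n)) :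
    cov (γ * partialInv S) = cov γ := by
  have h : denom (γ * partialInv S) (basePt n) =
      denom γ (basePt n) * diagonal fun i => if i ∈ S then 1 else -Complex.I := by
    have e : (diagonal fun i => if i ∈ S then 1 else -Complex.I) =
        toC (indDiag S) - Complex.I • toC (indDiag Sᶜ) := by
      ext i j
      by_cases hij : i = j
      · subst hij
        by_cases hS : i ∈ S <;> simp [indDiag, hS]
      · simp [indDiag, hij]
    rw [e, denom_basePt, denom_basePt, blkC_mul_partialInv, blkD_mul_partialInv, toC_sub, toC_add,
      toC_mul, toC_mul, toC_mul, toC_mul, add_mul, mul_sub, mul_sub, smul_mul, smul_mul,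
      Matrix.mul_smul, Matrix.mul_smul, smul_smul, Complex.I_mul_I, smul_sub]
    simp
    abel
  rw [cov, h, det_mul, det_diagonal, norm_mul, norm_prod, cov]
  rw [Finset.prod_eq_one, mul_one]
  intro i _
  split_ifs <;> simp

/-- Expanding det(iC + D) over columns, the term taking columns of C in S and of D elsewhere is, up
to a unit, the lower left minor after partial inversion outside S. -/
theorem cov_le_sum (γ : Sp n) :
    cov γ ≤ ∑ S : Finset (Fin n), |((blkC (γ * partialInv S)).det : ℝ)| := by
  have h1 : (denom γ (basePt n)).det = ∑ S : Finset (Fin n),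
      (of (S.piecewise (fun j => (Complex.I • toC (blkC γ))ᵀ j)
        (fun j => (toC (blkD γ))ᵀ j))).det := by
    rw [← det_transpose, denom_basePt, transpose_add]
    exact (detRowAlternating (R := ℂ) (n := Fin n)).toMultilinearMap.map_add_univ
      (fun j => (Complex.I • toC (blkC γ))ᵀ j) (fun j => (toC (blkD γ))ᵀ j)
  rw [cov, h1]
  refine (norm_sum_le _ _).trans (le_of_eq (Finset.sum_congr rfl fun S _ => ?_))
  have h2 : of (S.piecewise (fun j => (Complex.I • toC (blkC γ))ᵀ j)
        (fun j => (toC (blkD γ))ᵀ j)) =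
      diagonal (fun i => if i ∈ S then Complex.I else -1) *
        (toC (blkC (γ * partialInv S)))ᵀ := by
    ext i j
    rw [diagonal_mul, transpose_apply, blkC_mul_partialInv]
    by_cases hS : i ∈ S
    · simp [hS, indDiag, Finset.piecewise]
    · simp [hS, indDiag, Finset.piecewise]
  rw [h2, det_mul, det_transpose, det_diagonal, norm_mul, norm_prod, Finset.prod_eq_one, one_mul,
    det_toC, Complex.norm_intCast]
  intro i _
  split_ifs <;> simp

theorem exists_cov_le (γ : Sp n) :
    ∃ S : Finset (Fin n), cov γ ≤ 2 ^ n * |((blkC (γ * partialInv S)).det : ℝ)| := by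
  by_contra! h
  have h1 := Finset.sum_lt_sum_of_nonempty (s := (Finset.univ : Finset (Finset (Fin n))))
    Finset.univ_nonempty fun S _ => h S
  rw [← Finset.mul_sum, Finset.sum_const, Finset.card_univ, Fintype.card_finset, Fintype.card_fin,
    nsmul_eq_mul, Nat.cast_pow, Nat.cast_ofNat] at h1
  have := lt_of_mul_lt_mul_left h1 (by positivity)
  exact absurd (cov_le_sum γ) (not_le.2 this)

/-! ### Summability of |det(Ci + D)|^{-k} -/

/-- The inclusion of integral matrices into rational ones. -/
def toQ (M : Matrix (Fin n) (Fin n) ℤ) : Matrix (Fin n) (Fin n) ℚ := M.map (Int.cast : ℤ → ℚ)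

theorem toQ_mul (M M' : Matrix (Fin n) (Fin n) ℤ) : toQ (M * M') = toQ M * toQ M' :=
  Matrix.map_mul (f := Int.castRingHom ℚ)

theorem det_toQ (M : Matrix (Fin n) (Fin n) ℤ) : (toQ M).det = (M.det : ℚ) :=
  (RingHom.map_det (Int.castRingHom ℚ) M).symm

theorem toQ_injective : Function.Injective (toQ (n := n)) := by
  intro M M' h
  ext i j
  exact Int.cast_injective (α := ℚ) (congrFun (congrFun h i) j)

/-- The rational symmetric matrix `C⁻¹ D`. -/
noncomputable def ratQuot (γ : Sp n) : Matrix (Fin n) (Fin n) ℚ :=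
  (toQ (blkC γ))⁻¹ * toQ (blkD γ)

variable {γ : Sp n}

theorem isUnit_det_toQ {M : Matrix (Fin n) (Fin n) ℤ} (h : M.det ≠ 0) : IsUnit (toQ M).det := by
  rw [det_toQ]; exact (Int.cast_ne_zero.2 h).isUnit

theorem blkC_mul_ratQuot (h : (blkC γ).det ≠ 0) :
    toQ (blkC γ) * ratQuot γ = toQ (blkD γ) := by
  rw [ratQuot, ← Matrix.mul_assoc, mul_nonsing_inv _ (isUnit_det_toQ h), Matrix.one_mul]

theorem isSymm_ratQuot (h : (blkC γ).det ≠ 0) : (ratQuot γ).IsSymm := by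
  have h1 : toQ (blkC γ) * (toQ (blkD γ))ᵀ = toQ (blkD γ) * (toQ (blkC γ))ᵀ := by
    have := congrArg toQ (blkC_mul_transpose_blkD γ)
    rwa [toQ_mul, toQ_mul] at this
  rw [← blkC_mul_ratQuot h, transpose_mul, Matrix.mul_assoc] at h1
  have hu := isUnit_det_toQ h
  have hu' : IsUnit (toQ (blkC γ))ᵀ.det := by rwa [det_transpose]
  have h2 := congrArg (fun X => (toQ (blkC γ))⁻¹ * X) h1
  rw [nonsing_inv_mul_cancel_left _ _ hu, nonsing_inv_mul_cancel_left _ _ hu] at h2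
  have h3 := congrArg (fun X => X * ((toQ (blkC γ))ᵀ)⁻¹) h2
  rwa [mul_nonsing_inv_cancel_right _ _ hu', mul_nonsing_inv_cancel_right _ _ hu'] at h3

theorem ratQuot_mul_transpose_blkC (h : (blkC γ).det ≠ 0) :
    ratQuot γ * (toQ (blkC γ))ᵀ = (toQ (blkD γ))ᵀ := by
  rw [← blkC_mul_ratQuot h, transpose_mul, (isSymm_ratQuot h).eq]

/-- The class modulo `1` of a rational matrix. -/
def modOne (R : Matrix (Fin n) (Fin n) ℚ) : Matrix (Fin n) (Fin n) QZ :=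
  R.map (fun x : ℚ => (x : QZ))

theorem colHom_modOne (R : Matrix (Fin n) (Fin n) ℚ) (a : Fin n → ℤ) (i : Fin n) :
    colHom (modOne R) a i = ((∑ j, R i j * a j : ℚ) : QZ) := by
  rw [colHom_apply]
  have h : ∀ s : Finset (Fin n), ((∑ j ∈ s, R i j * a j : ℚ) : QZ) =
      ∑ j ∈ s, a j • modOne R i j := by
    intro s
    induction s using Finset.induction_on with
    | empty => simp
    | insert b s hb ih =>
      rw [Finset.sum_insert hb, Finset.sum_insert hb, AddCircle.coe_add, ih]
      congr 1
      rw [modOne, map_apply, ← AddCircle.coe_zsmul, zsmul_eq_mul, mul_comm]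
  exact (h Finset.univ).symm

/-- Since (C⁻¹D)Cᵀ = Dᵀ is integral, the column group of C⁻¹D modulo 1 is a quotient of ℤⁿ/Cᵀℤⁿ,
which has |det C| elements. -/
theorem nu_modOne_ratQuot_le (h : (blkC γ).det ≠ 0) :
    nu (modOne (ratQuot γ)) ≤ (blkC γ).det.natAbs := by
  let L : (Fin n → ℤ) →ₗ[ℤ] (Fin n → ℤ) := (blkC γ)ᵀ.mulVecLin
  have hL : Function.Injective L := by
    refine mulVec_injective_of_det_ne_zero ?_
    rwa [det_transpose]
  let e : (Fin n → ℤ) ≃ₗ[ℤ] LinearMap.range L := LinearEquiv.ofInjective L hL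
  have hcard : (blkC γ).det.natAbs = Nat.card ((Fin n → ℤ) ⧸ LinearMap.range L) := by
    have h1 := Submodule.natAbs_det_equiv (LinearMap.range L) e
    rw [← h1, ← det_transpose, ← LinearMap.det_toLin']
    exact congrArg (fun f : (Fin n → ℤ) →ₗ[ℤ] (Fin n → ℤ) => (LinearMap.det f).natAbs)
      (LinearMap.ext fun _ => rfl)
  let ψ : (Fin n → ℤ) →ₗ[ℤ] (Fin n → QZ) := (colHom (modOne (ratQuot γ))).toIntLinearMap
  have hker : LinearMap.range L ≤ LinearMap.ker ψ := by
    rintro _ ⟨b, rfl⟩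
    rw [LinearMap.mem_ker]
    funext i
    change colHom (modOne (ratQuot γ)) ((blkC γ)ᵀ *ᵥ b) i = 0
    have e1 := ratQuot_mul_transpose_blkC h
    have e2 : ∑ j, ratQuot γ i j * (((blkC γ)ᵀ *ᵥ b) j : ℤ) = (((blkD γ)ᵀ *ᵥ b) i : ℤ) := by
      have e3 : (fun j => ((((blkC γ)ᵀ *ᵥ b) j : ℤ) : ℚ)) =
          (toQ (blkC γ))ᵀ *ᵥ fun j => (b j : ℚ) := by
        funext j; simp [mulVec, dotProduct, toQ]
      have e4 := congrFun (congrArg (fun M => M *ᵥ fun j => (b j : ℚ)) e1) i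
      simp only [← mulVec_mulVec, ← e3] at e4
      calc _ = (ratQuot γ *ᵥ fun j => ((((blkC γ)ᵀ *ᵥ b) j : ℤ) : ℚ)) i := rfl
        _ = _ := e4
        _ = _ := by simp [mulVec, dotProduct, toQ]
    rw [colHom_modOne, e2, AddCircle.coe_eq_zero_iff]
    exact ⟨_, by rw [zsmul_eq_mul, mul_one]⟩
  rw [hcard, nu]
  have : Finite ((Fin n → ℤ) ⧸ LinearMap.range L) := by
    refine Nat.finite_of_card_ne_zero ?_
    rw [← hcard]
    exact Int.natAbs_ne_zero.2 h
  refine Nat.card_le_card_of_surjective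
    (fun z => (⟨(LinearMap.range L).liftQ ψ hker z, ?_⟩ :
      (colHom (modOne (ratQuot γ))).range)) ?_
  · obtain ⟨a, rfl⟩ := Submodule.Quotient.mk_surjective _ z
    exact ⟨a, rfl⟩
  · rintro ⟨_, a, rfl⟩
    exact ⟨Submodule.Quotient.mk a, rfl⟩

theorem ratQuot_eq_imp {γ' : Sp n} (h : (blkC γ).det ≠ 0) (h' : (blkC γ').det ≠ 0)
    (e : ratQuot γ = ratQuot γ') : γ' * γ⁻¹ ∈ parabolic n := by
  rw [mem_parabolic, blkC_mul, blkA_inv, blkC_inv]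
  apply toQ_injective
  have h1 : toQ (blkC γ') * (toQ (blkD γ))ᵀ = toQ (blkD γ') * (toQ (blkC γ))ᵀ := by
    rw [← ratQuot_mul_transpose_blkC h, e, ← Matrix.mul_assoc, blkC_mul_ratQuot h']
  have h2 : blkC γ' * (blkD γ)ᵀ = blkD γ' * (blkC γ)ᵀ := by
    apply toQ_injective
    rw [toQ_mul, toQ_mul]
    exact h1
  rw [h2, Matrix.mul_neg, add_neg_cancel]

theorem det_blkC_parabolic_mul {p : Sp n} (hp : p ∈ parabolic n) (x : Sp n) :
    (blkC (p * x)).det = (blkD p).det * (blkC x).det := by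
  rw [blkC_mul, mem_parabolic.1 hp, Matrix.zero_mul, zero_add, det_mul]

theorem toC_eq_map_toQ (M : Matrix (Fin n) (Fin n) ℤ) :
    toC M = ((toQ M).map (Rat.cast : ℚ → ℝ)).map Complex.ofReal := by
  ext i j; simp [toQ]

theorem cov_eq (h : (blkC γ).det ≠ 0) :
    cov γ = |((blkC γ).det : ℝ)| *
      ‖(Complex.I • (1 : Matrix (Fin n) (Fin n) ℂ) +
        ((ratQuot γ).map (Rat.cast : ℚ → ℝ)).map Complex.ofReal).det‖ := by
  have e : denom γ (basePt n) = toC (blkC γ) * (Complex.I • (1 : Matrix (Fin n) (Fin n) ℂ) +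
        ((ratQuot γ).map (Rat.cast : ℚ → ℝ)).map Complex.ofReal) := by
    rw [denom_basePt, Matrix.mul_add, Matrix.mul_smul, Matrix.mul_one]
    congr 1
    have h1 := congrArg (fun M => (M.map (Rat.cast : ℚ → ℝ)).map Complex.ofReal)
      (blkC_mul_ratQuot h)
    rw [toC_eq_map_toQ (blkD γ), ← h1, toC_eq_map_toQ (blkC γ)]
    have h2 := Matrix.map_mul (L := toQ (blkC γ)) (M := ratQuot γ) (f := Rat.castHom ℝ)
    have h3 := Matrix.map_mul (L := (toQ (blkC γ)).map (Rat.castHom ℝ))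
      (M := (ratQuot γ).map (Rat.castHom ℝ)) (f := Complex.ofRealHom)
    rw [← h2] at h3
    exact h3
  rw [cov, e, det_mul, norm_mul, det_toC, Complex.norm_intCast]

theorem isSymm_map_ratQuot (h : (blkC γ).det ≠ 0) :
    ((ratQuot γ).map (Rat.cast : ℚ → ℝ)).IsSymm := (isSymm_ratQuot h).map _

theorem abs_det_blkC_le_cov (γ : Sp n) (h : (blkC γ).det ≠ 0) :
    |((blkC γ).det : ℝ)| ≤ cov γ := by
  rw [cov_eq h]
  exact le_mul_of_one_le_right (abs_nonneg _) (one_le_norm_det_I_add (isSymm_map_ratQuot h))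

/-- Dividing by |det C| bounds |det(iI + C⁻¹D)| by 2^n, and this determinant controls every entry of
C⁻¹D. Thus only boundedly many integral translates of a class modulo 1 occur. -/
theorem abs_ratQuot_le (h : (blkC γ).det ≠ 0) (hc : cov γ ≤ 2 ^ n * |((blkC γ).det : ℝ)|)
    (i j : Fin n) : |ratQuot γ i j| ≤ 2 ^ n := by
  rw [cov_eq h, mul_comm] at hc
  have hpos : 0 < |((blkC γ).det : ℝ)| := abs_pos.2 (Int.cast_ne_zero.2 h)
  have h1 := le_of_mul_le_mul_right hc hpos
  have h2 := one_le_normSq_det_I_add (isSymm_map_ratQuot h) i j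
  rw [Complex.normSq_eq_norm_sq] at h2
  have h3 : (ratQuot γ i j : ℝ) ^ 2 ≤ (2 ^ n) ^ 2 := by
    have := pow_le_pow_left₀ (norm_nonneg _) h1 2
    have h4 : ((ratQuot γ).map (Rat.cast : ℚ → ℝ)) i j = (ratQuot γ i j : ℝ) := rfl
    rw [h4] at h2
    linarith
  have h5 := abs_le_of_sq_le_sq h3 (by positivity)
  exact_mod_cast h5

theorem cov_pos (γ : Sp n) : 0 < cov γ := by
  let τ : HSpace n := ⟨basePt n, by simp [basePt, IsSymm], by
    have : (basePt n).map Complex.im = 1 := by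
      ext i j; by_cases h : i = j <;> simp [basePt, h, one_apply]
    rw [this]; exact PosDef.one⟩
  exact norm_pos_iff.2 (det_denom_ne_zero γ τ)

/-- Cosets at which the minor `det C` dominates. -/
def IsDominant (γ : Sp n) : Prop := cov γ ≤ 2 ^ n * |((blkC γ).det : ℝ)|

theorem IsDominant.det_ne_zero (h : IsDominant γ) : (blkC γ).det ≠ 0 := by
  intro h0
  have := cov_pos γ
  rw [IsDominant, h0] at h
  simp at h
  linarith

theorem isDominant_parabolic_mul {p : Sp n} (hp : p ∈ parabolic n) (x : Sp n) :
    IsDominant (p * x) ↔ IsDominant x := by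
  have : |((blkD p).det : ℝ)| = 1 := by exact_mod_cast congrArg (Int.cast (R := ℝ)) (abs_det_blkD hp)
  rw [IsDominant, IsDominant, cov_parabolic_mul hp, det_blkC_parabolic_mul hp, Int.cast_mul,
    abs_mul, this, one_mul]

theorem tsum_dominant_ne_top {k : ℕ} (hk : n + 1 < k) :
    ∑' q : {q : CosetP n // IsDominant q.out}, ENNReal.ofReal ((cov q.1.out ^ k)⁻¹) ≠ ∞ := by
  let Y := {R : Matrix (Fin n) (Fin n) QZ // R.IsSymm}
  -- Finite extra data: the floors recover C⁻¹D from its class modulo 1, hence the coset of the full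
  -- parabolic. The Boolean, the sign of det C, separates the two cosets of Γ_∞⁺ inside it.
  let Fl := (Fin n → Fin n → Finset.Icc (-(2 ^ n : ℤ)) (2 ^ n)) × Bool
  have hfl : ∀ q : {q : CosetP n // IsDominant q.out}, ∀ i j,
      ⌊ratQuot q.1.out i j⌋ ∈ Finset.Icc (-(2 ^ n : ℤ)) (2 ^ n) := by
    intro q i j
    have h := abs_le.1 (abs_ratQuot_le q.2.det_ne_zero q.2 i j)
    rw [Finset.mem_Icc]
    refine ⟨Int.le_floor.2 (by push_cast; exact h.1), ?_⟩
    have h2 := (Int.floor_le (ratQuot q.1.out i j)).trans h.2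
    exact_mod_cast h2
  let f : {q : CosetP n // IsDominant q.out} → Y × Fl := fun q =>
    (⟨modOne (ratQuot q.1.out), (isSymm_ratQuot q.2.det_ne_zero).map _⟩,
      fun i j => ⟨⌊ratQuot q.1.out i j⌋, hfl q i j⟩, decide (0 < (blkC q.1.out).det))
  have hf : Function.Injective f := by
    intro q q' e
    have e1 := congrArg (fun z => z.1.1) e
    have e2 := congrArg (fun z => z.2.1) e
    have e3 := congrArg (fun z => z.2.2) e
    have eR : ratQuot q.1.out = ratQuot q'.1.out := by
      ext i j
      have h1 : ((ratQuot q.1.out i j : ℚ) : QZ) = (ratQuot q'.1.out i j : ℚ) :=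
        congrFun (congrFun e1 i) j
      have h2 : ⌊ratQuot q.1.out i j⌋ = ⌊ratQuot q'.1.out i j⌋ :=
        congrArg Subtype.val (congrFun (congrFun e2 i) j)
      rw [← sub_eq_zero, ← AddCircle.coe_sub, AddCircle.coe_eq_zero_iff] at h1
      obtain ⟨z, hz⟩ := h1
      have h3 : ratQuot q.1.out i j = ratQuot q'.1.out i j + z := by
        rw [zsmul_eq_mul, mul_one] at hz
        linarith
      rw [h3, Int.floor_add_intCast] at h2
      have : z = 0 := by omega
      rw [h3, this]; simp
    have hpar := ratQuot_eq_imp q.2.det_ne_zero q'.2.det_ne_zero eR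
    apply Subtype.ext
    rw [← q.1.out_eq, ← q'.1.out_eq, mk_eq_mk_iff, mem_GammaInfPlus_iff]
    refine ⟨hpar, ?_⟩
    have hd := det_blkC_parabolic_mul hpar q.1.out
    rw [inv_mul_cancel_right] at hd
    have hab := abs_det_blkD hpar
    rcases abs_eq (by norm_num : (0 : ℤ) ≤ 1) |>.1 hab with h | h
    · exact h
    · exfalso
      rw [h] at hd
      have h1 := q.2.det_ne_zero
      have e3' := decide_eq_decide.1 e3
      omega
  have hle : ∑' q : {q : CosetP n // IsDominant q.out}, ENNReal.ofReal ((cov q.1.out ^ k)⁻¹) ≤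
      ∑' z : Y × Fl, wt k (nu z.1.1) := by
    refine le_trans (ENNReal.tsum_le_tsum fun q => ?_)
      (ENNReal.tsum_comp_le_tsum_of_injective hf (fun z : Y × Fl => wt k (nu z.1.1)))
    have h1 := abs_det_blkC_le_cov q.1.out q.2.det_ne_zero
    have h2 : ((nu (modOne (ratQuot q.1.out)) : ℕ) : ℝ) ≤ cov q.1.out := by
      refine le_trans ?_ h1
      rw [← Int.cast_abs, Int.abs_eq_natAbs, Int.cast_natCast]
      exact_mod_cast nu_modOne_ratQuot_le q.2.det_ne_zero
    have h3 : (0 : ℝ) < (nu (modOne (ratQuot q.1.out)) : ℕ) := by exact_mod_cast nu_pos _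
    apply ENNReal.ofReal_le_ofReal
    gcongr
  refine ne_top_of_le_ne_top ?_ hle
  rw [ENNReal.tsum_prod']
  have : ∀ R : Y, ∑' _ : Fl, wt k (nu R.1) = Fintype.card Fl * wt k (nu R.1) := by
    intro R
    rw [tsum_fintype, Finset.sum_const, Finset.card_univ, nsmul_eq_mul]
  rw [tsum_congr this, ENNReal.tsum_mul_left]
  exact ENNReal.mul_ne_top (ENNReal.natCast_ne_top _) (siegel_series_ne_top n k (by omega))

/-- Every coset becomes dominant after one of the 2^n partial inversions, which permute the cosets
and preserve `cov`; the full sum is at most 2^n times the dominant one. -/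
theorem tsum_cov_ne_top {k : ℕ} (hk : n + 1 < k) :
    ∑' q : CosetP n, ENNReal.ofReal ((cov q.out ^ k)⁻¹) ≠ ∞ := by
  classical
  let F : CosetP n → ℝ≥0∞ := fun q => ENNReal.ofReal ((cov q.out ^ k)⁻¹)
  let I : CosetP n → ℝ≥0∞ := Set.indicator {q | IsDominant q.out} F
  have hI : ∑' q, I q ≠ ∞ := by
    have := tsum_dominant_ne_top hk
    rw [← tsum_subtype]
    exact this
  have hle : ∑' q, F q ≤ ∑' q, ∑ S : Finset (Fin n), I (translate _ (partialInv S) q) := by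
    refine ENNReal.tsum_le_tsum fun q => ?_
    obtain ⟨S, hS⟩ := exists_cov_le q.out
    refine le_trans ?_ (Finset.single_le_sum (f := fun S => I (translate _ (partialInv S) q))
      (fun _ _ => zero_le) (Finset.mem_univ S))
    obtain ⟨h, hh, e⟩ := exists_out_eq_mul (GammaInfPlus n) (q.out * partialInv S)
    have e' : (translate (GammaInfPlus n) (partialInv S) q).out = h * (q.out * partialInv S) := e
    have hh' := GammaInfPlus_le_parabolic n hh
    have hcov : cov (translate (GammaInfPlus n) (partialInv S) q).out = cov q.out := by
      rw [e', cov_parabolic_mul hh', cov_mul_partialInv]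
    have hdom : IsDominant (translate (GammaInfPlus n) (partialInv S) q).out := by
      rw [e', isDominant_parabolic_mul hh', IsDominant, cov_mul_partialInv]
      exact hS
    have : I (translate (GammaInfPlus n) (partialInv S) q) =
        F (translate (GammaInfPlus n) (partialInv S) q) :=
      Set.indicator_of_mem (s := {q : CosetP n | IsDominant q.out}) hdom F
    rw [this]
    simp only [F, hcov, le_refl]
  refine ne_top_of_le_ne_top ?_ hle
  rw [Summable.tsum_finsetSum fun _ _ => ENNReal.summable]
  refine (ENNReal.sum_lt_top.2 fun S _ => ?_).ne
  rw [(translate (GammaInfPlus n) (partialInv S)).tsum_eq I]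
  exact hI.lt_top

/-- Convergence of the Siegel Eisenstein series at the point `i`. -/
theorem summable_inv_cov_pow {k : ℕ} (hk : n + 1 < k) :
    Summable fun q : CosetP n => (cov q.out ^ k)⁻¹ := by
  have h := ENNReal.summable_toReal (tsum_cov_ne_top hk)
  refine h.congr fun q => ?_
  rw [ENNReal.toReal_ofReal]
  have := cov_pos q.out
  positivity

/-! ### Limits along the imaginary axis -/

open Filter Topology

/-- The point `iy` of the imaginary axis. -/
noncomputable def imagPt (n : ℕ) (y : ℝ) : Matrix (Fin n) (Fin n) ℂ := (y * Complex.I : ℂ) • 1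

theorem map_im_imagPt (y : ℝ) : (imagPt n y).map Complex.im = y • 1 := by
  ext i j; by_cases h : i = j <;> simp [imagPt, h]

/-- The point `iy` of the upper half space, for `y > 0`. -/
noncomputable def imagPtH (n : ℕ) {y : ℝ} (hy : 0 < y) : HSpace n :=
  ⟨imagPt n y, by simp [imagPt, IsSymm], by
    rw [map_im_imagPt]; exact PosDef.one.smul hy⟩

theorem imagPt_one : imagPt n 1 = basePt n := by simp [imagPt, basePt]

/-- The real matrix of an integral one. -/
def toR (M : Matrix (Fin n) (Fin n) ℤ) : Matrix (Fin n) (Fin n) ℝ := M.map (Int.cast : ℤ → ℝ)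

/-- The cross terms of (iyC + D)(−iyCᵀ + Dᵀ) cancel because CDᵀ is symmetric. -/
theorem normSq_det_denom_imagPt (γ : Sp n) (y : ℝ) :
    Complex.normSq (denom γ (imagPt n y)).det =
      (y ^ 2 • (toR (blkC γ) * (toR (blkC γ))ᵀ) + toR (blkD γ) * (toR (blkD γ))ᵀ).det := by
  have hd : denom γ (imagPt n y) = (y * Complex.I : ℂ) • toC (blkC γ) + toC (blkD γ) := by
    rw [denom_eq, imagPt, Matrix.mul_smul, Matrix.mul_one]
  have hc : starRingEnd ℂ (denom γ (imagPt n y)).det =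
      (-(y * Complex.I : ℂ) • (toC (blkC γ))ᵀ + (toC (blkD γ))ᵀ).det := by
    rw [RingHom.map_det, ← det_transpose]
    congr 1
    rw [hd]
    ext i j
    simp
  have hCD := congrArg toC (blkC_mul_transpose_blkD γ)
  rw [toC_mul, toC_mul, toC_transpose, toC_transpose] at hCD
  apply Complex.ofReal_injective
  rw [← Complex.mul_conj, hc, ← det_mul, hd]
  change _ = Complex.ofRealHom _
  rw [RingHom.map_det]
  congr 1
  have e1 : ∀ M : Matrix (Fin n) (Fin n) ℤ, Complex.ofRealHom.mapMatrix (toR M) = toC M := by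
    intro M; ext i j; simp [toR]
  have e2 : ∀ M : Matrix (Fin n) (Fin n) ℤ, Complex.ofRealHom.mapMatrix (toR M)ᵀ = (toC M)ᵀ := by
    intro M; ext i j; simp [toR]
  have e3 : ∀ (a : ℝ) (M : Matrix (Fin n) (Fin n) ℝ),
      Complex.ofRealHom.mapMatrix (a • M) = (a : ℂ) • Complex.ofRealHom.mapMatrix M := by
    intro a M; ext i j; simp
  rw [map_add, map_mul, e3, map_mul, e1, e1, e2, e2, add_mul, mul_add, mul_add, smul_mul, smul_mul,
    Matrix.mul_smul, Matrix.mul_smul, smul_smul, hCD]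
  have e4 : (y * Complex.I : ℂ) * (-(y * Complex.I : ℂ)) = ((y ^ 2 : ℝ) : ℂ) := by
    rw [mul_neg, mul_mul_mul_comm, Complex.I_mul_I]; push_cast; ring
  rw [e4, neg_smul]
  abel

theorem posDef_gram (γ : Sp n) :
    (toR (blkC γ) * (toR (blkC γ))ᵀ + toR (blkD γ) * (toR (blkD γ))ᵀ).PosDef := by
  have hps : (toR (blkC γ) * (toR (blkC γ))ᵀ + toR (blkD γ) * (toR (blkD γ))ᵀ).PosSemidef := by
    refine PosSemidef.add ?_ ?_
    · simpa using posSemidef_self_mul_conjTranspose (toR (blkC γ))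
    · simpa using posSemidef_self_mul_conjTranspose (toR (blkD γ))
  refine hps.posDef_iff_det_ne_zero.2 ?_
  have h := normSq_det_denom_imagPt γ 1
  rw [one_pow, one_smul, imagPt_one] at h
  rw [← h]
  have := cov_pos γ
  rw [cov] at this
  rw [Complex.normSq_eq_norm_sq]
  positivity

open scoped MatrixOrder Matrix.Norms.L2Operator in
theorem exists_eq_transpose_mul_self {S : Matrix (Fin n) (Fin n) ℝ} (hS : S.PosDef) :
    ∃ B : Matrix (Fin n) (Fin n) ℝ, IsUnit B.det ∧ S = Bᵀ * B := by
  obtain ⟨B, hB⟩ := CStarAlgebra.nonneg_iff_eq_star_mul_self.mp hS.posSemidef.nonneg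
  rw [star_eq_conjTranspose, conjTranspose_eq_transpose_of_trivial] at hB
  have h := hS.det_pos
  rw [hB, det_mul] at h
  exact ⟨B, (right_ne_zero_of_mul h.ne').isUnit, hB⟩

/-- Writing CCᵀ + DDᵀ = BᵀB and C = BᵀE, the squared norm at iy is its value at i times det(1 + (y²
− 1)EEᵀ), which is at least 1 + (y² − 1)c with c = tr(EEᵀ). One estimate thus serves both as
domination for y ≥ 1 and as divergence when C ≠ 0. -/
theorem exists_growth (γ : Sp n) : ∃ c : ℝ, 0 ≤ c ∧ (blkC γ ≠ 0 → 0 < c) ∧ ∀ y : ℝ, 1 ≤ y →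
    cov γ ^ 2 * (1 + (y ^ 2 - 1) * c) ≤ ‖(denom γ (imagPt n y)).det‖ ^ 2 := by
  set C := toR (blkC γ) with hC
  set S := C * Cᵀ + toR (blkD γ) * (toR (blkD γ))ᵀ with hS
  have hSpos : S.PosDef := posDef_gram γ
  obtain ⟨B, hBu, hSB⟩ := exists_eq_transpose_mul_self hSpos
  have hBu' : IsUnit Bᵀ.det := by rwa [det_transpose]
  set E := (Bᵀ)⁻¹ * C with hE
  have hBE : C = Bᵀ * E := by rw [hE, mul_nonsing_inv_cancel_left _ _ hBu']
  have htr : (E * Eᵀ).trace = ∑ i, ∑ j, E i j ^ 2 := by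
    simp [trace, mul_apply, sq]
  have hEps : (E * Eᵀ).PosSemidef := by
    simpa using posSemidef_self_mul_conjTranspose E
  refine ⟨(E * Eᵀ).trace, hEps.trace_nonneg, fun hne => ?_, fun y hy => ?_⟩
  · have hE0 : ∃ i j, E i j ≠ 0 := by
      by_contra! h0
      apply hne
      have : E = 0 := by ext i j; exact h0 i j
      rw [this, Matrix.mul_zero, hC] at hBE
      ext i j
      have := congrFun (congrFun hBE i) j
      simpa [toR] using this
    obtain ⟨i, j, hij⟩ := hE0
    rw [htr]
    refine Finset.sum_pos' (fun _ _ => Finset.sum_nonneg fun _ _ => sq_nonneg _)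
      ⟨i, Finset.mem_univ _, Finset.sum_pos' (fun _ _ => sq_nonneg _)
        ⟨j, Finset.mem_univ _, by positivity⟩⟩
  · have h1 : cov γ ^ 2 = S.det := by
      have h := normSq_det_denom_imagPt γ 1
      rw [one_pow, one_smul, imagPt_one, Complex.normSq_eq_norm_sq] at h
      exact h
    have ht : 0 ≤ y ^ 2 - 1 := by nlinarith
    have h2 : ‖(denom γ (imagPt n y)).det‖ ^ 2 = S.det * (1 + (y ^ 2 - 1) • (E * Eᵀ)).det := by
      rw [← Complex.normSq_eq_norm_sq, normSq_det_denom_imagPt]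
      have e1 : y ^ 2 • (C * Cᵀ) + toR (blkD γ) * (toR (blkD γ))ᵀ = S + (y ^ 2 - 1) • (C * Cᵀ) := by
        rw [hS, sub_smul, one_smul]; abel
      have e2 : C * Cᵀ = Bᵀ * (E * Eᵀ) * B := by
        rw [hBE, transpose_mul, transpose_transpose]
        simp only [Matrix.mul_assoc]
      have e3 : S + (y ^ 2 - 1) • (C * Cᵀ) = Bᵀ * (1 + (y ^ 2 - 1) • (E * Eᵀ)) * B := by
        rw [e2, mul_add, add_mul, Matrix.mul_one, ← hSB, Matrix.mul_smul, smul_mul]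
      rw [e1, e3, hSB, det_mul, det_mul, det_mul]
      ring
    rw [h1, h2]
    have h3 := one_add_trace_le_det (hEps.smul ht)
    rw [trace_smul, smul_eq_mul] at h3
    exact mul_le_mul_of_nonneg_left h3 hSpos.det_pos.le

theorem cov_le_norm_det_denom (γ : Sp n) {y : ℝ} (hy : 1 ≤ y) :
    cov γ ≤ ‖(denom γ (imagPt n y)).det‖ := by
  obtain ⟨c, hc, -, h⟩ := exists_growth γ
  have h1 := h y hy
  have h2 : cov γ ^ 2 ≤ ‖(denom γ (imagPt n y)).det‖ ^ 2 := by
    refine le_trans ?_ h1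
    have : 0 ≤ (y ^ 2 - 1) * c := mul_nonneg (by nlinarith) hc
    nlinarith [sq_nonneg (cov γ)]
  exact le_of_sq_le_sq h2 (norm_nonneg _)

theorem norm_autFac (k : ℕ) (γ : Sp n) (τ : Matrix (Fin n) (Fin n) ℂ) :
    ‖autFac k γ τ‖ = (‖(denom γ τ).det‖ ^ k)⁻¹ := by
  rw [autFac, _root_.zpow_neg, zpow_natCast, norm_inv, norm_pow]

open Classical in
/-- The limit of the automorphy factor along the imaginary axis. -/
noncomputable def cuspVal (k : ℕ) (γ : Sp n) : ℂ := if γ ∈ parabolic n then psi k γ else 0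

theorem tendsto_autFac {k : ℕ} (hk : 0 < k) (γ : Sp n) :
    Tendsto (fun y : ℝ => autFac k γ (imagPt n y)) atTop (𝓝 (cuspVal k γ)) := by
  by_cases hγ : γ ∈ parabolic n
  · rw [cuspVal, if_pos hγ]
    have : ∀ y : ℝ, autFac k γ (imagPt n y) = psi k γ := by
      intro y
      have h := autFac_parabolic_mul k hγ 1 (imagPt n y)
      rw [mul_one] at h
      rw [h, autFac, denom_eq, blkC_one, blkD_one, toC_zero, toC_one, Matrix.zero_mul, zero_add,
        det_one, _root_.one_zpow, mul_one]
    simp only [this]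
    exact tendsto_const_nhds
  · rw [cuspVal, if_neg hγ, tendsto_zero_iff_norm_tendsto_zero]
    obtain ⟨c, -, hc, h⟩ := exists_growth γ
    have hc' := hc hγ
    have hcov := cov_pos γ
    have h1 : Tendsto (fun y : ℝ => cov γ ^ 2 * (1 + (y ^ 2 - 1) * c)) atTop atTop := by
      refine Tendsto.const_mul_atTop (by positivity) (tendsto_atTop_add_const_left _ _ ?_)
      refine Tendsto.atTop_mul_const hc' ?_
      exact tendsto_atTop_add_const_right _ _ (tendsto_pow_atTop two_ne_zero)
    have h2 : Tendsto (fun y : ℝ => ‖(denom γ (imagPt n y)).det‖ ^ 2) atTop atTop :=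
      tendsto_atTop_mono' _ (by filter_upwards [eventually_ge_atTop 1] with y hy using h y hy) h1
    have h3 : Tendsto (fun y : ℝ => ‖(denom γ (imagPt n y)).det‖) atTop atTop := by
      have := Real.tendsto_sqrt_atTop.comp h2
      refine this.congr fun y => ?_
      simp [Real.sqrt_sq (norm_nonneg _)]
    have h4 := (tendsto_inv_atTop_zero.comp ((tendsto_pow_atTop hk.ne').comp h3))
    refine h4.congr fun y => ?_
    rw [norm_autFac]; rfl

open Classical in
/-- The limit of a summand of `𝔼*|γ` along the imaginary axis. -/
noncomputable def eisLim (k N : ℕ) (γ : Sp n) (q : CosetP n) : ℂ :=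
  if q.out * γ⁻¹ ∈ infGamma n N then cuspVal k q.out else 0

/-- Dominated convergence: for y ≥ 1 each summand is at most its size `cov ^ (-k)` at the point i,
and these are summable. -/
theorem tendsto_slash_eisStar {k : ℕ} (hk : n + 1 < k) (N : ℕ) (γ : Sp n) :
    Tendsto (fun y : ℝ => slash k (eisStar n k N) γ (imagPt n y)) atTop
      (𝓝 (∑' q, eisLim k N γ q)) := by
  have h := tendsto_tsum_of_dominated_convergence (𝓕 := atTop)
    (f := fun (y : ℝ) (q : CosetP n) => eisTerm k N γ (imagPt n y) q) (g := eisLim k N γ)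
    (summable_inv_cov_pow hk) ?_ ?_
  · refine h.congr' ?_
    filter_upwards [eventually_gt_atTop 0] with y hy
    exact (slash_eisStar k N γ (imagPtH n hy)).symm
  · intro q
    simp only [eisTerm, eisLim]
    split_ifs
    · exact tendsto_autFac (by omega) _
    · exact tendsto_const_nhds
  · filter_upwards [eventually_ge_atTop 1] with y hy q
    have hc := cov_pos q.out
    rw [eisTerm]
    split_ifs
    · rw [norm_autFac]
      have := cov_le_norm_det_denom q.out hy
      gcongr
    · rw [norm_zero]; positivity

/-! ### Values at cusps separate double cosets -/

theorem out_mem_parabolic_imp (hn : 0 < n) {q : CosetP n} (hq : q.out ∈ parabolic n) :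
    q = Quotient.mk _ 1 ∨ q = Quotient.mk _ (gammaPM n) := by
  have hab := abs_det_blkD hq
  rcases abs_eq (by norm_num : (0 : ℤ) ≤ 1) |>.1 hab with h | h
  · left
    rw [← q.out_eq, eq_comm, mk_eq_mk_iff, inv_one, mul_one, mem_GammaInfPlus_iff]
    exact ⟨hq, h⟩
  · right
    rw [← q.out_eq, eq_comm, mk_eq_mk_iff, mem_GammaInfPlus_iff]
    refine ⟨mul_mem hq (inv_mem gammaPM_mem_parabolic), ?_⟩
    have h1 := det_blkD_mul_left (p := gammaPM n) gammaPM_mem_parabolic (gammaPM n)⁻¹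
    rw [mul_inv_cancel, blkD_one, det_one, det_blkD_gammaPM hn] at h1
    rw [det_blkD_mul_left hq, h]
    exact h1.symm

/-- The limit of the character sum at the cusp `γ'`. -/
noncomputable def cuspLim {N : ℕ} (k : ℕ) (χ : DirichletCharacter ℂ N) (γ γ' : Sp n) : ℂ :=
  ∑ᶠ c : CosetLevel n N, starRingEnd ℂ (chiSp χ (c.out : Gamma0 n N).1) *
    ∑' q, eisLim k N (γ * (c.out : Gamma0 n N).1 * γ'⁻¹) q

theorem tendsto_eisSum {k N : ℕ} (hN : 0 < N) (hk : n + 1 < k) (χ : DirichletCharacter ℂ N)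
    (γ γ' : Sp n) :
    Tendsto (fun y : ℝ => autFac k γ'⁻¹ (imagPt n y) *
      eisSum k χ γ (moebius γ'⁻¹ (imagPt n y))) atTop (𝓝 (cuspLim k χ γ γ')) := by
  have := finite_cosetLevel n hN
  have := Fintype.ofFinite (CosetLevel n N)
  rw [cuspLim, finsum_eq_sum_of_fintype]
  have h := tendsto_finsetSum (Finset.univ : Finset (CosetLevel n N)) fun c _ =>
    (tendsto_slash_eisStar hk N (γ * (c.out : Gamma0 n N).1 * γ'⁻¹)).const_mul
      (starRingEnd ℂ (chiSp χ (c.out : Gamma0 n N).1))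
  refine h.congr' ?_
  filter_upwards [eventually_gt_atTop 0] with y hy
  rw [eisSum, finsum_eq_sum_of_fintype, Finset.mul_sum]
  refine Finset.sum_congr rfl fun c _ => ?_
  have h1 := slash_mul k (eisStar n k N) (γ * (c.out : Gamma0 n N).1) γ'⁻¹ (imagPtH n hy)
  change slash k _ _ (imagPt n y) = slash k _ _ (imagPt n y) at h1
  rw [h1]
  conv_lhs => rw [slash]
  rw [autFac]
  ring

theorem eisLim_ne_zero {k N : ℕ} {γ : Sp n} {q : CosetP n} (h : eisLim k N γ q ≠ 0) :
    q.out * γ⁻¹ ∈ infGamma n N ∧ q.out ∈ parabolic n ∧ eisLim k N γ q = psi k q.out := by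
  rw [eisLim] at h ⊢
  split_ifs at h ⊢ with h1
  · rw [cuspVal] at h ⊢
    split_ifs at h ⊢ with h2
    · exact ⟨h1, h2, rfl⟩
    · exact absurd rfl h
  · exact absurd rfl h

/-- A nonzero summand of the limit gives a relation between double cosets. -/
theorem exists_relation {N : ℕ} {γ γ' β q : Sp n} (h : q * (γ * β * γ'⁻¹)⁻¹ ∈ infGamma n N)
    (hq : q ∈ parabolic n) : ∃ p ∈ parabolic n, ∃ g ∈ Gamma n N, γ' = p * g * γ * β ∧
      ∀ k, psi k p = psi k q := by
  obtain ⟨p₀, hp₀, g, hg, e⟩ := mem_infGamma.1 h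
  have hp₀' := GammaInfPlus_le_parabolic n hp₀
  -- From p₀g = q(γβγ'⁻¹)⁻¹ one solves γ' = q⁻¹p₀gγβ; the sign of q⁻¹p₀ is that of q, since p₀ has
  -- sign one and signs are their own inverses.
  refine ⟨q⁻¹ * p₀, mul_mem (inv_mem hq) hp₀', g, hg, ?_, fun k => ?_⟩
  · rw [mul_assoc q⁻¹, e]; group
  · rw [psi_mul k (inv_mem hq), psi_eq_one k hp₀, mul_one]
    have h1 := psi_mul k hq q⁻¹
    rw [mul_inv_cancel, psi_eq_one k (one_mem _), ← psi_sq k hq] at h1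
    have h0 : psi k q ≠ 0 := left_ne_zero_of_mul (psi_sq k hq ▸ one_ne_zero)
    exact (mul_left_cancel₀ h0 h1).symm

theorem exists_relation_of_cuspLim_ne_zero {k N : ℕ} (χ : DirichletCharacter ℂ N) {γ γ' : Sp n}
    (h : cuspLim k χ γ γ' ≠ 0) :
    ∃ p ∈ parabolic n, ∃ g ∈ Gamma n N, ∃ β ∈ Gamma0 n N, γ' = p * g * γ * β := by
  rw [cuspLim] at h
  obtain ⟨c, hc⟩ : ∃ c : CosetLevel n N, starRingEnd ℂ (chiSp χ (c.out : Gamma0 n N).1) *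
      ∑' q, eisLim k N (γ * (c.out : Gamma0 n N).1 * γ'⁻¹) q ≠ 0 := by
    by_contra! h0
    exact h (by simp only [h0, finsum_zero])
  obtain ⟨q, hq⟩ : ∃ q, eisLim k N (γ * (c.out : Gamma0 n N).1 * γ'⁻¹) q ≠ 0 := by
    by_contra! h0
    exact hc (by simp only [h0, tsum_zero, mul_zero])
  obtain ⟨h1, h2, -⟩ := eisLim_ne_zero hq
  obtain ⟨p, hp, g, hg, e, -⟩ := exists_relation h1 h2
  exact ⟨p, hp, g, hg, c.out.1, c.out.2, e⟩

/-- Every nonzero term χ̄(β)·(sign of q) comes from a self-relation of γ, and compatibility makes it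
equal 1. So no cancellation is possible, and the term of the trivial cosets is present. -/
theorem cuspLim_self_ne_zero {k N : ℕ} (hn : 0 < n) (hN : 0 < N) (χ : DirichletCharacter ℂ N)
    {γ : Sp n} (h : ∀ p ∈ parabolic n, ∀ g ∈ Gamma n N, ∀ β ∈ Gamma0 n N,
      γ = p * g * γ * β → psi k p * chiSp χ β = 1) : cuspLim k χ γ γ ≠ 0 := by
  have := finite_cosetLevel n hN
  have := Fintype.ofFinite (CosetLevel n N)
  let a : CosetLevel n N → CosetP n → ℂ := fun c q =>
    starRingEnd ℂ (chiSp χ (c.out : Gamma0 n N).1) *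
      eisLim k N (γ * (c.out : Gamma0 n N).1 * γ⁻¹) q
  have ha : ∀ c q, a c q = 0 ∨ a c q = 1 := by
    intro c q
    by_cases h0 : eisLim k N (γ * (c.out : Gamma0 n N).1 * γ⁻¹) q = 0
    · left; simp only [a, h0, mul_zero]
    · right
      obtain ⟨h1, h2, h3⟩ := eisLim_ne_zero h0
      obtain ⟨p, hp, g, hg, e, hpsi⟩ := exists_relation h1 h2
      have h4 := h p hp g hg c.out.1 c.out.2 e
      rw [hpsi k] at h4
      have h5 : psi k q.out = chiSp χ (c.out : Gamma0 n N).1 := by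
        calc _ = psi k q.out * (psi k q.out * chiSp χ (c.out : Gamma0 n N).1) := by
              rw [h4, mul_one]
          _ = _ := by rw [← mul_assoc, psi_sq k h2, one_mul]
      simp only [a]
      rw [h3, h5, conj_chiSp_mul_chiSp χ c.out.2]
  classical
  -- Only the two parabolic cosets, of determinant ±1, can contribute to the limit; the sum becomes
  -- finite.
  let s : Finset (CosetP n) :=
    {(Quotient.mk _ 1 : CosetP n), (Quotient.mk _ (gammaPM n) : CosetP n)}
  have hsum : cuspLim k χ γ γ = ∑ c : CosetLevel n N, ∑ q ∈ s, a c q := by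
    rw [cuspLim, finsum_eq_sum_of_fintype]
    refine Finset.sum_congr rfl fun c _ => ?_
    rw [tsum_eq_sum (s := s), Finset.mul_sum]
    intro q hq
    by_contra h0
    obtain ⟨-, h2, -⟩ := eisLim_ne_zero h0
    exact hq (by simpa [s] using out_mem_parabolic_imp hn h2)
  have hnonneg : ∀ c q, 0 ≤ (a c q).re := by
    intro c q
    rcases ha c q with h0 | h0 <;> rw [h0] <;> simp
  have hone : a (Quotient.mk _ 1) (Quotient.mk _ 1) = 1 := by
    refine (ha _ _).resolve_left ?_
    obtain ⟨b, hb, e⟩ := exists_out_eq_mul ((Gamma n N).subgroupOf (Gamma0 n N)) 1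
    obtain ⟨p, hp, e'⟩ := exists_out_eq_mul (GammaInfPlus n) 1
    rw [mul_one] at e e'
    simp only [a]
    have hb' : (b : Sp n) ∈ Gamma n N := hb
    rw [e, eisLim, e', if_pos, cuspVal, if_pos (GammaInfPlus_le_parabolic n hp), psi_eq_one k hp,
      chiSp_of_mem_Gamma χ hb']
    · simp
    · exact mul_mem (Subgroup.mem_sup_left hp) (inv_mem (Subgroup.mem_sup_right
        (Subgroup.Normal.conj_mem inferInstance _ hb' γ)))
  intro h0
  have hre : (∑ c : CosetLevel n N, ∑ q ∈ s, a c q).re = 0 := by rw [← hsum, h0]; rfl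
  rw [Complex.re_sum] at hre
  have h1 := (Finset.sum_eq_zero_iff_of_nonneg (fun c _ => by
    rw [Complex.re_sum]; exact Finset.sum_nonneg fun q _ => hnonneg c q)).1 hre
      (Quotient.mk _ 1) (Finset.mem_univ _)
  rw [Complex.re_sum] at h1
  have h2 := (Finset.sum_eq_zero_iff_of_nonneg (fun q _ => hnonneg _ q)).1 h1
    (Quotient.mk _ 1) (by simp [s])
  rw [hone] at h2
  simp at h2

theorem tendsto_eis {k N : ℕ} (hn : 0 < n) (hN : 0 < N) (hk : n + 1 < k)
    (χ : DirichletCharacter ℂ N) (hχ : χ (-1) = (-1 : ℂ) ^ k) (γ γ' : Sp n) :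
    Tendsto (fun y : Set.Ioi (0 : ℝ) => autFac k γ'⁻¹ (imagPt n y) *
      eis k χ γ (moebiusH γ'⁻¹ (imagPtH n y.2))) atTop
      (𝓝 (((Gamma n N).relIndex (stabPlus n N γ) : ℂ)⁻¹ * cuspLim k χ γ γ')) := by
  have h := ((tendsto_eisSum hN hk χ γ γ').const_mul
    ((Gamma n N).relIndex (stabPlus n N γ) : ℂ)⁻¹).comp 
      ((tendsto_Ioi_atTop (a := (0 : ℝ))).1 tendsto_id)
  refine h.congr fun y => ?_
  rw [eis_eq hn χ hχ]
  simp only [Function.comp_apply]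
  rw [mul_left_comm]
  rfl

/-- A nonzero series forces all self-relations to be compatible: each one gives 𝔼_γ as a scalar
multiple of itself. -/
theorem cuspLim_self_ne_zero_of_eis_ne_zero {k N : ℕ} (hn : 0 < n) (hN : 0 < N)
    (χ : DirichletCharacter ℂ N) (hχ : χ (-1) = (-1 : ℂ) ^ k) {γ : Sp n}
    (h : eis k χ γ ≠ 0) : cuspLim k χ γ γ ≠ 0 := by
  refine cuspLim_self_ne_zero hn hN χ fun p hp g hg β hβ e => ?_
  have h1 := eis_transform hn χ hχ hp hg hβ γ
  rw [← e] at h1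
  have h2 : (1 - psi k p * chiSp χ β) • eis k χ γ = 0 := by
    rw [sub_smul, one_smul, ← h1, sub_self]
  exact (sub_eq_zero.1 ((smul_eq_zero.1 h2).resolve_right h)).symm

/-- If `𝔼_γ` vanishes, some self-relation of the double coset of `γ` is incompatible with the
character. -/
theorem exists_bad_relation {k N : ℕ} (hn : 0 < n) (hN : 0 < N) (hk : n + 1 < k)
    (χ : DirichletCharacter ℂ N) (hχ : χ (-1) = (-1 : ℂ) ^ k) {γ : Sp n}
    (h : eis k χ γ = 0) : ∃ p ∈ parabolic n, ∃ g ∈ Gamma n N, ∃ β ∈ Gamma0 n N,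
      γ = p * g * γ * β ∧ psi k p * chiSp χ β ≠ 1 := by
  by_contra! hcon
  have h1 := cuspLim_self_ne_zero (k := k) hn hN χ hcon
  have h2 := tendsto_eis hn hN hk χ hχ γ γ
  simp only [h, Pi.zero_apply, mul_zero] at h2
  have h3 := tendsto_nhds_unique h2 tendsto_const_nhds
  exact mul_ne_zero (inv_ne_zero (Nat.cast_ne_zero.2 (relIndex_stabPlus_ne_zero hN γ))) h1 h3

/-- Equal nonzero series belong to the same double coset. -/
theorem exists_relation_of_eis_eq {k N : ℕ} (hn : 0 < n) (hN : 0 < N) (hk : n + 1 < k)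
    (χ : DirichletCharacter ℂ N) (hχ : χ (-1) = (-1 : ℂ) ^ k) {γ γ' : Sp n}
    (h : eis k χ γ = eis k χ γ') (h0 : eis k χ γ' ≠ 0) :
    ∃ p ∈ parabolic n, ∃ g ∈ Gamma n N, ∃ β ∈ Gamma0 n N, γ' = p * g * γ * β := by
  refine exists_relation_of_cuspLim_ne_zero (k := k) χ fun hz => ?_
  have h1 := tendsto_eis hn hN hk χ hχ γ γ'
  have h2 := tendsto_eis hn hN hk χ hχ γ' γ'
  rw [h] at h1
  have h3 := tendsto_nhds_unique h2 h1
  rw [hz, mul_zero] at h3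
  exact mul_ne_zero (inv_ne_zero (Nat.cast_ne_zero.2 (relIndex_stabPlus_ne_zero hN γ')))
    (cuspLim_self_ne_zero_of_eis_ne_zero hn hN χ hχ h0) h3

/-! ### Lifting conjugates by diag(w, 1, …, 1) -/

theorem exists_isCoprime_add_mul {a h N w : ℤ} (hah : IsCoprime a h) (hN : IsCoprime N w)
    (hw : w ≠ 0) : ∃ t, IsCoprime (a + N * h * t) w := by
  -- Take t to be the product of the primes dividing w but not a: a prime of w dividing a divides
  -- none of N, h, t, and any other prime of w divides t but not a.
  let s := w.natAbs.primeFactors.filter fun p : ℕ => ¬ (p : ℤ) ∣ a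
  refine ⟨∏ p ∈ s, (p : ℤ), ?_⟩
  rw [Int.isCoprime_iff_gcd_eq_one]
  by_contra hne
  obtain ⟨p, hp, hpd⟩ := Nat.exists_prime_and_dvd hne
  have hpd' : (p : ℤ) ∣ Int.gcd (a + N * h * ∏ p ∈ s, (p : ℤ)) w := by exact_mod_cast hpd
  have h1 := hpd'.trans (Int.gcd_dvd_left _ _)
  have h2 := hpd'.trans (Int.gcd_dvd_right _ _)
  have hpi : Prime (p : ℤ) := Nat.prime_iff_prime_int.1 hp
  by_cases hpa : (p : ℤ) ∣ a
  · have h3 := (Int.dvd_add_right hpa).1 h1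
    rcases hpi.dvd_or_dvd h3 with h4 | h4
    · rcases hpi.dvd_or_dvd h4 with h5 | h5
      · exact hpi.not_isUnit (hN.isUnit_of_dvd' h5 h2)
      · exact hpi.not_isUnit (hah.isUnit_of_dvd' hpa h5)
    · obtain ⟨q, hq, hpq⟩ := hpi.exists_mem_finset_dvd h4
      rw [Finset.mem_filter] at hq
      have hq' := Nat.prime_of_mem_primeFactors hq.1
      have : p = q := (Nat.prime_dvd_prime_iff_eq hp hq').1 (by exact_mod_cast hpq)
      exact hq.2 (this ▸ hpa)
  · have hps : p ∈ s := by
      rw [Finset.mem_filter]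
      refine ⟨Nat.mem_primeFactors.2 ⟨hp, ?_, Int.natAbs_ne_zero.2 hw⟩, hpa⟩
      exact Int.natCast_dvd.1 h2
    have h3 : (p : ℤ) ∣ ∏ p ∈ s, (p : ℤ) := Finset.dvd_prod_of_mem (fun p : ℕ => (p : ℤ)) hps
    exact hpa ((Int.dvd_add_left (h3.mul_left _)).1 h1)

/-- Reduction modulo `N` of an integral matrix. -/
abbrev toZ (N : ℕ) (M : Matrix (Fin n) (Fin n) ℤ) : Matrix (Fin n) (Fin n) (ZMod N) :=
  M.map (Int.castRingHom (ZMod N))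

theorem toZ_mul (N : ℕ) (M M' : Matrix (Fin n) (Fin n) ℤ) :
    toZ N (M * M') = toZ N M * toZ N M' := Matrix.map_mul

theorem det_toZ (N : ℕ) (M : Matrix (Fin n) (Fin n) ℤ) : (toZ N M).det = (M.det : ZMod N) :=
  (RingHom.map_det (Int.castRingHom (ZMod N)) M).symm

/-- A determinant one matrix can be changed within its class modulo `N` so that its first row
becomes `(*, 0, …, 0)` modulo an integer `w` prime to `N`. -/
theorem exists_first_row_dvd (hn : 0 < n) {N : ℕ} {w : ℤ} (hw : IsCoprime w (N : ℤ)) (hw0 : w ≠ 0)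
    {A : Matrix (Fin n) (Fin n) ℤ} (hA : A.det = 1) :
    ∃ A' : Matrix (Fin n) (Fin n) ℤ, A'.det = 1 ∧ toZ N A' = toZ N A ∧
      ∀ j : Fin n, j ≠ ⟨0, hn⟩ → w ∣ A' ⟨0, hn⟩ j := by
  set z : Fin n := ⟨0, hn⟩
  -- The expansion of det A = 1 along the first row, without its leading cofactor: it shows the
  -- leading entry is coprime to a combination of the other entries of that row.
  let c : Fin n → ℤ := fun j => if j = z then 0 else A.adjugate j z
  have hrow : A z z * A.adjugate z z + ∑ j, A z j * c j = 1 := by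
    have h := congrFun (congrFun (mul_adjugate A) z) z
    rw [hA, one_smul, one_apply_eq, mul_apply, ← Finset.add_sum_erase _ _ (Finset.mem_univ z)] at h
    rw [← h, ← Finset.add_sum_erase (a := z) _ _ (Finset.mem_univ z)]
    congr 1
    rw [show c z = 0 from if_pos rfl, mul_zero, zero_add]
    refine Finset.sum_congr rfl fun j hj => ?_
    rw [show c j = A.adjugate j z from if_neg (Finset.ne_of_mem_erase hj)]
  have hcop : IsCoprime (A z z) (∑ j, A z j * c j) :=
    ⟨A.adjugate z z, 1, by rw [one_mul, mul_comm, hrow]⟩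
  obtain ⟨t, ht⟩ := exists_isCoprime_add_mul hcop hw.symm hw0
  set b := A z z + N * (∑ j, A z j * c j) * t with hb
  have hbN : IsCoprime (b * N) w := ht.mul_left hw.symm
  obtain ⟨u, u', hu⟩ := hbN
  -- `U` adds multiples of N of the other columns to the first, making the leading entry b prime to
  -- w. `V` then subtracts multiples of N of the first column; as ubN ≡ 1 modulo w, the rest of the
  -- first row becomes divisible by w. Both are unipotent and trivial modulo N.
  let U : Matrix (Fin n) (Fin n) ℤ := 1 + vecMulVec ((N * t) • c) (Pi.single z 1)
  let r : Fin n → ℤ := fun j => if j = z then 0 else -(N * u * A z j)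
  let V : Matrix (Fin n) (Fin n) ℤ := 1 + vecMulVec (Pi.single z 1) r
  have hAU : ∀ j, (A * U) z j = if j = z then b else A z j := by
    intro j
    simp only [U, mul_add, mul_one, Matrix.add_apply, mul_vecMulVec, vecMulVec_apply]
    by_cases hj : j = z
    · subst hj
      rw [Pi.single_eq_same, if_pos rfl, mul_one, hb]
      simp only [mulVec, dotProduct, Pi.smul_apply, smul_eq_mul, Finset.mul_sum, Finset.sum_mul]
      congr 1
      exact Finset.sum_congr rfl fun _ _ => by ring
    · rw [Pi.single_eq_of_ne hj, if_neg hj, mul_zero, add_zero]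
  refine ⟨A * U * V, ?_, ?_, ?_⟩
  · have hU : U.det = 1 := by
      simp only [U]
      rw [vecMulVec_eq Unit, det_one_add_replicateCol_mul_replicateRow]
      simp [c]
    have hV : V.det = 1 := by
      simp only [V]
      rw [vecMulVec_eq Unit, det_one_add_replicateCol_mul_replicateRow]
      simp [r]
    rw [det_mul, det_mul, hA, hU, hV]; rfl
  · have hU : toZ N U = 1 := by
      ext i j
      simp [U, vecMulVec_apply, one_apply]
    have hV : toZ N V = 1 := by
      ext i j
      simp [V, vecMulVec_apply, r, one_apply]
    rw [toZ_mul, toZ_mul, hU, hV, mul_one, mul_one]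
  · intro j hj
    have e : (A * U * V) z j = A z j + b * -(N * u * A z j) := by
      simp only [V, mul_add, mul_one, Matrix.add_apply, mul_vecMulVec, vecMulVec_apply]
      rw [hAU, if_neg hj, mulVec_single_one, col_apply, hAU, if_pos rfl]
      simp [r, hj]
    rw [e]
    refine ⟨u' * A z j, ?_⟩
    linear_combination -(A z j) * hu

/-- A determinant one lift of `W⁻¹ A W` modulo `N`, for `W = diag(w, 1, …, 1)`. -/
theorem exists_conj_diagFirst (hn : 0 < n) {N : ℕ} {w : ℤ} (hw : IsCoprime w (N : ℤ))
    {A : Matrix (Fin n) (Fin n) ℤ} (hA : A.det = 1) :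
    ∃ A' : Matrix (Fin n) (Fin n) ℤ, A'.det = 1 ∧
      toZ N (diagFirst n w) * toZ N A' = toZ N A * toZ N (diagFirst n w) := by
  rcases eq_or_ne w 0 with rfl | hw0
  · have hN : N = 1 := by
      have := isCoprime_zero_left.1 hw
      simpa using Int.isUnit_iff_natAbs_eq.1 this
    subst hN
    exact ⟨1, det_one, Subsingleton.elim _ _⟩
  obtain ⟨B, hB, hBA, hd⟩ := exists_first_row_dvd hn hw hw0 hA
  set z : Fin n := ⟨0, hn⟩ with hz
  choose! d hd using hd
  -- This is W⁻¹BW, integral because the first row of B off its leading entry is divisible by w.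
  let A' : Matrix (Fin n) (Fin n) ℤ := of fun i j =>
    if i = z then (if j = z then B i j else d j) else (if j = z then B i j * w else B i j)
  have hdiag : ∀ i : Fin n, (if (i : ℕ) = 0 then w else 1) = if i = z then w else 1 := by
    intro i
    have : (i : ℕ) = 0 ↔ i = z := by rw [Fin.ext_iff]
    simp only [this]
  have key : diagFirst n w * A' = B * diagFirst n w := by
    ext i j
    rw [diagFirst, diagonal_mul, mul_diagonal, hdiag, hdiag]
    by_cases hi : i = z
    · by_cases hj : j = z
      · simp [A', hi, hj, mul_comm]
      · simp [A', hi, hj, hd j hj]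
    · by_cases hj : j = z
      · simp [A', hi, hj]
      · simp [A', hi, hj]
  refine ⟨A', ?_, ?_⟩
  · have h := congrArg Matrix.det key
    rw [det_mul, det_mul, det_diagFirst hn, hB, one_mul] at h
    exact mul_left_cancel₀ hw0 (by rw [h, mul_one])
  · rw [← hBA, ← toZ_mul, ← toZ_mul, key]

/-! ### The twist as conjugation by a similitude modulo N -/

/-- The element `(A 0; 0 A^{-T})` of the Levi subgroup. -/
def levi (A : Matrix (Fin n) (Fin n) ℤ) (hA : A.det = 1) : Sp n :=
  ⟨fromBlocks A 0 0 (A.adjugate)ᵀ, by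
    have h1 : A * A.adjugate = 1 := by rw [mul_adjugate, hA, one_smul]
    have h2 : (A.adjugate)ᵀ * Aᵀ = 1 := by rw [← transpose_mul, h1, transpose_one]
    rw [SymplecticGroup.mem_iff, Matrix.J, fromBlocks_transpose, fromBlocks_multiply,
      fromBlocks_multiply]
    simp [h1, h2]⟩

/-- The element `(1 S; 0 1)` of the unipotent radical. -/
def upper (S : SymMat n) : Sp n :=
  ⟨fromBlocks 1 S.1 0 1, by
    have h : S.1ᵀ = S.1 := S.2
    rw [SymplecticGroup.mem_iff, Matrix.J, fromBlocks_transpose, fromBlocks_multiply,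
      fromBlocks_multiply]
    simp [h]⟩

@[simp] theorem blkA_levi (A : Matrix (Fin n) (Fin n) ℤ) (hA) : blkA (levi A hA) = A := by
  simp [blkA, levi]
@[simp] theorem blkB_levi (A : Matrix (Fin n) (Fin n) ℤ) (hA) : blkB (levi A hA) = 0 := by
  simp [blkB, levi]
@[simp] theorem blkC_levi (A : Matrix (Fin n) (Fin n) ℤ) (hA) : blkC (levi A hA) = 0 := by
  simp [blkC, levi]
@[simp] theorem blkD_levi (A : Matrix (Fin n) (Fin n) ℤ) (hA) :
    blkD (levi A hA) = A.adjugateᵀ := by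
  simp [blkD, levi]
@[simp] theorem blkA_upper (S : SymMat n) : blkA (upper S) = 1 := by simp [blkA, upper]
@[simp] theorem blkB_upper (S : SymMat n) : blkB (upper S) = S.1 := by simp [blkB, upper]
@[simp] theorem blkC_upper (S : SymMat n) : blkC (upper S) = 0 := by simp [blkC, upper]
@[simp] theorem blkD_upper (S : SymMat n) : blkD (upper S) = 1 := by simp [blkD, upper]
@[simp] theorem blkA_lower (S : SymMat n) : blkA (lower S) = 1 := by simp [blkA, lower]
@[simp] theorem blkB_lower (S : SymMat n) : blkB (lower S) = 0 := by simp [blkB, lower]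
@[simp] theorem blkC_lower (S : SymMat n) : blkC (lower S) = S.1 := by simp [blkC, lower]
@[simp] theorem blkD_lower (S : SymMat n) : blkD (lower S) = 1 := by simp [blkD, lower]

theorem levi_mem (A : Matrix (Fin n) (Fin n) ℤ) (hA) : levi A hA ∈ GammaInfPlus n :=
  ⟨blkC_levi A hA, by rw [blkA_levi, hA]⟩

theorem upper_mem (S : SymMat n) : upper S ∈ GammaInfPlus n :=
  ⟨blkC_upper S, by rw [blkA_upper, det_one]⟩

theorem exists_eq_upper_mul_levi {p : Sp n} (hp : p ∈ GammaInfPlus n) :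
    ∃ (S : SymMat n) (A : Matrix (Fin n) (Fin n) ℤ) (hA : A.det = 1), p = upper S * levi A hA := by
  obtain ⟨hC, hA⟩ := hp
  have hAD := blkA_mul_transpose_blkD p
  rw [hC, transpose_zero, Matrix.mul_zero, sub_zero] at hAD
  have hDA : (blkD p)ᵀ * blkA p = 1 := mul_eq_one_comm.1 hAD
  have hAD' : (blkA p)ᵀ * blkD p = 1 := by
    have := congrArg transpose hDA
    simpa [transpose_mul] using this
  have hadj : (blkA p).adjugateᵀ = blkD p := by
    have h1 : (blkA p) * (blkA p).adjugate = 1 := by rw [mul_adjugate, hA, one_smul]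
    have h2 : (blkA p).adjugate = (blkD p)ᵀ :=
      calc _ = ((blkD p)ᵀ * blkA p) * (blkA p).adjugate := by rw [hDA, Matrix.one_mul]
        _ = _ := by rw [Matrix.mul_assoc, h1, Matrix.mul_one]
    rw [h2, transpose_transpose]
  obtain ⟨S, hS⟩ : ∃ S : SymMat n, S.1 = blkB p * (blkA p)ᵀ :=
    ⟨⟨_, by rw [IsSymm, transpose_mul, transpose_transpose, blkA_mul_transpose_blkB]⟩, rfl⟩
  refine ⟨S, blkA p, hA, ?_⟩
  apply ext_blk
  · rw [blkA_mul]; simp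
  · rw [blkB_mul, blkA_upper, blkB_levi, blkB_upper, blkD_levi, hadj, hS, Matrix.mul_assoc, hAD']
    simp
  · rw [blkC_mul, hC]; simp
  · rw [blkD_mul]; simp [hadj]

section Twist

variable {N : ℕ}

/-- The diagonal matrix `diag(a, 1, …, 1)` modulo `N`. -/
def diagFirstMod (n : ℕ) (a : ZMod N) : Matrix (Fin n) (Fin n) (ZMod N) :=
  diagonal fun i => if (i : ℕ) = 0 then a else 1

theorem transpose_diagFirstMod (a : ZMod N) : (diagFirstMod n a)ᵀ = diagFirstMod n a :=
  diagonal_transpose _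

/-- The similitude `diag(diag(a, 1, …, 1), v diag(b, 1, …, 1))` modulo `N`. -/
def simil (n : ℕ) (a b : ZMod N) (v : ZMod N) : Matrix (Fin n ⊕ Fin n) (Fin n ⊕ Fin n) (ZMod N) :=
  fromBlocks (diagFirstMod n a) 0 0 (v • diagFirstMod n b)

theorem diagFirstMod_mul {a b : ZMod N} (h : a * b = 1) :
    diagFirstMod n a * diagFirstMod n b = 1 := by
  rw [diagFirstMod, diagFirstMod, diagonal_mul_diagonal, ← diagonal_one]
  congr 1; funext i
  split_ifs
  · exact h
  · exact mul_one 1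

theorem simil_mul_simil {a b v v' : ZMod N} (h : a * b = 1) (hv : v * v' = 1) :
    simil n a b v * simil n b a v' = 1 := by
  rw [simil, simil, fromBlocks_multiply]
  simp only [Matrix.mul_zero, add_zero, Matrix.zero_mul, zero_add, smul_zero, smul_mul, Matrix.mul_smul,
    smul_smul, hv, mul_comm v' v, one_smul, diagFirstMod_mul h,
    diagFirstMod_mul ((mul_comm b a).trans h)]
  exact fromBlocks_one

theorem toZ_diagFirst (w : ℤ) : toZ N (diagFirst n w) = diagFirstMod n (w : ZMod N) := by
  ext i j
  by_cases h : i = j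
  · subst h
    simp only [diagFirst, diagFirstMod, map_apply, diagonal_apply_eq]
    split_ifs <;> simp
  · simp [diagFirst, diagFirstMod, h]

theorem toZ_one : toZ N (1 : Matrix (Fin n) (Fin n) ℤ) = 1 :=
  Matrix.map_one _ (map_zero _) (map_one _)

theorem toZ_zero : toZ N (0 : Matrix (Fin n) (Fin n) ℤ) = 0 := Matrix.map_zero _ (map_zero _)

theorem toZ_twist (v w : ℤ) (M : SymMat n) : toZ N (twist v w M).1 =
    (v : ZMod N) • (diagFirstMod n (w : ZMod N) * toZ N M.1 * diagFirstMod n (w : ZMod N)) := by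
  rw [← toZ_diagFirst, ← toZ_mul, ← toZ_mul]
  ext i j
  exact map_mul (Int.castRingHom (ZMod N)) v ((diagFirst n w * M.1 * diagFirst n w) i j)

theorem red_lower (M : SymMat n) : red n N (lower M) = fromBlocks 1 0 (toZ N M.1) 1 := by
  rw [red_eq_fromBlocks, blkA_lower, blkB_lower, blkC_lower, blkD_lower]
  exact congrArg₂ (fun a b => fromBlocks a b (toZ N M.1) a) toZ_one toZ_zero

theorem red_upper (M : SymMat n) : red n N (upper M) = fromBlocks 1 (toZ N M.1) 0 1 := by
  rw [red_eq_fromBlocks, blkA_upper, blkB_upper, blkC_upper, blkD_upper]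
  exact congrArg₂ (fun a b => fromBlocks a (toZ N M.1) b a) toZ_one toZ_zero

theorem red_levi (A : Matrix (Fin n) (Fin n) ℤ) (hA : A.det = 1) :
    red n N (levi A hA) = fromBlocks (toZ N A) 0 0 (toZ N A.adjugateᵀ) := by
  rw [red_eq_fromBlocks, blkA_levi, blkB_levi, blkC_levi, blkD_levi]
  exact congrArg (fun b => fromBlocks (toZ N A) b b (toZ N A.adjugateᵀ)) toZ_zero

variable {v w : ℤ} {v' w' : ZMod N}

/-- Conjugation by diag(W⁻¹, vW) multiplies the lower left block by vW on the left and W on the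
right. This recasts the twist as the restriction of a group automorphism modulo N. -/
theorem red_lower_twist (hv : (v : ZMod N) * v' = 1) (hw : (w : ZMod N) * w' = 1) (M : SymMat n) :
    red n N (lower (twist v w M)) =
      simil n w' w v * red n N (lower M) * simil n w w' v' := by
  have hw2 := diagFirstMod_mul (n := n) hw
  have hw3 := diagFirstMod_mul (n := n) ((mul_comm w' (w : ZMod N)).trans hw)
  rw [red_lower, red_lower, toZ_twist, simil, simil, fromBlocks_multiply,
    fromBlocks_multiply]
  simp only [Matrix.mul_zero, add_zero, Matrix.zero_mul, zero_add, smul_zero, smul_mul, Matrix.mul_smul,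
    smul_smul, mul_comm v', hv, one_smul, Matrix.mul_one, hw2, hw3]

theorem red_upper_twist (hv : (v : ZMod N) * v' = 1) (hw : (w : ZMod N) * w' = 1) {a b : ℤ}
    (ha : (a : ZMod N) = v') (hb : (b : ZMod N) = w') (S : SymMat n) :
    red n N (upper (twist a b S)) =
      simil n w' w v * red n N (upper S) * simil n w w' v' := by
  have hw2 := diagFirstMod_mul (n := n) hw
  have hw3 := diagFirstMod_mul (n := n) ((mul_comm w' (w : ZMod N)).trans hw)
  rw [red_upper, red_upper, toZ_twist, simil, simil, fromBlocks_multiply,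
    fromBlocks_multiply]
  simp only [Matrix.mul_zero, add_zero, Matrix.zero_mul, zero_add, smul_mul, Matrix.mul_smul,
    smul_smul, mul_comm v', hv, one_smul, Matrix.mul_one, hw2, hw3, ha, hb]

theorem exists_red_levi (hn : 0 < n) (hv : (v : ZMod N) * v' = 1) (hw : (w : ZMod N) * w' = 1)
    (A : Matrix (Fin n) (Fin n) ℤ) (hA : A.det = 1) :
    ∃ (A' : Matrix (Fin n) (Fin n) ℤ) (hA' : A'.det = 1), red n N (levi A' hA') =
      simil n w' w v * red n N (levi A hA) * simil n w w' v' := by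
  have hcop : IsCoprime w (N : ℤ) := by
    rw [isCoprime_comm, ← ZMod.coe_int_isUnit_iff_isCoprime]
    exact IsUnit.of_mul_eq_one _ hw
  obtain ⟨A', hA', e⟩ := exists_conj_diagFirst hn hcop hA
  refine ⟨A', hA', ?_⟩
  have hw2 := diagFirstMod_mul (n := n) hw
  have hw3 := diagFirstMod_mul (n := n) ((mul_comm w' (w : ZMod N)).trans hw)
  rw [toZ_diagFirst] at e
  have e1 : toZ N A' = diagFirstMod n w' * toZ N A * diagFirstMod n (w : ZMod N) := by
    rw [Matrix.mul_assoc, ← e, ← Matrix.mul_assoc, hw3, Matrix.one_mul]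
  have hadj : ∀ B : Matrix (Fin n) (Fin n) ℤ, B.det = 1 →
      toZ N B * toZ N B.adjugate = 1 := by
    intro B hB
    rw [← toZ_mul, mul_adjugate, hB, one_smul, toZ_one]
  have e2 : toZ N A'.adjugate =
      diagFirstMod n w' * toZ N A.adjugate * diagFirstMod n (w : ZMod N) := by
    have h1 : toZ N A' * (diagFirstMod n w' * toZ N A.adjugate * diagFirstMod n (w : ZMod N)) =
        1 := by
      rw [e1]
      calc _ = diagFirstMod n w' * (toZ N A * ((diagFirstMod n (w : ZMod N) * diagFirstMod n w') *
              toZ N A.adjugate)) * diagFirstMod n (w : ZMod N) := by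
            simp only [Matrix.mul_assoc]
        _ = 1 := by rw [hw2, Matrix.one_mul, hadj A hA, Matrix.mul_one, hw3]
    have h2 := mul_eq_one_comm.1 (hadj A' hA')
    calc _ = toZ N A'.adjugate * (toZ N A' *
              (diagFirstMod n w' * toZ N A.adjugate * diagFirstMod n (w : ZMod N))) := by
          rw [h1, Matrix.mul_one]
      _ = _ := by rw [← Matrix.mul_assoc, h2, Matrix.one_mul]
  have e3 : toZ N A'.adjugateᵀ =
      diagFirstMod n (w : ZMod N) * toZ N A.adjugateᵀ * diagFirstMod n w' := by
    have h1 : toZ N A'.adjugateᵀ = (toZ N A'.adjugate)ᵀ := rfl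
    rw [h1, e2, transpose_mul, transpose_mul, transpose_diagFirstMod, transpose_diagFirstMod,
      Matrix.mul_assoc]
    rfl
  rw [red_levi, red_levi, simil, simil, fromBlocks_multiply, fromBlocks_multiply, e1, e3]
  simp only [Matrix.mul_zero, add_zero, Matrix.zero_mul, zero_add, smul_zero, smul_mul, Matrix.mul_smul,
    smul_smul, mul_comm v', hv, one_smul]

theorem red_gammaPM : red n N (gammaPM n) =
    fromBlocks (diagFirstMod n (-1)) 0 0 (diagFirstMod n (-1)) := by
  have h : toZ N (diagFirst n (-1)) = diagFirstMod n (-1) := by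
    rw [toZ_diagFirst]; simp
  rw [red_eq_fromBlocks]
  rw [← h, show blkA (gammaPM n) = diagFirst n (-1) by simp [blkA, gammaPM],
    show blkB (gammaPM n) = 0 by simp [blkB, gammaPM],
    show blkC (gammaPM n) = 0 by simp [blkC, gammaPM],
    show blkD (gammaPM n) = diagFirst n (-1) by simp [blkD, gammaPM]]
  exact congrArg (fun b => fromBlocks (toZ N (diagFirst n (-1))) b b _) toZ_zero

theorem diagFirstMod_mul_comm (a b : ZMod N) :
    diagFirstMod n a * diagFirstMod n b = diagFirstMod n b * diagFirstMod n a := by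
  rw [diagFirstMod, diagFirstMod, diagonal_mul_diagonal, diagonal_mul_diagonal]
  simp only [mul_comm]

theorem red_gammaPM_mul_simil (a b u : ZMod N) :
    red n N (gammaPM n) * simil n a b u = simil n a b u * red n N (gammaPM n) := by
  rw [red_gammaPM, simil, fromBlocks_multiply, fromBlocks_multiply]
  simp only [Matrix.mul_zero, add_zero, Matrix.zero_mul, zero_add, smul_zero, smul_mul, Matrix.mul_smul,
    diagFirstMod_mul_comm (-1)]

theorem exists_red_GammaInfPlus (hn : 0 < n) (hv : (v : ZMod N) * v' = 1)
    (hw : (w : ZMod N) * w' = 1) {p : Sp n} (hp : p ∈ GammaInfPlus n) :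
    ∃ q ∈ GammaInfPlus n, red n N q = simil n w' w v * red n N p * simil n w w' v' := by
  obtain ⟨S, A, hA, rfl⟩ := exists_eq_upper_mul_levi hp
  obtain ⟨A', hA', e⟩ := exists_red_levi hn hv hw A hA
  obtain ⟨a, ha⟩ := ZMod.intCast_surjective v'
  obtain ⟨b, hb⟩ := ZMod.intCast_surjective w'
  refine ⟨upper (twist a b S) * levi A' hA', mul_mem (upper_mem _) (levi_mem _ _), ?_⟩
  have hs : simil n (w : ZMod N) w' v' * simil n w' w v = 1 :=
    simil_mul_simil hw ((mul_comm v' (v : ZMod N)).trans hv)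
  rw [map_mul, map_mul, e, red_upper_twist hv hw ha hb]
  calc _ = simil n w' w v * red n N (upper S) * (simil n w w' v' * simil n w' w v) *
        red n N (levi A hA) * simil n w w' v' := by simp only [Matrix.mul_assoc]
    _ = _ := by rw [hs]; simp only [Matrix.mul_assoc, Matrix.one_mul]

/-- For determinant one, split into unipotent and Levi factors and lift each conjugate. Determinant
−1 reduces to this by γ_±, which commutes with the similitude. The exact integral determinant must
be kept because it determines the sign `psi`. -/
theorem exists_red_parabolic (hn : 0 < n) (hv : (v : ZMod N) * v' = 1)
    (hw : (w : ZMod N) * w' = 1) {p : Sp n} (hp : p ∈ parabolic n) :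
    ∃ q ∈ parabolic n, (blkD q).det = (blkD p).det ∧
      red n N q = simil n w' w v * red n N p * simil n w w' v' := by
  rcases Int.isUnit_iff.1 (IsUnit.of_mul_eq_one _ (det_blkD_sq hp)) with h | h
  · obtain ⟨q, hq, e⟩ := exists_red_GammaInfPlus hn hv hw
      (mem_GammaInfPlus_iff.2 ⟨mem_parabolic.1 hp, h⟩)
    exact ⟨q, GammaInfPlus_le_parabolic n hq, (mem_GammaInfPlus_iff.1 hq).2.trans h.symm, e⟩
  · have hpar : (gammaPM n)⁻¹ * p ∈ parabolic n := mul_mem (inv_mem gammaPM_mem_parabolic) hp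
    have hp1 : (gammaPM n)⁻¹ * p ∈ GammaInfPlus n := by
      refine mem_GammaInfPlus_iff.2 ⟨mem_parabolic.1 hpar, ?_⟩
      have e := det_blkD_mul_left gammaPM_mem_parabolic ((gammaPM n)⁻¹ * p)
      rw [mul_inv_cancel_left, det_blkD_gammaPM hn, h] at e
      linarith
    obtain ⟨q, hq, e⟩ := exists_red_GammaInfPlus hn hv hw hp1
    refine ⟨gammaPM n * q, mul_mem gammaPM_mem_parabolic (GammaInfPlus_le_parabolic n hq), ?_, ?_⟩
    · rw [det_blkD_mul_left gammaPM_mem_parabolic, det_blkD_gammaPM hn,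
        (mem_GammaInfPlus_iff.1 hq).2, h, mul_one]
    · rw [map_mul, e, ← Matrix.mul_assoc, ← Matrix.mul_assoc, red_gammaPM_mul_simil,
        Matrix.mul_assoc (simil n w' w v) (red n N (gammaPM n)), ← map_mul, mul_inv_cancel_left]

theorem red_mul_simil_of_eq (hv : (v : ZMod N) * v' = 1) (hw : (w : ZMod N) * w' = 1)
    {x y x₁ y₁ : Sp n} (hx : red n N x₁ = simil n w' w v * red n N x * simil n w w' v')
    (hy : red n N y₁ = simil n w' w v * red n N y * simil n w w' v') :
    red n N (x₁ * y₁) = simil n w' w v * red n N (x * y) * simil n w w' v' := by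
  have hs : simil n (w : ZMod N) w' v' * simil n w' w v = 1 :=
    simil_mul_simil hw ((mul_comm v' (v : ZMod N)).trans hv)
  rw [map_mul, map_mul, hx, hy]
  calc _ = simil n w' w v * red n N x * (simil n w w' v' * simil n w' w v) *
        red n N y * simil n w w' v' := by simp only [Matrix.mul_assoc]
    _ = _ := by rw [hs]; simp only [Matrix.mul_assoc, Matrix.one_mul]

theorem red_inv_simil_of_eq (hv : (v : ZMod N) * v' = 1) (hw : (w : ZMod N) * w' = 1)
    {x x₁ : Sp n} (hx : red n N x₁ = simil n w' w v * red n N x * simil n w w' v') :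
    red n N x₁⁻¹ = simil n w' w v * red n N x⁻¹ * simil n w w' v' := by
  have hs : simil n (w : ZMod N) w' v' * simil n w' w v = 1 :=
    simil_mul_simil hw ((mul_comm v' (v : ZMod N)).trans hv)
  have hs' := mul_eq_one_comm.1 hs
  have h1 : red n N x₁ * (simil n w' w v * red n N x⁻¹ * simil n w w' v') = 1 := by
    rw [hx]
    calc _ = simil n w' w v * red n N x * (simil n w w' v' * simil n w' w v) *
          red n N x⁻¹ * simil n w w' v' := by simp only [Matrix.mul_assoc]
      _ = simil n w' w v * (red n N x * red n N x⁻¹) * simil n w w' v' := by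
          rw [hs]; simp only [Matrix.mul_assoc, Matrix.one_mul]
      _ = 1 := by rw [← map_mul, mul_inv_cancel, map_one, Matrix.mul_one, hs']
  have h2 : red n N x₁⁻¹ * red n N x₁ = 1 := by rw [← map_mul, inv_mul_cancel, map_one]
  calc _ = red n N x₁⁻¹ * (red n N x₁ * (simil n w' w v * red n N x⁻¹ * simil n w w' v')) := by
        rw [h1, Matrix.mul_one]
    _ = _ := by rw [← Matrix.mul_assoc, h2, Matrix.one_mul]

theorem mem_Gamma0_iff {x : Sp n} : x ∈ Gamma0 n N ↔ toZ N (blkC x) = 0 := Iff.rfl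

/-- The similitude is block diagonal, so C ≡ 0 persists and D is replaced by WDW⁻¹, with the same
determinant modulo N; hence χ is unchanged. -/
theorem mem_Gamma0_of_red_eq_simil (hv : (v : ZMod N) * v' = 1) (hw : (w : ZMod N) * w' = 1)
    {x x₁ : Sp n} (hx : red n N x₁ = simil n w' w v * red n N x * simil n w w' v')
    (hx0 : x ∈ Gamma0 n N) :
    x₁ ∈ Gamma0 n N ∧ ((blkD x₁).det : ZMod N) = (blkD x).det := by
  rw [red_eq_fromBlocks, red_eq_fromBlocks, simil, simil, fromBlocks_multiply,
    fromBlocks_multiply] at hx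
  obtain ⟨-, -, h3, h4⟩ := fromBlocks_inj.1 hx
  rw [mem_Gamma0_iff] at hx0
  simp only [Matrix.mul_zero, add_zero, Matrix.zero_mul, zero_add, smul_mul,
    Matrix.mul_smul, smul_smul, mul_comm v', hv, one_smul] at h3 h4
  refine ⟨?_, ?_⟩
  · change toZ N (blkC x₁) = 0
    rw [toZ, h3]
    change (v : ZMod N) • (_ * toZ N (blkC x) * _) = _
    rw [hx0]; simp
  · rw [← det_toZ, ← det_toZ]
    change toZ N _ = _ * toZ N _ * _ at h4
    rw [h4, det_mul, det_mul, mul_comm (det _), mul_assoc, ← det_mul, diagFirstMod_mul hw,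
      det_one, mul_one]

/-- A relation between the unipotent elements of `M` and `M'` induces one between their
twists, with the same characters. -/
theorem exists_twist_relation (hn : 0 < n) (hv : (v : ZMod N) * v' = 1)
    (hw : (w : ZMod N) * w' = 1) {M M' : SymMat n} {p g β : Sp n} (hp : p ∈ parabolic n)
    (hg : g ∈ Gamma n N) (hβ : β ∈ Gamma0 n N) (h : lower M' = p * g * lower M * β) (k : ℕ)
    (χ : DirichletCharacter ℂ N) :
    ∃ q ∈ parabolic n, ∃ ε ∈ Gamma0 n N, psi k q = psi k p ∧ chiSp χ ε = chiSp χ β ∧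
      lower (twist v w M') = q * 1 * lower (twist v w M) * ε := by
  obtain ⟨q, hq, hdet, e⟩ := exists_red_parabolic hn hv hw hp
  -- With q lifting the conjugate of p, the element ε is forced by the desired relation. It reduces
  -- to the conjugate of β, since g is trivial modulo N.
  let ε : Sp n := (lower (twist v w M))⁻¹ * (q⁻¹ * lower (twist v w M'))
  have hε : red n N ε = simil n w' w v *
      red n N ((lower M)⁻¹ * (p⁻¹ * lower M')) * simil n w w' v' :=
    red_mul_simil_of_eq hv hw (red_inv_simil_of_eq hv hw (red_lower_twist hv hw M))
      (red_mul_simil_of_eq hv hw (red_inv_simil_of_eq hv hw e) (red_lower_twist hv hw M'))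
  have hβ' : red n N ((lower M)⁻¹ * (p⁻¹ * lower M')) = red n N β := by
    rw [h]
    have e1 : (lower M)⁻¹ * (p⁻¹ * (p * g * lower M * β)) = (lower M)⁻¹ * g * lower M * β := by
      group
    rw [e1, map_mul, map_mul, map_mul, mem_Gamma_iff.1 hg, mul_one, ← map_mul, inv_mul_cancel,
      map_one, one_mul]
  rw [hβ'] at hε
  obtain ⟨h0, hd⟩ := mem_Gamma0_of_red_eq_simil hv hw hε hβ
  refine ⟨q, hq, ε, h0, by rw [psi, psi, hdet], by rw [chiSp, chiSp, hd], ?_⟩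
  simp only [ε]; group

end Twist

/-! ### Descent of the twist to the set of series -/

section Action

variable {N k : ℕ}

theorem isUnit_of_isCoprime_mul {v w : ℤ} (h : IsCoprime (v * w) (N : ℤ)) :
    (∃ v' : ZMod N, (v : ZMod N) * v' = 1) ∧ ∃ w' : ZMod N, (w : ZMod N) * w' = 1 := by
  have h1 := (ZMod.coe_int_isUnit_iff_isCoprime v N).2 h.of_mul_left_left.symm
  have h2 := (ZMod.coe_int_isUnit_iff_isCoprime w N).2 h.of_mul_left_right.symm
  exact ⟨h1.exists_right_inv, h2.exists_right_inv⟩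

theorem exists_lower_eq_mul {M M' : SymMat n} (h : toZ N M.1 = toZ N M'.1) :
    ∃ g ∈ Gamma n N, lower M' = lower M * g := by
  refine ⟨(lower M)⁻¹ * lower M', ?_, by group⟩
  have e : red n N (lower M') = red n N (lower M) := by rw [red_lower, red_lower, h]
  rw [mem_Gamma_iff, map_mul, e, ← map_mul, inv_mul_cancel, map_one]

theorem toZ_twist_congr {v w v₁ w₁ : ℤ} (hv : v₁ ≡ v [ZMOD (N : ℤ)]) (hw : w₁ ≡ w [ZMOD (N : ℤ)])
    (M : SymMat n) : toZ N (twist v w M).1 = toZ N (twist v₁ w₁ M).1 := by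
  rw [toZ_twist, toZ_twist, (ZMod.intCast_eq_intCast_iff v₁ v N).2 hv,
    (ZMod.intCast_eq_intCast_iff w₁ w N).2 hw]

theorem eis_lower_congr (hn : 0 < n) (χ : DirichletCharacter ℂ N)
    (hχ : χ (-1) = (-1 : ℂ) ^ k) {M M' : SymMat n} (h : toZ N M.1 = toZ N M'.1) :
    eis k χ (lower M) = eis k χ (lower M') := by
  obtain ⟨g, hg, e⟩ := exists_lower_eq_mul h
  have := eis_transform hn χ hχ (one_mem (parabolic n)) (one_mem (Gamma n N))
    (Gamma_le_Gamma0 n N hg) (lower M)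
  rw [one_mul, one_mul, ← e, psi_eq_one k (one_mem _), chiSp_of_mem_Gamma χ hg, one_mul,
    one_smul] at this
  exact this.symm

variable {v w : ℤ} {v' w' : ZMod N}

/-- The incompatible self-relation that explains the vanishing of 𝔼_γ is transported to the twist
with the same scalar ≠ 1, which kills the twisted series as well. -/
theorem eis_twist_eq_zero (hn : 0 < n) (hN : 0 < N) (hk : n + 1 < k) (χ : DirichletCharacter ℂ N)
    (hχ : χ (-1) = (-1 : ℂ) ^ k) (hv : (v : ZMod N) * v' = 1) (hw : (w : ZMod N) * w' = 1)
    {M : SymMat n} (h : eis k χ (lower M) = 0) : eis k χ (lower (twist v w M)) = 0 := by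
  obtain ⟨p, hp, g, hg, β, hβ, e, hne⟩ := exists_bad_relation hn hN hk χ hχ h
  obtain ⟨q, hq, ε, hε, h1, h2, e'⟩ := exists_twist_relation hn hv hw hp hg hβ e k χ
  have := eis_transform hn χ hχ hq (one_mem _) hε (lower (twist v w M))
  rw [← e', h1, h2] at this
  have h3 : (psi k p * chiSp χ β - 1) • eis k χ (lower (twist v w M)) = 0 := by
    rw [sub_smul, one_smul, ← this, sub_self]
  exact (smul_eq_zero.1 h3).resolve_left (sub_ne_zero.2 hne)

/-- If the common series is nonzero, the two double cosets agree and the scalar of the connecting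
relation must be 1; the transported relation has the same scalar. The zero case has no common double
coset and is treated separately. -/
theorem eis_twist_congr (hn : 0 < n) (hN : 0 < N) (hk : n + 1 < k) (χ : DirichletCharacter ℂ N)
    (hχ : χ (-1) = (-1 : ℂ) ^ k) (hv : (v : ZMod N) * v' = 1) (hw : (w : ZMod N) * w' = 1)
    {M M' : SymMat n} (h : eis k χ (lower M) = eis k χ (lower M')) :
    eis k χ (lower (twist v w M)) = eis k χ (lower (twist v w M')) := by
  by_cases h0 : eis k χ (lower M') = 0
  · rw [eis_twist_eq_zero hn hN hk χ hχ hv hw h0, eis_twist_eq_zero hn hN hk χ hχ hv hw (h.trans h0)]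
  obtain ⟨p, hp, g, hg, β, hβ, e⟩ := exists_relation_of_eis_eq hn hN hk χ hχ h h0
  obtain ⟨q, hq, ε, hε, h1, h2, e'⟩ := exists_twist_relation hn hv hw hp hg hβ e k χ
  have t1 := eis_transform hn χ hχ hp hg hβ (lower M)
  have t2 := eis_transform hn χ hχ hq (one_mem _) hε (lower (twist v w M))
  rw [← e, h] at t1
  have h3 : (psi k p * chiSp χ β - 1) • eis k χ (lower M') = 0 := by
    rw [sub_smul, one_smul, ← t1, sub_self]
  rw [← e', h1, h2, sub_eq_zero.1 ((smul_eq_zero.1 h3).resolve_right h0), one_smul] at t2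
  exact t2.symm

theorem twist_one_one (M : SymMat n) : twist 1 1 M = M := by
  have h : diagFirst n 1 = 1 := by simp [diagFirst]
  exact Subtype.ext (by simp [twist, h])

theorem twist_twist (v w v₁ w₁ : ℤ) (M : SymMat n) :
    twist v w (twist v₁ w₁ M) = twist (v * v₁) (w * w₁) M := by
  have h : diagFirst n w * diagFirst n w₁ = diagFirst n (w * w₁) := by
    rw [diagFirst, diagFirst, diagFirst, diagonal_mul_diagonal]
    congr 1; funext i
    split_ifs <;> simp
  have h' : diagFirst n w₁ * diagFirst n w = diagFirst n (w * w₁) := by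
    rw [← h, diagFirst, diagFirst, diagonal_mul_diagonal, diagonal_mul_diagonal]
    simp only [mul_comm]
  apply Subtype.ext
  change v • (diagFirst n w * (v₁ • (diagFirst n w₁ * M.1 * diagFirst n w₁)) * diagFirst n w) =
    (v * v₁) • (diagFirst n (w * w₁) * M.1 * diagFirst n (w * w₁))
  rw [Matrix.mul_smul, smul_mul, smul_smul]
  congr 1
  calc _ = diagFirst n w * diagFirst n w₁ * M.1 * (diagFirst n w₁ * diagFirst n w) := by
        simp only [Matrix.mul_assoc]
    _ = _ := by rw [h, h']

theorem exists_mulAction (hn : 0 < n) (hN : 0 < N) (hk : n + 1 < k) (χ : DirichletCharacter ℂ N)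
    (hχ : χ (-1) = (-1 : ℂ) ^ k) :
    ∃ act : MulAction ((ZMod N)ˣ × (ZMod N)ˣ) (eisSet n k χ),
      ∀ (a b : (ZMod N)ˣ) (v w : ℤ), (v : ZMod N) = a → (w : ZMod N) = b →
        ∀ M : SymMat n, act.smul (a, b) (eisMem k χ M) = eisMem k χ (twist v w M) := by
  let lift : (ZMod N)ˣ → ℤ := fun u => Function.surjInv ZMod.intCast_surjective (u : ZMod N)
  have hlift : ∀ u : (ZMod N)ˣ, ((lift u : ℤ) : ZMod N) = u :=
    fun u => Function.surjInv_eq ZMod.intCast_surjective (u : ZMod N)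
  -- The action is defined through arbitrary choices of a matrix for each series and integers for
  -- each unit; `key` states that these choices do not matter.
  let rep : eisSet n k χ → SymMat n := fun f => f.2.choose
  have hrep : ∀ f : eisSet n k χ, f = eisMem k χ (rep f) :=
    fun f => Subtype.ext f.2.choose_spec
  have key : ∀ (a b : (ZMod N)ˣ) (v w : ℤ), (v : ZMod N) = a → (w : ZMod N) = b →
      ∀ M : SymMat n, eisMem k χ (twist (lift a) (lift b) (rep (eisMem k χ M))) =
        eisMem k χ (twist v w M) := by
    intro a b v w hv hw M
    have h1 := eis_twist_congr hn hN hk χ hχ (v := lift a) (w := lift b)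
      (by rw [hlift, Units.mul_inv]) (by rw [hlift, Units.mul_inv])
      (congrArg Subtype.val (hrep (eisMem k χ M)))
    refine Subtype.ext (h1.symm.trans (eis_lower_congr hn χ hχ ?_))
    rw [toZ_twist, toZ_twist, hlift, hlift, hv, hw]
  refine ⟨{ smul := fun u f => eisMem k χ (twist (lift u.1) (lift u.2) (rep f)),
            one_smul := ?one, mul_smul := ?mul }, key⟩
  case one =>
    intro f
    change eisMem k χ (twist (lift 1) (lift 1) (rep f)) = f
    conv_rhs => rw [hrep f, ← twist_one_one (rep f)]
    conv_lhs => rw [hrep f]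
    exact key 1 1 1 1 (by simp) (by simp) (rep f)
  case mul =>
    rintro ⟨a, b⟩ ⟨c, d⟩ f
    change eisMem k χ (twist (lift (a * c)) (lift (b * d)) (rep f)) =
      eisMem k χ (twist (lift a) (lift b)
        (rep (eisMem k χ (twist (lift c) (lift d) (rep f)))))
    rw [key a b (lift a) (lift b) (hlift a) (hlift b), twist_twist]
    conv_lhs => rw [hrep f]
    exact key (a * c) (b * d) _ _ (by rw [Int.cast_mul, hlift, hlift, Units.val_mul])
      (by rw [Int.cast_mul, hlift, hlift, Units.val_mul]) (rep f)

end Action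

/-! ### Square-free level -/

section SquareFree

variable {N : ℕ}

theorem MulPartition.coprime_part (hsq : Squarefree N) (σ : MulPartition n N)
    {d d' : Fin (n + 1)} (h : d ≠ d') : (σ.part d).Coprime (σ.part d') := by
  have h1 : σ.part d * σ.part d' ∣ N := by
    conv_rhs => rw [← σ.prod_part, ← Finset.mul_prod_erase _ _ (Finset.mem_univ d)]
    exact Nat.mul_dvd_mul_left _ (Finset.dvd_prod_of_mem _ (by simp [h.symm]))
  exact Nat.coprime_of_squarefree_mul (hsq.squarefree_of_dvd h1)

theorem MulPartition.part_dvd_div (hsq : Squarefree N) (σ : MulPartition n N)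
    {d d' : Fin (n + 1)} (h : d' ≠ d) : σ.part d' ∣ N / σ.part d := by
  refine (σ.coprime_part hsq h).dvd_of_dvd_mul_left ?_
  rw [Nat.mul_div_cancel' (σ.part_dvd d)]
  exact σ.part_dvd d'

/-- Reduction from level `N` to the level of a part. -/
abbrev MulPartition.proj (σ : MulPartition n N) (d : Fin (n + 1)) : ZMod N →+* ZMod (σ.part d) :=
  ZMod.castHom (σ.part_dvd d) _

theorem MulPartition.ext_proj (hsq : Squarefree N) (σ : MulPartition n N) {a b : ZMod N}
    (h : ∀ d, σ.proj d a = σ.proj d b) : a = b := by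
  obtain ⟨x, rfl⟩ := ZMod.intCast_surjective a
  obtain ⟨y, rfl⟩ := ZMod.intCast_surjective b
  rw [ZMod.intCast_eq_intCast_iff_dvd_sub]
  have h1 : (N : ℤ) = ∏ d, (σ.part d : ℤ) := by rw [← Nat.cast_prod, σ.prod_part]
  rw [h1]
  refine Fintype.prod_dvd_of_coprime (fun d d' hd => ?_) fun d => ?_
  · exact Nat.isCoprime_iff_coprime.2 (σ.coprime_part hsq hd)
  · have := h d
    rw [map_intCast, map_intCast, ZMod.intCast_eq_intCast_iff_dvd_sub] at this
    exact this

/-- The local component is evaluated as χ at the Chinese remainder lift that is 1 away from m;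
values of all components can then be multiplied inside `ZMod N`. -/
theorem exists_charFactor_eq (χ : DirichletCharacter ℂ N) {m : ℕ} (hm : m ∣ N)
    (hc : m.Coprime (N / m)) {a : ZMod m} (ha : IsUnit a) :
    ∃ b : ZMod N, ZMod.castHom hm (ZMod m) b = a ∧
      ZMod.castHom (Nat.div_dvd_of_dvd hm) (ZMod (N / m)) b = 1 ∧
      charFactor χ m hm hc a = χ b := by
  obtain ⟨u, rfl⟩ := ha
  let y : ZMod (m * (N / m)) := (ZMod.chineseRemainder hc).symm ((u : ZMod m), 1)
  have hy : ZMod.chineseRemainder hc y = ((u : ZMod m), 1) := RingEquiv.apply_symm_apply _ _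
  have hdvd : N ∣ m * (N / m) := dvd_of_eq (Nat.mul_div_cancel' hm).symm
  refine ⟨ZMod.castHom hdvd (ZMod N) y, ?_, ?_, ?_⟩
  · refine (DFunLike.congr_fun (RingHom.ext_zmod ((ZMod.castHom hm (ZMod m)).comp
      (ZMod.castHom hdvd (ZMod N))) ((RingHom.fst (ZMod m) (ZMod (N / m))).comp
      (ZMod.chineseRemainder hc : ZMod (m * (N / m)) →+* ZMod m × ZMod (N / m)))) y).trans ?_
    exact congrArg Prod.fst hy
  · refine (DFunLike.congr_fun (RingHom.ext_zmod
      ((ZMod.castHom (Nat.div_dvd_of_dvd hm) (ZMod (N / m))).comp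
      (ZMod.castHom hdvd (ZMod N))) ((RingHom.snd (ZMod m) (ZMod (N / m))).comp
      (ZMod.chineseRemainder hc : ZMod (m * (N / m)) →+* ZMod m × ZMod (N / m)))) y).trans ?_
    exact congrArg Prod.snd hy
  · rw [charFactor, MulChar.ofUnitHom_coe, MonoidHom.comp_apply,
      DirichletCharacter.changeLevel_toUnitHom, MonoidHom.comp_apply, MulChar.coe_toUnitHom]
    rfl

/-- A determinant one lift of `diag(u, 1, …, 1, u⁻¹)` modulo `N`. -/
theorem exists_lift_diag (hn : 1 < n) {u u' : ZMod N} (hu : u * u' = 1) :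
    ∃ X : Matrix (Fin n) (Fin n) ℤ, X.det = 1 ∧ toZ N X = diagonal fun i : Fin n =>
      (if (i : ℕ) = 0 then u else 1) * (if (i : ℕ) = n - 1 then u' else 1) := by
  have hn0 : 0 < n := by omega
  obtain ⟨w, rfl⟩ := ZMod.intCast_surjective u'
  have hcop : IsCoprime w (N : ℤ) := by
    rw [isCoprime_comm, ← ZMod.coe_int_isUnit_iff_isCoprime]
    exact IsUnit.of_mul_eq_one u ((mul_comm _ _).trans hu)
  let τ : Equiv.Perm (Fin n) := Equiv.swap ⟨0, hn0⟩ ⟨n - 1, by omega⟩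
  -- A signed transposition of the first and last coordinates, with determinant one. It moves w from
  -- the first to the last diagonal place, so A'A⁻¹ reduces to W⁻¹AWA⁻¹ = diag(w⁻¹, 1, …, 1, w),
  -- where w⁻¹ is u.
  let A : Matrix (Fin n) (Fin n) ℤ := diagFirst n (-1) * τ.permMatrix ℤ
  have hA : A.det = 1 := by
    rw [det_mul, det_diagFirst hn0, det_permutation, Equiv.Perm.sign_swap]
    · simp
    · intro h; have := congrArg Fin.val h; simp at this; omega
  let L : Matrix (Fin n) (Fin n) ℤ := diagonal fun i : Fin n => if (i : ℕ) = n - 1 then w else 1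
  have hAL : A * diagFirst n w = L * A := by
    ext i j
    simp only [A, L, diagFirst, diagonal_mul, mul_diagonal]
    by_cases hj : τ i = j
    · have h0 : (j : ℕ) = 0 ↔ (i : ℕ) = n - 1 := by
        have h1 : τ i = ⟨0, hn0⟩ ↔ i = ⟨n - 1, by omega⟩ := by
          rw [← Equiv.eq_symm_apply, Equiv.symm_swap, Equiv.swap_apply_left]
        rw [hj] at h1
        simpa [Fin.ext_iff] using h1
      simp only [h0]
      ring
    · have h0 : τ.permMatrix ℤ i j = 0 := by
        rw [Equiv.Perm.permMatrix, PEquiv.toMatrix_apply, if_neg]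
        simpa [Equiv.toPEquiv_apply, eq_comm] using hj
      rw [h0]; ring
  obtain ⟨A', hA', e⟩ := exists_conj_diagFirst hn0 hcop hA
  refine ⟨A' * A.adjugate, ?_, ?_⟩
  · rw [det_mul, hA', det_adjugate, hA, one_pow, mul_one]
  · have hadj : A * A.adjugate = 1 := by rw [mul_adjugate, hA, one_smul]
    have h1 : diagFirstMod n (w : ZMod N) * toZ N (A' * A.adjugate) = toZ N L := by
      rw [← toZ_diagFirst, toZ_mul, ← Matrix.mul_assoc, e, ← toZ_mul, hAL, ← toZ_mul,
        Matrix.mul_assoc, hadj, Matrix.mul_one]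
    have h2 : toZ N (A' * A.adjugate) = diagFirstMod n u * toZ N L := by
      rw [← h1, ← Matrix.mul_assoc, diagFirstMod_mul hu, Matrix.one_mul]
    have h3 : toZ N L = diagonal fun i : Fin n => if (i : ℕ) = n - 1 then (w : ZMod N) else 1 := by
      rw [toZ, diagonal_map (map_zero _)]
      congr 1; funext i
      split_ifs <;> simp
    rw [h2, h3, diagFirstMod, diagonal_mul_diagonal]

/-- Modulo N everything is diagonal, so the relation splits into n relations of 2 × 2 matrices:
where e = 0 the lower right entry is x', where e = 1 it is xm'. The freedom in x is what lets the
determinant be adjusted. -/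
theorem exists_diagonal_relation {M M' : SymMat n} {e x x' m m' : Fin n → ZMod N}
    (hx : ∀ i, x i * x' i = 1) (hm : ∀ i, m i * m' i = 1) (he : ∀ i, e i * e i = e i)
    {X : Matrix (Fin n) (Fin n) ℤ} (hX : X.det = 1) (hXx : toZ N X = diagonal x)
    (hM : toZ N M.1 = diagonal e) (hM' : toZ N M'.1 = diagonal fun i => m i * e i) :
    ∃ p ∈ GammaInfPlus n, ∃ β ∈ Gamma0 n N, lower M' = p * 1 * lower M * β ∧
      ((blkD β).det : ZMod N) = ∏ i, ((1 - e i) * x' i + e i * (x i * m' i)) := by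
  -- The upper unipotent entry s = 1 − x²m' is the one for which the lower left entry of
  -- γ_M⁻¹qγ_{M'} vanishes, using that e is idempotent.
  choose s hs using fun i => ZMod.intCast_surjective (1 - x i * x i * m' i)
  let S : SymMat n := ⟨diagonal s, diagonal_transpose s⟩
  have hS : toZ N S.1 = diagonal fun i => 1 - x i * x i * m' i := by
    rw [toZ]
    change (diagonal s).map _ = _
    rw [diagonal_map (map_zero _)]
    exact congrArg _ (funext hs)
  have hadj : toZ N X.adjugateᵀ = diagonal x' := by
    have h1 : toZ N X * toZ N X.adjugate = 1 := by
      rw [← toZ_mul, mul_adjugate, hX, one_smul, toZ_one]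
    have h2 : diagonal x' * diagonal x = 1 := by
      rw [diagonal_mul_diagonal, ← diagonal_one]
      exact congrArg _ (funext fun i => (mul_comm _ _).trans (hx i))
    have h3 : toZ N X.adjugate = diagonal x' := by
      calc _ = diagonal x' * diagonal x * toZ N X.adjugate := by rw [h2, Matrix.one_mul]
        _ = _ := by rw [Matrix.mul_assoc, ← hXx, h1, Matrix.mul_one]
    have h4 : toZ N X.adjugateᵀ = (toZ N X.adjugate)ᵀ := rfl
    rw [h4, h3, diagonal_transpose]
  let q : Sp n := upper S * levi X hX
  let β : Sp n := (lower M)⁻¹ * (q * lower M')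
  have hinv : red n N (lower M)⁻¹ = fromBlocks 1 0 (-diagonal e) 1 := by
    have h1 : red n N (lower M) * fromBlocks 1 0 (-diagonal e) 1 = 1 := by
      rw [red_lower, hM, fromBlocks_multiply, ← fromBlocks_one]
      simp
    have h2 : red n N (lower M)⁻¹ * red n N (lower M) = 1 := by
      rw [← map_mul, inv_mul_cancel, map_one]
    rw [← Matrix.mul_one (red n N (lower M)⁻¹), ← h1, ← Matrix.mul_assoc, h2, Matrix.one_mul]
  have hβ : red n N (lower M)⁻¹ * (red n N (upper S) * red n N (levi X hX) *
      red n N (lower M')) = red n N β := by simp only [β, q, map_mul]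
  rw [hinv, red_upper, red_levi, red_lower, hS, hXx, hadj, hM', red_eq_fromBlocks] at hβ
  simp only [fromBlocks_multiply, Matrix.mul_zero, add_zero, Matrix.zero_mul, zero_add,
    Matrix.mul_one, Matrix.one_mul, diagonal_mul_diagonal, diagonal_add, diagonal_neg] at hβ
  obtain ⟨-, -, hC, hD⟩ := fromBlocks_inj.1 hβ
  refine ⟨q⁻¹, inv_mem (mul_mem (upper_mem _) (levi_mem _ _)), β, ?_, ?_, ?_⟩
  · rw [mem_Gamma0_iff, toZ, ← hC, ← diagonal_zero]
    congr 1; funext i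
    linear_combination (e i * e i * x i * m i * m' i) * hx i + (e i * e i * x i) * hm i +
      (x i - x' i * m i) * he i
  · simp only [β]; group
  · rw [← det_toZ, toZ, ← hD, det_diagonal]
    refine Finset.prod_congr rfl fun i _ => ?_
    linear_combination (e i * x i * m' i) * hx i

/-- The part of index `d` sees the idempotent `e i` as the truth value of `i < d`. -/
theorem proj_diag {σ : MulPartition n N} {M : SymMat n} (h : IsRepOf M σ) (d : Fin (n + 1))
    (i : Fin n) : σ.proj d (M.1 i i : ZMod N) = if (i : ℕ) < (d : ℕ) then 1 else 0 := by
  rw [map_intCast, (ZMod.intCast_eq_intCast_iff _ _ _).2 (h d i i)]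
  simp only [true_and]
  split_ifs <;> simp

theorem toZ_eq_diagonal (hsq : Squarefree N) {σ : MulPartition n N} {M : SymMat n}
    (h : IsRepOf M σ) : toZ N M.1 = diagonal fun i => (M.1 i i : ZMod N) := by
  ext i j
  by_cases hij : i = j
  · subst hij; simp
  · rw [diagonal_apply_ne _ hij]
    refine σ.ext_proj hsq fun d => ?_
    have := (ZMod.intCast_eq_intCast_iff _ _ _).2 (h d i j)
    rw [if_neg (fun h => hij h.1)] at this
    have h1 : toZ N M.1 i j = (M.1 i j : ZMod N) := rfl
    rw [h1, map_intCast, this]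
    simp

theorem prod_ite_val_lt {R : Type*} [CommMonoid R] {d : ℕ} (hd : d ≤ n) (a : R) :
    ∏ i : Fin n, (if (i : ℕ) < d then a else 1) = a ^ d := by
  rw [Finset.prod_ite, Finset.prod_const, Finset.prod_const_one, mul_one,
    Fin.card_filter_val_lt, min_eq_right hd]

theorem prod_ite_val_eq {R : Type*} [CommMonoid R] (j : Fin n) (a : R) :
    ∏ i : Fin n, (if (i : ℕ) = j then a else 1) = a := by
  simp only [← Fin.ext_iff]
  rw [Finset.prod_ite_eq' Finset.univ j fun _ => a, if_pos (Finset.mem_univ _)]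

/-- The relation between `M_σ` and its twist, and the resulting determinant at each part. -/
theorem exists_relation_twist (hn : 0 < n) (hsq : Squarefree N) {σ : MulPartition n N}
    {M : SymMat n} (h : IsRepOf M σ) {v w : ℤ} {v' w' : ZMod N} (hv : (v : ZMod N) * v' = 1)
    (hw : (w : ZMod N) * w' = 1) :
    ∃ p ∈ GammaInfPlus n, ∃ β ∈ Gamma0 n N, lower (twist v w M) = p * 1 * lower M * β ∧
      ∀ d : Fin (n + 1), σ.proj d ((blkD β).det : ZMod N) =
        σ.proj d v' ^ (d : ℕ) * if d = Fin.last n then σ.proj d w' ^ 2 else 1 := by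
  let l : Fin n := ⟨n - 1, by omega⟩
  let z : Fin n := ⟨0, hn⟩
  let e : Fin n → ZMod N := fun i => (M.1 i i : ZMod N)
  have he : ∀ d i, σ.proj d (e i) = if (i : ℕ) < (d : ℕ) then 1 else 0 := proj_diag h
  have hee : ∀ i, e i * e i = e i := fun i => σ.ext_proj hsq fun d => by
    rw [map_mul, he]; split_ifs <;> simp
  -- The idempotent of the intermediate parts: there the first diagonal entry of M_σ is 1 and the
  -- last is 0.
  obtain ⟨f, hf⟩ : ∃ f : ZMod N, ∀ d, σ.proj d f = if 0 < (d : ℕ) ∧ (d : ℕ) < n then 1 else 0 := by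
    refine ⟨e z * (1 - e l), fun d => ?_⟩
    rw [map_mul, map_sub, map_one, he, he]
    have hd : (d : ℕ) ≤ n := Nat.lt_succ_iff.1 d.2
    by_cases h1 : 0 < (d : ℕ)
    · by_cases h2 : (d : ℕ) < n
      · rw [if_pos h1, if_neg (by simp only [l]; omega), if_pos ⟨h1, h2⟩, sub_zero, one_mul]
      · rw [if_pos h1, if_pos (by simp only [l]; omega), if_neg (by omega), sub_self, mul_zero]
    · rw [if_neg h1, zero_mul, if_neg fun h2 => h1 h2.1]
  have hff : f * f = f := σ.ext_proj hsq fun d => by rw [map_mul, hf]; split_ifs <;> simp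
  -- At an intermediate part the twist contributes w⁻² at the first coordinate. Taking x = diag(w,
  -- 1, …, 1, w⁻¹) there contributes w at the first place and, through x', another w at the last,
  -- cancelling it. At d = n no coordinate has e = 0, so w⁻² survives; at d = 0 the twist is
  -- invisible. In both cases u = 1.
  obtain ⟨u, u', huu, hu, hu'⟩ : ∃ u u' : ZMod N, u * u' = 1 ∧
      (∀ d, σ.proj d u = if 0 < (d : ℕ) ∧ (d : ℕ) < n then σ.proj d w else 1) ∧
      ∀ d, σ.proj d u' = if 0 < (d : ℕ) ∧ (d : ℕ) < n then σ.proj d w' else 1 := by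
    refine ⟨1 + f * (w - 1), 1 + f * (w' - 1), ?_, fun d => ?_, fun d => ?_⟩
    · linear_combination f * hw + (w - 1) * (w' - 1) * hff
    all_goals
      rw [map_add, map_mul, hf, map_sub, map_one]
      split_ifs <;> ring
  let x : Fin n → ZMod N := fun i =>
    (if (i : ℕ) = 0 then u else 1) * (if (i : ℕ) = n - 1 then u' else 1)
  let x' : Fin n → ZMod N := fun i =>
    (if (i : ℕ) = 0 then u' else 1) * (if (i : ℕ) = n - 1 then u else 1)
  have hx : ∀ i, x i * x' i = 1 := by
    intro i
    simp only [x, x']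
    split_ifs
    · linear_combination (u * u' + 1) * huu
    · linear_combination huu
    · linear_combination huu
    · ring
  obtain ⟨X, hX, hXx⟩ : ∃ X : Matrix (Fin n) (Fin n) ℤ, X.det = 1 ∧ toZ N X = diagonal x := by
    rcases Nat.lt_or_ge 1 n with h1 | h1
    · exact exists_lift_diag h1 huu
    -- For n = 1 the first and last coordinates coincide and x = uu' = 1.
    · refine ⟨1, det_one, ?_⟩
      rw [toZ_one, ← diagonal_one]
      congr 1; funext i
      have h0 : (i : ℕ) = 0 := by omega
      have h2 : (i : ℕ) = n - 1 := by omega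
      simp only [x, if_pos h0, if_pos h2, huu]
  let m : Fin n → ZMod N := fun i => v * if (i : ℕ) = 0 then (w : ZMod N) ^ 2 else 1
  let m' : Fin n → ZMod N := fun i => v' * if (i : ℕ) = 0 then w' ^ 2 else 1
  have hm : ∀ i, m i * m' i = 1 := by
    intro i
    simp only [m, m']
    split_ifs
    · linear_combination hv * ((w : ZMod N) ^ 2 * w' ^ 2) + hw * (w * w' + 1)
    · linear_combination hv
  have hM' : toZ N (twist v w M).1 = diagonal fun i => m i * e i := by
    rw [toZ_twist, toZ_eq_diagonal hsq h, diagFirstMod, diagonal_mul_diagonal,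
      diagonal_mul_diagonal, ← diagonal_smul]
    congr 1; funext i
    simp only [m, e, Pi.smul_apply, smul_eq_mul]
    split_ifs <;> ring
  obtain ⟨p, hp, β, hβ, h1, h2⟩ :=
    exists_diagonal_relation hx hm hee hX hXx (toZ_eq_diagonal hsq h) hM'
  refine ⟨p, hp, β, hβ, h1, fun d => ?_⟩
  have hd : (d : ℕ) ≤ n := Nat.lt_succ_iff.1 d.2
  rw [h2, map_prod]
  have hbc : σ.proj d (w : ZMod N) * σ.proj d w' = 1 := by rw [← map_mul, hw, map_one]
  have hfac : ∀ i, σ.proj d ((1 - e i) * x' i + e i * (x i * m' i)) =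
      (1 - if (i : ℕ) < (d : ℕ) then 1 else 0) *
        ((if (i : ℕ) = 0 then σ.proj d u' else 1) * (if (i : ℕ) = n - 1 then σ.proj d u else 1)) +
      (if (i : ℕ) < (d : ℕ) then 1 else 0) *
        ((if (i : ℕ) = 0 then σ.proj d u else 1) * (if (i : ℕ) = n - 1 then σ.proj d u' else 1) *
          (σ.proj d v' * if (i : ℕ) = 0 then σ.proj d w' ^ 2 else 1)) := by
    intro i
    simp only [x, x', m', map_add, map_mul, map_sub, map_one, he, apply_ite (σ.proj d), map_pow]
  rw [Finset.prod_congr rfl fun i _ => hfac i, hu, hu']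
  by_cases h1 : 0 < (d : ℕ) ∧ (d : ℕ) < n
  · rw [if_pos h1, if_pos h1, if_neg (fun h3 => by rw [h3, Fin.val_last] at h1; omega), mul_one]
    calc _ = ∏ i : Fin n, ((if (i : ℕ) < (d : ℕ) then σ.proj d v' else 1) *
          (if (i : ℕ) = z then σ.proj d (w : ZMod N) * σ.proj d w' ^ 2 else 1) *
          (if (i : ℕ) = l then σ.proj d (w : ZMod N) else 1)) := by
          refine Finset.prod_congr rfl fun i _ => ?_
          simp only [z, l]
          split_ifs <;> first | omega | ring
      _ = _ := by
          rw [Finset.prod_mul_distrib, Finset.prod_mul_distrib, prod_ite_val_lt hd,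
            prod_ite_val_eq, prod_ite_val_eq]
          linear_combination σ.proj d v' ^ (d : ℕ) *
            (σ.proj d (w : ZMod N) * σ.proj d w' + 1) * hbc
  · rw [if_neg h1, if_neg h1]
    by_cases h3 : d = Fin.last n
    · rw [if_pos h3]
      have h4 : (d : ℕ) = n := by rw [h3, Fin.val_last]
      calc _ = ∏ i : Fin n, ((if (i : ℕ) < (d : ℕ) then σ.proj d v' else 1) *
            (if (i : ℕ) = z then σ.proj d w' ^ 2 else 1)) := by
            refine Finset.prod_congr rfl fun i _ => ?_
            have h5 : (i : ℕ) < d := h4.symm ▸ i.2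
            simp only [z, if_pos h5]
            split_ifs <;> ring
        _ = _ := by rw [Finset.prod_mul_distrib, prod_ite_val_lt hd, prod_ite_val_eq]
    · have h4 : (d : ℕ) = 0 := by
        have : (d : ℕ) ≠ n := fun h5 => h3 (Fin.ext (by rw [h5, Fin.val_last]))
        omega
      rw [if_neg h3, h4, pow_zero, mul_one]
      refine Finset.prod_eq_one fun i _ => ?_
      rw [if_neg (Nat.not_lt_zero _)]
      simp

theorem eis_twist_squarefree {k : ℕ} (hn : 0 < n) (χ : DirichletCharacter ℂ N)
    (hχ : χ (-1) = (-1 : ℂ) ^ k) (hsq : Squarefree N) (σ : MulPartition n N) {M : SymMat n}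
    (h : IsRepOf M σ) {v w : ℤ} {v' w' : ZMod N} (hv : (v : ZMod N) * v' = 1)
    (hw : (w : ZMod N) * w' = 1) :
    eis k χ (lower (twist v w M)) =
      (starRingEnd ℂ (partChar χ hsq σ (Fin.last n) ((w ^ 2 : ℤ) : ZMod _)) *
        ∏ d ∈ Finset.univ.filter (fun d : Fin (n + 1) => 0 < (d : ℕ)),
          starRingEnd ℂ (partChar χ hsq σ d ((v ^ (d : ℕ) : ℤ) : ZMod _))) •
      eis k χ (lower M) := by
  obtain ⟨p, hp, β, hβ, e, hdet⟩ := exists_relation_twist hn hsq h hv hw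
  rw [e, eis_transform hn χ hχ (GammaInfPlus_le_parabolic n hp) (one_mem _) hβ,
    psi_eq_one k hp, one_mul]
  congr 1
  have hv1 : ∀ d, ((v : ℤ) : ZMod (σ.part d)) * σ.proj d v' = 1 := fun d => by
    rw [← map_intCast (σ.proj d), ← map_mul, hv, map_one]
  have hw1 : ∀ d, ((w : ℤ) : ZMod (σ.part d)) * σ.proj d w' = 1 := fun d => by
    rw [← map_intCast (σ.proj d), ← map_mul, hw, map_one]
  have hexists : ∀ (d : Fin (n + 1)) (a : ZMod (σ.part d)), IsUnit a → ∃ b : ZMod N,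
      σ.proj d b = a ∧ (∀ d', d' ≠ d → σ.proj d' b = 1) ∧ partChar χ hsq σ d a = χ b := by
    intro d a ha
    obtain ⟨b, hb1, hb2, hb3⟩ := exists_charFactor_eq χ (σ.part_dvd d)
      (coprime_div_of_squarefree hsq (σ.part_dvd d)) ha
    refine ⟨b, hb1, fun d' hd' => ?_, hb3⟩
    have h1 := congrArg (ZMod.castHom (σ.part_dvd_div hsq hd') (ZMod (σ.part d'))) hb2
    rwa [← RingHom.comp_apply, ZMod.castHom_comp, map_one] at h1
  obtain ⟨b, hb1, hb2, hb3⟩ := hexists (Fin.last n) ((w ^ 2 : ℤ) : ZMod _) (by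
    rw [Int.cast_pow]; exact (IsUnit.of_mul_eq_one _ (hw1 _)).pow 2)
  choose c hc1 hc2 hc3 using fun d : Fin (n + 1) => hexists d ((v ^ (d : ℕ) : ℤ) : ZMod _) (by
    rw [Int.cast_pow]; exact (IsUnit.of_mul_eq_one _ (hv1 _)).pow _)
  -- Checked part by part: the lifts reduce to v^d, times w² when d = n, inverse to det D_β there.
  -- Applying χ and using |χ(β)| = 1 expresses χ(β) as the conjugate of the product of components.
  have hprod : b * (∏ d ∈ Finset.univ.filter (fun d : Fin (n + 1) => 0 < (d : ℕ)), c d) *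
      ((blkD β).det : ZMod N) = 1 := by
    refine σ.ext_proj hsq fun d => ?_
    have h1 : σ.proj d b = if d = Fin.last n then (w : ZMod (σ.part d)) ^ 2 else 1 := by
      split_ifs with hd
      · subst hd; rw [hb1, Int.cast_pow]
      · exact hb2 d hd
    have h2 : σ.proj d (∏ d ∈ Finset.univ.filter (fun d : Fin (n + 1) => 0 < (d : ℕ)), c d) =
        (v : ZMod (σ.part d)) ^ (d : ℕ) := by
      have h3 : ∀ d', d' ≠ d → σ.proj d (c d') = 1 := fun d' hd' => hc2 d' d hd'.symm
      rw [map_prod]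
      by_cases hd : 0 < (d : ℕ)
      · rw [Finset.prod_eq_single_of_mem d (by simpa using hd) fun d' _ => h3 d', hc1,
          Int.cast_pow]
      · rw [Finset.prod_eq_one fun d' hd' => h3 d' fun h4 => hd (h4 ▸ (Finset.mem_filter.1 hd').2)]
        rw [Nat.eq_zero_of_not_pos hd, pow_zero]
    rw [map_mul, map_mul, h1, h2, hdet, map_one]
    calc _ = ((v : ZMod (σ.part d)) * σ.proj d v') ^ (d : ℕ) *
          if d = Fin.last n then ((w : ZMod (σ.part d)) * σ.proj d w') ^ 2 else 1 := by
          rw [mul_pow]; split_ifs <;> ring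
      _ = 1 := by rw [hv1, hw1]; simp
  have hχ1 := congrArg χ hprod
  rw [map_mul, map_mul, map_prod, map_one, ← hb3] at hχ1
  simp only [← hc3] at hχ1
  have h5 := conj_chiSp_mul_chiSp χ hβ
  rw [← map_prod, ← map_mul]
  have h6 : chiSp χ β = χ ((blkD β).det : ZMod N) := rfl
  rw [← h6] at hχ1
  have h7 := mul_right_cancel₀ (right_ne_zero_of_mul_eq_one h5) (hχ1.trans h5.symm)
  rw [h7, Complex.conj_conj]

end SquareFree

end SiegelEis

theorem proposition5p1 (n k N : ℕ) (hn : 0 < n) (hN : 0 < N) (hk : n + 1 < k)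
    (χ : DirichletCharacter ℂ N) (hχ : χ (-1) = (-1 : ℂ) ^ k) (hNk : 2 < N ∨ Even k) :
    -- dependence on `v, w` modulo `N` only
    (∀ (M : SymMat n) (v w v' w' : ℤ), IsCoprime (v * w) (N : ℤ) →
      v' ≡ v [ZMOD (N : ℤ)] → w' ≡ w [ZMOD (N : ℤ)] →
        (∃ g ∈ Gamma n N, lower (twist v' w' M) = lower (twist v w M) * g) ∧
        eis k χ (lower (twist v w M)) = eis k χ (lower (twist v' w' M))) ∧
    -- dependence on the series only
    (∀ (M M' : SymMat n) (v w : ℤ), IsCoprime (v * w) (N : ℤ) →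
      eis k χ (lower M) = eis k χ (lower M') →
        eis k χ (lower (twist v w M)) = eis k χ (lower (twist v w M'))) ∧
    -- the resulting group action
    (∃ act : MulAction ((ZMod N)ˣ × (ZMod N)ˣ) (eisSet n k χ),
      ∀ (a b : (ZMod N)ˣ) (v w : ℤ), (v : ZMod N) = a → (w : ZMod N) = b →
        ∀ M : SymMat n, act.smul (a, b) (eisMem k χ M) = eisMem k χ (twist v w M)) ∧
    -- square-free level
    (∀ (hsq : Squarefree N) (σ : MulPartition n N) (M : SymMat n), IsRepOf M σ →
      ∀ v w : ℤ, IsCoprime (v * w) (N : ℤ) →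
        eis k χ (lower (twist v w M)) =
          (starRingEnd ℂ (partChar χ hsq σ (Fin.last n) ((w ^ 2 : ℤ) : ZMod _)) *
            ∏ d ∈ Finset.univ.filter (fun d : Fin (n + 1) => 0 < (d : ℕ)),
              starRingEnd ℂ (partChar χ hsq σ d ((v ^ (d : ℕ) : ℤ) : ZMod _))) •
          eis k χ (lower M)) := by
  refine ⟨fun M v w v₁ w₁ _ hv hw => ⟨exists_lower_eq_mul (toZ_twist_congr hv hw M),
      eis_lower_congr hn χ hχ (toZ_twist_congr hv hw M)⟩,
    fun M M' v w hvw h => ?_, exists_mulAction hn hN hk χ hχ, fun hsq σ M hM v w hvw => ?_⟩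
  · obtain ⟨⟨v', hv⟩, w', hw⟩ := isUnit_of_isCoprime_mul hvw
    exact eis_twist_congr hn hN hk χ hχ hv hw h
  · obtain ⟨⟨v', hv⟩, w', hw⟩ := isUnit_of_isCoprime_mul hvw
    exact eis_twist_squarefree hn χ hχ hsq σ hM hv hw
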